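/- **Setting.** Let $d\ge 2$ and let $\mathcal A$ be the quantum spin system on $\mathbb Z^2$ with one-site algebra $M_d(\mathbb C)$; for $\Gamma\subset\mathbb R^2$ let $\mathcal A_\Gamma\subset\mathcal A$ be the C\*-subalgebra generated by the sites in $\Gamma\cap\mathbb Z^2$, and $\Gamma^c=\mathbb R^2\setminus\Gamma$. Let $\omega$ be a pure state of $\mathcal A$ with GNS triple $(\mathcal H,\pi,\Omega)$. Let $G$ be a finite group with a unitary representation $U$ on $\mathbb C^d$ such that $g\mapsto \mathrm{Ad}\,U_g$ is faithful. For $\Gamma\subset\mathbb R^2$, $\beta^\Gamma_g$ denotes the automorphism of $\mathcal A$ acting as $\mathrm{Ad}\,U_g$ on each site in $\Gamma$ and trivially on the other sites; $\beta_g=\beta_g^{\mathbb R^2}$. Assume $\omega\circ\beta_g=\omega$ for all $g$, and let $R$ be a unitary representation of $G$ on $\mathcal H$ with $\mathrm{Ad}R_g\circ\pi=\pi\circ\beta_g$. **Cones.** Write $e_\theta=(\cos\theta,\sin\theta)$ and, for $a\in\mathbb R^2$, $\theta\in\mathbb R$, $\varphi\in(0,\pi)$, let $\Lambda_{a,\theta,\varphi}=\{x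 : (x-a)\cdot e_\theta>\|x-a\|\cos\varphi\}$ (a *cone*), with $\arg\Lambda_{a,\theta,\varphi}=\{e^{it}: |t-\theta|\le\varphi\}$, and $(\arg\Lambda_{a,\theta,\varphi})_\varepsilon=\{e^{it}:|t-\theta|\le\varphi+\varepsilon\}$. Let $\mathcal C^r=\{\Lambda_{(a,0),0,\varphi}: a\in\mathbb R,\ 0<\varphi<\pi\}$ and let $\mathcal C^l$ be the set of complements of the elements of $\mathcal C^r$; the element $(\Lambda_{(a,0),0,\pi-\varphi})^c$ of $\mathcal C^l$ is the closed cone with apex $(a,0)$, axis $-e_0$ and half-angle $\varphi$, and $\arg$ of it is $\arg\Lambda_{(a,0),\pi,\varphi}$. Let $PC$ be the set of $(\Lambda_1,\Lambda_2)\in\mathcal C^l\times\mathcal C^r$ with $\Lambda_1\cap\Lambda_2=\emptyset$ and $(\arg\Lambda_1)_\varepsilon\cap\arg\Lambda_2=\emptyset$ for some $\varepsilon>0$. Write $(\Lambda_1,\Lambda_2)\leftarrow(\Lambda_1',\Lambda_2')$ if $(\arg(\Lambda_1'^{\,c}))_\varepsilon\subset\arg\Lambda_2$ for some $\varepsilon>0$.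 **Algebras.** Let $\mathcal F$ be the norm closure of $\bigcup_{(\Lambda_1,\Lambda_2)\in PC}\pi(\mathcal A_{(\Lambda_1\cup\Lambda_2)^c})''$ and $\mathcal B_l$ the norm closure of $\bigcup_{\Lambda\in\mathcal C^l}\pi(\mathcal A_\Lambda)''$; these are C\*-algebras, and $\mathcal F\subset\mathcal B_l$. **Assumption (approximate Haag duality for right and left cones).** For all $\varphi\in(0,\pi/2)$ and $\varepsilon>0$ with $2\varphi+2\varepsilon<\pi$ there are $r>0$ and decreasing functions $f_\delta:[0,\infty)\to\mathbb R$, $\delta>0$, with $f_\delta(t)\to0$ as $t\to\infty$, such that for every $a\in\mathbb R$ there is a unitary $u$ on $\mathcal H$ with $$\pi(\mathcal A_{(\Lambda_{(a,0),0,\varphi})^c})'\subset u\,\pi(\mathcal A_{\Lambda_{(a-r,0),0,\varphi+\varepsilon}})''\,u^*$$ and, for all $\delta>0$ with $\varphi+\varepsilon+\delta<\pi$ and all $t\ge0$, a unitary $w\in\pi(\mathcal A_{\Lambda_{(a-t,0),0,\varphi+\varepsilon+\delta}})''\cap\mathcal F$ with $\|u-w\|\le f_\delta(t)$. Likewise for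 left cones: the same with $\Lambda_{(a,0),\pi,\varphi}$, $\Lambda_{(a+r,0),\pi,\varphi+\varepsilon}$ and $\Lambda_{(a+t,0),\pi,\varphi+\varepsilon+\delta}$ in place of the three cones. **Sectors.** Let $O$ be the set of representations $\rho$ of $\mathcal A$ on $\mathcal H$ such that for every cone $\Lambda$ there is a unitary $V$ on $\mathcal H$ with $\mathrm{Ad}V\circ\rho=\pi$ on $\mathcal A_{\Lambda^c}$. For $g\in G$ and $(\Lambda_1,\Lambda_2)\in PC$, let $\mathcal V^{(g)}_{\rho,(\Lambda_1,\Lambda_2)}$ be the set of unitaries $V\in\mathcal F$ (*charge transporters*) with $\mathrm{Ad}V\circ\rho=\pi\circ\beta_g^{\Lambda_1}$ on $\mathcal A_{\Lambda_1\cup\Lambda_2}$. Fix $(\Lambda^{(0)}_1,\Lambda^{(0)}_2)\in PC$, and let $O^{(g)}$ be the set of $\rho\in O$ such that $\mathcal V^{(g)}_{\rho,(\Lambda_1,\Lambda_2)}\ne\emptyset$ for all $(\Lambda_1,\Lambda_2)\in PC$ and $\mathbb I\in\mathcal V^{(g)}_{\rho,(\Lambda^{(0)}_1,\Lambda^{(0)}_2)}$.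 Let $\mathrm{Mor}_G(\rho,\sigma)=\{X\in\mathcal F: X\rho(A)=\sigma(A)X\ \text{for all}\ A\in\mathcal A\}$. For $\rho\in O^{(g)}$ let $S_\rho$ be the $*$-endomorphism of $\mathcal B_l$ with $S_\rho\circ\pi=\rho$ that is $\sigma$-weakly continuous on $\pi(\mathcal A_\Lambda)''$ for every $\Lambda\in\mathcal C^l$. Put $\rho\otimes\sigma=S_\rho S_\sigma\pi$, and $X\otimes Y=X\,S_\rho(Y)$ for $X,Y\in\mathcal F$, where $\rho$ is the source of $X$. Put $\Theta(k)(\rho)=\mathrm{Ad}R_k\circ\rho\circ\beta_{k^{-1}}$ and $\Theta(k)(X)=R_kXR_k^*$. **Claim.** $S_\rho$ exists and is unique for every $\rho\in O^{(g)}$; $\rho\otimes\sigma\in O^{(gh)}$ for $\rho\in O^{(g)}$, $\sigma\in O^{(h)}$; and $\Theta(k)(\rho)\in O^{(kgk^{-1})}$ for $\rho\in O^{(g)}$, $k\in G$. Moreover, for all $g,h\in G$, $\rho\in O^{(g)}$, $\sigma\in O^{(h)}$ there is a unitary $\epsilon_G(\rho,\sigma)\in\mathcal F$ such that for all $(\Lambda_{1\rho},\Lambda_{2\rho})\leftarrow(\Lambda_{1\sigma},\Lambda_{2\sigma})$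 in $PC$ and all choices of charge transporters $V_t\in\mathcal V^{(g)}_{\rho,(\Lambda_{1\rho}-te_0,\Lambda_{2\rho}-te_0)}$ and $W_s\in\mathcal V^{(h)}_{\sigma,(\Lambda_{1\sigma}+se_0,\Lambda_{2\sigma}+se_0)}$, $t,s\ge0$, $$\epsilon_G(\rho,\sigma)=\lim_{t,s\to\infty}\bigl(W_s\otimes\Theta(h^{-1})(V_t)\bigr)^*\bigl(V_t\otimes W_s\bigr)\quad\text{in norm},$$ where the sources of $V_t$ and $W_s$ in the tensor products are $\rho$ and $\sigma$; in particular the limit exists and does not depend on the choices. It satisfies the following, for all $g,h,k\in G$, $\rho,\rho'\in O^{(g)}$, $\sigma,\sigma'\in O^{(h)}$, $\gamma\in O^{(k)}$. 1. (Intertwining) $\epsilon_G(\rho,\sigma)\in\mathrm{Mor}_G\bigl(\rho\otimes\sigma,\ \sigma\otimes\Theta(h^{-1})(\rho)\bigr)$. 2. (First hexagon) $\epsilon_G(\rho\otimes\sigma,\gamma)=\bigl(\epsilon_G(\rho,\gamma)\otimes\mathrm{id}_{\Theta(k^{-1})(\sigma)}\bigr)\bigl(\mathrm{id}_\rho\otimes\epsilon_G(\sigma,\gamma)\bigr)$.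 3. (Second hexagon) $\epsilon_G(\rho,\sigma\otimes\gamma)=\bigl(\mathrm{id}_\sigma\otimes\epsilon_G(\Theta(h^{-1})(\rho),\gamma)\bigr)\bigl(\epsilon_G(\rho,\sigma)\otimes\mathrm{id}_\gamma\bigr)$. 4. (Naturality) $\epsilon_G(\rho',\sigma')(X\otimes Y)=\bigl(Y\otimes\Theta(h^{-1})(X)\bigr)\epsilon_G(\rho,\sigma)$ for $X\in\mathrm{Mor}_G(\rho,\rho')$, $Y\in\mathrm{Mor}_G(\sigma,\sigma')$. 5. (Equivariance) $\Theta(k)(\epsilon_G(\rho,\sigma))=\epsilon_G(\Theta(k)(\rho),\Theta(k)(\sigma))$. Here $\epsilon_G(\rho,\sigma)$ is taken with respect to the degrees in the stated sets: $(g,h)$ for $\rho\in O^{(g)}$, $\sigma\in O^{(h)}$, degree $gh$ for $\rho\otimes\sigma$, and degree $kgk^{-1}$ for $\Theta(k)(\rho)$. -/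

import Mathlib

open Filter Topology

namespace SpinSET

/-! ### The quantum spin system on `ℤ²` -/

/-- Configurations: basis labels of the formal product `⨂_{z ∈ ℤ²} ℂ^d`. -/
abbrev Config (d : ℕ) : Type := ℤ × ℤ → Fin d
/-- The auxiliary Hilbert space `ℓ²` over all configurations. It is only used to build the
quasi-local algebra concretely (a faithful representation of it). -/
abbrev ConfigSpace (d : ℕ) : Type := lp (fun _ : Config d => ℂ) 2

/-- The permutation of configurations that exchanges the values `i` and `j` at the site `z`. -/
def siteSwap {d : ℕ} (z : ℤ × ℤ) (i j : Fin d) : Equiv.Perm (Config d) :=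
  Function.Involutive.toPerm (fun s => Function.update s z (Equiv.swap i j (s z)))
    (fun s => by simp)

theorem siteSwap_apply {d : ℕ} (z : ℤ × ℤ) (i j : Fin d) (s : Config d) :
    siteSwap z i j s = Function.update s z (Equiv.swap i j (s z)) := rfl

theorem summable_unitFun {d : ℕ} (z : ℤ × ℤ) (i j : Fin d) (ψ : ConfigSpace d) :
    Summable (fun s : Config d => ‖if s z = i then ψ (siteSwap z i j s) else 0‖ ^ 2) ∧
      ∑' s : Config d, ‖if s z = i then ψ (siteSwap z i j s) else 0‖ ^ 2 ≤ ‖ψ‖ ^ 2 := by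
  have h := lp.hasSum_norm (p := 2) (by norm_num) ψ
  simp only [ENNReal.toReal_ofNat, Real.rpow_ofNat] at h
  have h' := (siteSwap z i j).hasSum_iff.mpr h
  have hle : ∀ s : Config d, ‖if s z = i then ψ (siteSwap z i j s) else 0‖ ^ 2 ≤
      ((fun s => ‖ψ s‖ ^ 2) ∘ siteSwap z i j) s := by
    intro s
    split_ifs <;> simp
  have hs := Summable.of_nonneg_of_le (fun s => by positivity) hle h'.summable
  exact ⟨hs, h'.tsum_eq ▸ hs.tsum_le_tsum hle h'.summable⟩

/-- The matrix unit `E_{ij}` acting at the site `z`. -/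
noncomputable def siteUnit {d : ℕ} (z : ℤ × ℤ) (i j : Fin d) : ConfigSpace d →L[ℂ] ConfigSpace d :=
  LinearMap.mkContinuous
    { toFun := fun ψ => ⟨fun s => if s z = i then ψ (siteSwap z i j s) else 0,
        memℓp_gen (by simpa using (summable_unitFun z i j ψ).1)⟩
      map_add' := fun ψ φ => by
        ext s
        change (if s z = i then (ψ + φ) (siteSwap z i j s) else 0) =
          (if s z = i then ψ (siteSwap z i j s) else 0) +
            (if s z = i then φ (siteSwap z i j s) else 0)
        split_ifs <;> simp
      map_smul' := fun c ψ => by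
        ext s; by_cases h : s z = i <;> simp [h] } 1
    (fun ψ => by
      refine lp.norm_le_of_tsum_le (p := 2) (by norm_num) (by positivity) ?_
      simpa using (summable_unitFun z i j ψ).2)

theorem siteUnit_apply {d : ℕ} (z : ℤ × ℤ) (i j : Fin d) (ψ : ConfigSpace d) (s : Config d) :
    siteUnit z i j ψ s = if s z = i then ψ (Function.update s z j) else 0 := by
  change (if s z = i then ψ (siteSwap z i j s) else 0) = _
  split_ifs with h
  · simp [siteSwap_apply, h]
  · rfl

theorem star_siteUnit {d : ℕ} (z : ℤ × ℤ) (i j : Fin d) :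
    star (siteUnit z i j) = siteUnit z j i := by
  rw [ContinuousLinearMap.star_eq_adjoint, eq_comm, ContinuousLinearMap.eq_adjoint_iff]
  intro ψ φ
  rw [lp.inner_eq_tsum, lp.inner_eq_tsum, ← (siteSwap z i j).tsum_eq]
  refine tsum_congr fun s => ?_
  rw [siteUnit_apply, siteUnit_apply]
  have h1 : (siteSwap z i j s) z = j ↔ s z = i := by
    simp [siteSwap_apply, Equiv.swap_apply_eq_iff]
  by_cases h : s z = i
  · have h2 : Function.update (siteSwap z i j s) z i = s := by
      subst h; simp [siteSwap_apply]
    have h3 : siteSwap z i j s = Function.update s z j := by simp [siteSwap_apply, h]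
    rw [if_pos h, if_pos (h1.2 h), h2, h3]
  · rw [if_neg h, if_neg (mt h1.1 h)]; simp

theorem siteSum_apply {d : ℕ} (z : ℤ × ℤ) (m : Matrix (Fin d) (Fin d) ℂ) (ψ : ConfigSpace d)
    (s : Config d) : (∑ i, ∑ j, m i j • siteUnit z i j) ψ s =
      ∑ j, m (s z) j * ψ (Function.update s z j) := by
  have h : ∀ (T : Finset (Fin d × Fin d)), (∑ p ∈ T, m p.1 p.2 • siteUnit z p.1 p.2) ψ s =
      ∑ p ∈ T, m p.1 p.2 * siteUnit z p.1 p.2 ψ s := by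
    intro T
    induction T using Finset.induction_on with
    | empty => simp
    | insert a T ha ih => rw [Finset.sum_insert ha, Finset.sum_insert ha, ← ih]; rfl
  have h' := h Finset.univ
  rw [Fintype.sum_prod_type, Fintype.sum_prod_type] at h'
  rw [h', Finset.sum_eq_single (s z)]
  · simp [siteUnit_apply]
  · intro i _ hi
    simp [siteUnit_apply, Ne.symm hi]
  · simp

/-- A `d × d` matrix acting at the site `z` (tensored with the identity elsewhere):
`(siteOp d z m ψ)(s) = ∑ j, m (s z) j * ψ (s with z ↦ j)`. -/
noncomputable def siteOp (d : ℕ) (z : ℤ × ℤ) :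
    Matrix (Fin d) (Fin d) ℂ →⋆ₐ[ℂ] (ConfigSpace d →L[ℂ] ConfigSpace d) where
  toFun m := ∑ i, ∑ j, m i j • siteUnit z i j
  map_one' := by
    ext ψ s
    rw [siteSum_apply]
    simp [Matrix.one_apply]
  map_mul' m n := by
    ext ψ s
    change _ = (∑ i, ∑ j, m i j • siteUnit z i j) ((∑ i, ∑ j, n i j • siteUnit z i j) ψ) s
    have h : ∀ j, (∑ k, ∑ l, n k l • siteUnit z k l) ψ (Function.update s z j) =
        ∑ l, n j l * ψ (Function.update s z l) := by
      intro j
      rw [siteSum_apply, Function.update_self]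
      exact Finset.sum_congr rfl fun l _ => by rw [Function.update_idem]
    rw [siteSum_apply, siteSum_apply, Finset.sum_congr rfl fun j _ => congrArg _ (h j)]
    simp only [Matrix.mul_apply, Finset.sum_mul, Finset.mul_sum]
    rw [Finset.sum_comm]
    simp only [mul_assoc]
  map_zero' := by simp
  map_add' m n := by simp [add_smul, Finset.sum_add_distrib]
  commutes' c := by
    ext ψ s
    rw [siteSum_apply]
    simp [Matrix.algebraMap_matrix_apply, ContinuousLinearMap.algebraMap_apply]
  map_star' m := by
    simp only [star_sum, star_smul, star_siteUnit, Matrix.star_apply]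
    rw [Finset.sum_comm]

theorem siteOp_apply (d : ℕ) (z : ℤ × ℤ) (m : Matrix (Fin d) (Fin d) ℂ) (ψ : ConfigSpace d)
    (s : Config d) :
    siteOp d z m ψ s = ∑ j, m (s z) j * ψ (Function.update s z j) :=
  siteSum_apply z m ψ s

theorem siteOp_commute (d : ℕ) {z w : ℤ × ℤ} (h : z ≠ w) (m n : Matrix (Fin d) (Fin d) ℂ) :
    siteOp d z m * siteOp d w n = siteOp d w n * siteOp d z m := by
  ext ψ s
  change siteOp d z m (siteOp d w n ψ) s = siteOp d w n (siteOp d z m ψ) s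
  simp only [siteOp_apply, Function.update_of_ne h, Function.update_of_ne h.symm, Finset.mul_sum]
  rw [Finset.sum_comm]
  refine Finset.sum_congr rfl fun i _ => Finset.sum_congr rfl fun j _ => ?_
  rw [Function.update_comm h]
  ring

/-- The real plane. -/
abbrev Plane : Type := EuclideanSpace ℝ (Fin 2)

/-- The lattice point `z ∈ ℤ²` as a point of the plane. -/
noncomputable def latticePt (z : ℤ × ℤ) : Plane := !₂[(z.1 : ℝ), (z.2 : ℝ)]

/-- The C*-algebra `𝒜_Γ` of a region `Γ ⊆ ℝ²`: the norm closure of the *-algebra generated by all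
matrices sitting at the lattice points of `Γ`, i.e. the inductive limit of the matrix algebras
`⨂_{z ∈ I} M_d` over the finite sets `I ⊆ Γ ∩ ℤ²`. -/
noncomputable def localOps (d : ℕ) (Γ : Set Plane) :
    StarSubalgebra ℂ (ConfigSpace d →L[ℂ] ConfigSpace d) :=
  (StarAlgebra.adjoin ℂ {x | ∃ z m, latticePt z ∈ Γ ∧ siteOp d z m = x}).topologicalClosure

instance isClosed_localOps (d : ℕ) (Γ : Set Plane) :
    IsClosed (localOps d Γ : Set (ConfigSpace d →L[ℂ] ConfigSpace d)) :=
  StarSubalgebra.isClosed_topologicalClosure _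

/-- The quasi-local algebra `𝒜 = 𝒜_{ℤ²}` of the two-dimensional quantum spin system. -/
def SpinAlg (d : ℕ) : Type := localOps d Set.univ

noncomputable instance instCStarAlgebraSpinAlg (d : ℕ) : CStarAlgebra (SpinAlg d) :=
  inferInstanceAs (CStarAlgebra (localOps d Set.univ))

/-- The concrete realisation of `𝒜` on the auxiliary Hilbert space. -/
noncomputable def SpinAlg.val (d : ℕ) : SpinAlg d →⋆ₐ[ℂ] (ConfigSpace d →L[ℂ] ConfigSpace d) :=
  (localOps d Set.univ).subtype

theorem SpinAlg.val_injective (d : ℕ) : Function.Injective (SpinAlg.val d) :=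
  Subtype.val_injective

theorem siteOp_mem (d : ℕ) (z : ℤ × ℤ) (m : Matrix (Fin d) (Fin d) ℂ) :
    siteOp d z m ∈ localOps d Set.univ :=
  StarSubalgebra.le_topologicalClosure _ (StarAlgebra.subset_adjoin ℂ _ ⟨z, m, trivial, rfl⟩)

/-- The embedding of `M_d` into `𝒜` as the algebra of the site `z`. -/
noncomputable def site (d : ℕ) (z : ℤ × ℤ) :
    Matrix (Fin d) (Fin d) ℂ →⋆ₐ[ℂ] SpinAlg d where
  toFun m := ⟨siteOp d z m, siteOp_mem d z m⟩
  map_one' := Subtype.ext (map_one _)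
  map_mul' _ _ := Subtype.ext (map_mul _ _ _)
  map_zero' := Subtype.ext (map_zero _)
  map_add' _ _ := Subtype.ext (map_add _ _ _)
  commutes' c := Subtype.ext (AlgHomClass.commutes (siteOp d z) c)
  map_star' _ := Subtype.ext (map_star _ _)

theorem site_commute (d : ℕ) {z w : ℤ × ℤ} (h : z ≠ w) (m n : Matrix (Fin d) (Fin d) ℂ) :
    site d z m * site d w n = site d w n * site d z m :=
  Subtype.ext (siteOp_commute d h m n)

/-- The local algebra `𝒜_Γ` as a subalgebra of `𝒜`. -/
noncomputable def localAlg (d : ℕ) (Γ : Set Plane) : StarSubalgebra ℂ (SpinAlg d) :=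
  (localOps d Γ).comap (SpinAlg.val d)

theorem spinAlg_induction {d : ℕ} {P : SpinAlg d → Prop} (hclosed : IsClosed {x | P x})
    (hsite : ∀ z m, P (site d z m)) (hsc : ∀ c : ℂ, P (algebraMap ℂ _ c))
    (hadd : ∀ x y, P x → P y → P (x + y)) (hmul : ∀ x y, P x → P y → P (x * y))
    (hstar : ∀ x, P x → P (star x)) (x : SpinAlg d) : P x := by
  have hcl : IsClosed (SpinAlg.val d '' {x : SpinAlg d | P x}) :=
    (isClosed_localOps d Set.univ).isClosedEmbedding_subtypeVal.isClosedMap _ hclosed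
  have hsub : ((StarAlgebra.adjoin ℂ {x | ∃ z m, latticePt z ∈ Set.univ ∧ siteOp d z m = x} :
      StarSubalgebra ℂ _) : Set (ConfigSpace d →L[ℂ] ConfigSpace d)) ⊆
      SpinAlg.val d '' {x : SpinAlg d | P x} := by
    intro y hy
    refine StarAlgebra.adjoin_induction
      (p := fun y _ => y ∈ SpinAlg.val d '' {x : SpinAlg d | P x}) ?_ ?_ ?_ ?_ ?_ hy
    · rintro _ ⟨z, m, -, rfl⟩
      exact ⟨site d z m, hsite z m, rfl⟩
    · exact fun c => ⟨algebraMap ℂ _ c, hsc c, AlgHomClass.commutes _ c⟩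
    · rintro _ _ _ _ ⟨a, ha, rfl⟩ ⟨b, hb, rfl⟩
      exact ⟨a + b, hadd a b ha hb, map_add _ _ _⟩
    · rintro _ _ _ _ ⟨a, ha, rfl⟩ ⟨b, hb, rfl⟩
      exact ⟨a * b, hmul a b ha hb, map_mul _ _ _⟩
    · rintro _ _ ⟨a, ha, rfl⟩
      exact ⟨star a, hstar a ha, map_star _ _⟩
  obtain ⟨y, hy, hyx⟩ := closure_minimal hsub hcl x.2
  exact (SpinAlg.val_injective d hyx : y = x) ▸ hy

/-- A unitary matrix at the site `z`, as a unitary of `𝒜`. -/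
noncomputable def siteUnitary {d : ℕ} (z : ℤ × ℤ) (u : Matrix.unitaryGroup (Fin d) ℂ) :
    unitary (SpinAlg d) :=
  ⟨site d z u, by
    rw [Unitary.mem_iff, ← map_star, ← map_mul, ← map_mul, (Unitary.mem_iff.1 u.2).1,
      (Unitary.mem_iff.1 u.2).2, map_one]
    exact ⟨rfl, rfl⟩⟩

/-- The product of the unitaries `v z` over the first `n` sites in an enumeration of `ℤ²`. -/
noncomputable def prodUnitary {d : ℕ} (v : ℤ × ℤ → Matrix.unitaryGroup (Fin d) ℂ) :
    ℕ → unitary (SpinAlg d)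
  | 0 => 1
  | n + 1 => siteUnitary ((Denumerable.eqv (ℤ × ℤ)).symm n)
      (v ((Denumerable.eqv (ℤ × ℤ)).symm n)) * prodUnitary v n

theorem prodUnitary_conj {d : ℕ} (v : ℤ × ℤ → Matrix.unitaryGroup (Fin d) ℂ)
    (z : ℤ × ℤ) (m : Matrix (Fin d) (Fin d) ℂ) (n : ℕ) :
    Unitary.conjStarAlgAut ℂ _ (prodUnitary v n) (site d z m) =
      if Denumerable.eqv (ℤ × ℤ) z < n then
        site d z ((v z : Matrix (Fin d) (Fin d) ℂ) * m * star (v z : Matrix (Fin d) (Fin d) ℂ))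
      else site d z m := by
  induction n with
  | zero => simp [prodUnitary]
  | succ n ih =>
    set w := (Denumerable.eqv (ℤ × ℤ)).symm n with hw
    have hwn : Denumerable.eqv (ℤ × ℤ) w = n := by simp [hw]
    rw [prodUnitary, Unitary.conjStarAlgAut_mul_apply, ih, ← hw]
    have h1 : ∀ x, Unitary.conjStarAlgAut ℂ _ (siteUnitary w (v w)) (site d w x) =
        site d w ((v w : Matrix (Fin d) (Fin d) ℂ) * x *
          star (v w : Matrix (Fin d) (Fin d) ℂ)) := fun x => by
      rw [Unitary.conjStarAlgAut_apply, siteUnitary, ← map_star, ← map_mul, ← map_mul]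
    by_cases hz : z = w
    · rw [← hz] at hwn h1
      rw [if_neg (by omega), if_pos (by omega), ← hz, h1]
    · have hne : Denumerable.eqv (ℤ × ℤ) z ≠ n := by
        rw [← hwn]; exact fun h => hz ((Denumerable.eqv _).injective h)
      have h3 : ∀ x, Unitary.conjStarAlgAut ℂ _ (siteUnitary w (v w)) (site d z x) =
          site d z x := fun x => by
        rw [Unitary.conjStarAlgAut_apply, siteUnitary, site_commute d (Ne.symm hz), mul_assoc,
          ← map_star, ← map_mul, (Unitary.mem_iff.1 (v w).2).2, map_one, mul_one]
      by_cases hlt : Denumerable.eqv (ℤ × ℤ) z < n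
      · rw [if_pos hlt, if_pos (by omega), h3]
      · rw [if_neg hlt, if_neg (by omega), h3]

theorem exists_limit {d : ℕ} (v : ℤ × ℤ → Matrix.unitaryGroup (Fin d) ℂ) (x : SpinAlg d) :
    ∃ y : SpinAlg d, Tendsto (fun n => Unitary.conjStarAlgAut ℂ _ (prodUnitary v n) x)
      atTop (𝓝 y) := by
  refine spinAlg_induction (P := fun x => ∃ y : SpinAlg d, Tendsto
    (fun n => Unitary.conjStarAlgAut ℂ _ (prodUnitary v n) x) atTop (𝓝 y)) ?_ ?_ ?_ ?_ ?_ ?_ x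
  · have hiso : ∀ n (x y : SpinAlg d), dist (Unitary.conjStarAlgAut ℂ _ (prodUnitary v n) x)
        (Unitary.conjStarAlgAut ℂ _ (prodUnitary v n) y) = dist x y := by
      intro n x y
      rw [dist_eq_norm, ← map_sub, Unitary.conjStarAlgAut_apply, ← Unitary.coe_star,
        CStarRing.norm_mul_coe_unitary, CStarRing.norm_coe_unitary_mul, dist_eq_norm]
    refine isClosed_of_closure_subset fun x hx => ?_
    refine cauchySeq_tendsto_of_complete (Metric.cauchySeq_iff.2 fun ε hε => ?_)
    obtain ⟨y, ⟨l, hl⟩, hxy⟩ := Metric.mem_closure_iff.1 hx (ε / 3) (by positivity)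
    obtain ⟨N, hN⟩ := Metric.cauchySeq_iff.1 hl.cauchySeq (ε / 3) (by positivity)
    refine ⟨N, fun m hm n hn => ?_⟩
    have h1 := hN m hm n hn
    have h2 := hiso m x y
    have h3 := hiso n y x
    rw [dist_comm y x] at h3
    have h4 := dist_triangle4 (Unitary.conjStarAlgAut ℂ _ (prodUnitary v m) x)
      (Unitary.conjStarAlgAut ℂ _ (prodUnitary v m) y)
      (Unitary.conjStarAlgAut ℂ _ (prodUnitary v n) y)
      (Unitary.conjStarAlgAut ℂ _ (prodUnitary v n) x)
    linarith
  · intro z m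
    refine ⟨site d z ((v z : Matrix (Fin d) (Fin d) ℂ) * m *
      star (v z : Matrix (Fin d) (Fin d) ℂ)), tendsto_const_nhds.congr' ?_⟩
    filter_upwards [eventually_gt_atTop (Denumerable.eqv (ℤ × ℤ) z)] with n hn
    rw [prodUnitary_conj, if_pos hn]
  · intro c
    exact ⟨algebraMap ℂ _ c, tendsto_const_nhds.congr fun n => (AlgHomClass.commutes _ c).symm⟩
  · rintro x y ⟨a, ha⟩ ⟨b, hb⟩
    exact ⟨a + b, (ha.add hb).congr fun n => (map_add _ _ _).symm⟩
  · rintro x y ⟨a, ha⟩ ⟨b, hb⟩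
    exact ⟨a * b, (ha.mul hb).congr fun n => (map_mul _ _ _).symm⟩
  · rintro x ⟨a, ha⟩
    exact ⟨star a, ha.star.congr fun n => (map_star _ _).symm⟩

theorem hom_ext_site {d : ℕ} {f g : SpinAlg d →⋆ₐ[ℂ] SpinAlg d}
    (h : ∀ z m, f (site d z m) = g (site d z m)) : f = g := by
  ext1 x
  refine spinAlg_induction (P := fun x => f x = g x) ?_ h ?_ ?_ ?_ ?_ x
  · exact isClosed_eq (AddMonoidHomClass.continuous_of_bound f 1 fun x => by
      simpa using NonUnitalStarAlgHom.norm_apply_le f x) (AddMonoidHomClass.continuous_of_bound g 1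
      fun x => by simpa using NonUnitalStarAlgHom.norm_apply_le g x)
  · intro c; rw [AlgHomClass.commutes, AlgHomClass.commutes]
  · intro x y hx hy; rw [map_add, map_add, hx, hy]
  · intro x y hx hy; rw [map_mul, map_mul, hx, hy]
  · intro x hx; rw [map_star, map_star, hx]

theorem exists_productHom {d : ℕ} (v : ℤ × ℤ → Matrix.unitaryGroup (Fin d) ℂ) :
    ∃ β : SpinAlg d →⋆ₐ[ℂ] SpinAlg d, ∀ z m, β (site d z m) =
      site d z ((v z : Matrix (Fin d) (Fin d) ℂ) * m * star (v z : Matrix (Fin d) (Fin d) ℂ)) := by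
  choose β hβ using exists_limit v
  refine ⟨⟨⟨⟨⟨⟨β, ?_⟩, ?_⟩, ?_, ?_⟩, ?_⟩, ?_⟩, ?_⟩
  · exact tendsto_nhds_unique (hβ 1) (tendsto_const_nhds.congr fun n => (map_one _).symm)
  · exact fun x y => tendsto_nhds_unique (hβ _)
      (((hβ x).mul (hβ y)).congr fun n => (map_mul _ _ _).symm)
  · exact tendsto_nhds_unique (hβ 0) (tendsto_const_nhds.congr fun n => (map_zero _).symm)
  · exact fun x y => tendsto_nhds_unique (hβ _)
      (((hβ x).add (hβ y)).congr fun n => (map_add _ _ _).symm)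
  · exact fun c => tendsto_nhds_unique (hβ _)
      (tendsto_const_nhds.congr fun n => (AlgHomClass.commutes _ c).symm)
  · exact fun x => tendsto_nhds_unique (hβ _) ((hβ x).star.congr fun n => (map_star _ _).symm)
  · intro z m
    refine tendsto_nhds_unique (hβ _) (tendsto_const_nhds.congr' ?_)
    filter_upwards [eventually_gt_atTop (Denumerable.eqv (ℤ × ℤ) z)] with n hn
    rw [prodUnitary_conj, if_pos hn]

theorem existsUnique_productAut {d : ℕ} (v : ℤ × ℤ → Matrix.unitaryGroup (Fin d) ℂ) :
    ∃! β : SpinAlg d ≃⋆ₐ[ℂ] SpinAlg d, ∀ z m, β (site d z m) =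
      site d z ((v z : Matrix (Fin d) (Fin d) ℂ) * m * star (v z : Matrix (Fin d) (Fin d) ℂ)) := by
  obtain ⟨f, hf⟩ := exists_productHom v
  obtain ⟨g, hg⟩ := exists_productHom fun z => (v z)⁻¹
  have hv1 : ∀ z, (v z : Matrix (Fin d) (Fin d) ℂ) * star (v z : Matrix (Fin d) (Fin d) ℂ) = 1 :=
    fun z => (Unitary.mem_iff.1 (v z).2).2
  have hv2 : ∀ z, star (v z : Matrix (Fin d) (Fin d) ℂ) * (v z : Matrix (Fin d) (Fin d) ℂ) = 1 :=
    fun z => (Unitary.mem_iff.1 (v z).2).1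
  have hg' : ∀ z m, g (site d z m) =
      site d z (star (v z : Matrix (Fin d) (Fin d) ℂ) * m * (v z : Matrix (Fin d) (Fin d) ℂ)) := by
    intro z m
    rw [hg, Matrix.UnitaryGroup.inv_val, star_star]
  have hfg : f.comp g = StarAlgHom.id ℂ _ := hom_ext_site fun z m => by
    rw [StarAlgHom.comp_apply, hg', hf]
    change _ = site d z m
    congr 1
    rw [← mul_assoc, ← mul_assoc, hv1, one_mul, mul_assoc, hv1, mul_one]
  have hgf : g.comp f = StarAlgHom.id ℂ _ := hom_ext_site fun z m => by
    rw [StarAlgHom.comp_apply, hf, hg']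
    change _ = site d z m
    congr 1
    rw [← mul_assoc, ← mul_assoc, hv2, one_mul, mul_assoc, hv2, mul_one]
  refine ⟨StarAlgEquiv.ofStarAlgHom f g hgf hfg, hf, fun β hβ => ?_⟩
  have h : (β : SpinAlg d →⋆ₐ[ℂ] SpinAlg d) = f := hom_ext_site fun z m => by
    rw [hf]; exact hβ z m
  ext1 x
  exact congrArg (fun k : SpinAlg d →⋆ₐ[ℂ] SpinAlg d => k x) h

/-- The on-site action of `g` on the region `Γ`: the unique automorphism of `𝒜` that acts as
`Ad (U g)` at every site of `Γ` and trivially at every other site. Restricted to `𝒜_Γ` it is the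
product action `β_g^Γ`; the automorphism `β_g` is the case `Γ = Set.univ`. -/
noncomputable def onSite {d : ℕ} {G : Type*} [Group G] (U : G →* Matrix.unitaryGroup (Fin d) ℂ)
    (Γ : Set Plane) (g : G) : SpinAlg d ≃⋆ₐ[ℂ] SpinAlg d :=
  open Classical in
  (existsUnique_productAut fun z => if latticePt z ∈ Γ then U g else 1).choose

theorem onSite_site {d : ℕ} {G : Type*} [Group G] (U : G →* Matrix.unitaryGroup (Fin d) ℂ)
    (Γ : Set Plane) (g : G) (z : ℤ × ℤ) (m : Matrix (Fin d) (Fin d) ℂ) [Decidable (latticePt z ∈ Γ)] :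
    onSite U Γ g (site d z m) = if latticePt z ∈ Γ then
      site d z ((U g : Matrix (Fin d) (Fin d) ℂ) * m * star (U g : Matrix (Fin d) (Fin d) ℂ))
      else site d z m := by
  classical
  have h := (existsUnique_productAut fun z => if latticePt z ∈ Γ then U g else 1).choose_spec.1 z m
  refine Eq.trans (b := _) (by rw [onSite]) (h.trans ?_)
  by_cases hz : latticePt z ∈ Γ <;> simp [hz]

/-! ### States and representations -/

/-- States of `𝒜`: normalised positive linear functionals. -/
def stateSpace (d : ℕ) : Set (SpinAlg d →ₗ[ℂ] ℂ) :=
  {ω | ω 1 = 1 ∧ ∀ A, ∃ r : ℝ, 0 ≤ r ∧ ω (star A * A) = r}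

/-- Pure states: extreme points of the state space. -/
def IsPureState {d : ℕ} (ω : SpinAlg d →ₗ[ℂ] ℂ) : Prop :=
  ω ∈ (stateSpace d).extremePoints ℝ

section Representations

variable {d : ℕ} {H : Type*} [NormedAddCommGroup H] [InnerProductSpace ℂ H] [CompleteSpace H]

/-- `(H, π, Ω)` is a GNS triple of `ω`. -/
structure IsGNSTriple (ω : SpinAlg d →ₗ[ℂ] ℂ) (π : SpinAlg d →⋆ₐ[ℂ] (H →L[ℂ] H)) (Ω : H) :
    Prop where
  cyclic : DenseRange fun A => π A Ω
  vector_state : ∀ A, ω A = inner ℂ Ω (π A Ω)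

/-- The commutant `π(𝒜_Γ)'`. -/
noncomputable def commutant (π : SpinAlg d →⋆ₐ[ℂ] (H →L[ℂ] H)) (Γ : Set Plane) :
    StarSubalgebra ℂ (H →L[ℂ] H) :=
  StarSubalgebra.centralizer ℂ (π '' localAlg d Γ)

/-- The von Neumann algebra `π(𝒜_Γ)''`. -/
noncomputable def vNAlg (π : SpinAlg d →⋆ₐ[ℂ] (H →L[ℂ] H)) (Γ : Set Plane) :
    StarSubalgebra ℂ (H →L[ℂ] H) :=
  StarSubalgebra.centralizer ℂ (commutant π Γ)

theorem localAlg_mono {Γ₁ Γ₂ : Set Plane} (h : Γ₁ ⊆ Γ₂) : localAlg d Γ₁ ≤ localAlg d Γ₂ := by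
  intro x hx
  refine StarSubalgebra.topologicalClosure_mono (StarAlgebra.adjoin_mono ?_) hx
  rintro _ ⟨z, m, hz, rfl⟩
  exact ⟨z, m, h hz, rfl⟩

theorem vNAlg_mono (π : SpinAlg d →⋆ₐ[ℂ] (H →L[ℂ] H)) {Γ₁ Γ₂ : Set Plane} (h : Γ₁ ⊆ Γ₂) :
    vNAlg π Γ₁ ≤ vNAlg π Γ₂ :=
  StarSubalgebra.centralizer_le _ _ _
    (StarSubalgebra.centralizer_le _ _ _ (Set.image_mono (localAlg_mono h)))

theorem map_mem_vNAlg (π : SpinAlg d →⋆ₐ[ℂ] (H →L[ℂ] H)) {Γ : Set Plane} {A : SpinAlg d}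
    (hA : A ∈ localAlg d Γ) : π A ∈ vNAlg π Γ := by
  rw [vNAlg, StarSubalgebra.mem_centralizer_iff]
  intro g hg
  have hg' := StarSubalgebra.mem_centralizer_iff ℂ |>.1 hg (π A) ⟨A, hA, rfl⟩
  have hg2 := StarSubalgebra.mem_centralizer_iff ℂ |>.1 (star_mem hg) (π A) ⟨A, hA, rfl⟩
  exact ⟨hg'.1.symm, hg2.1.symm⟩

/-- The σ-weak (ultraweak) topology on `B(H)`, i.e. the initial topology for all functionals
`x ↦ ∑ₙ ⟪ξₙ, x ηₙ⟫` with `∑ₙ ‖ξₙ‖² < ∞` and `∑ₙ ‖ηₙ‖² < ∞`. -/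
@[reducible] noncomputable def sigmaWeak (H : Type*) [NormedAddCommGroup H] [InnerProductSpace ℂ H] :
    TopologicalSpace (H →L[ℂ] H) :=
  ⨅ p : lp (fun _ : ℕ => H) 2 × lp (fun _ : ℕ => H) 2,
    TopologicalSpace.induced (fun x => ∑' n, inner ℂ (p.1 n) (x (p.2 n))) inferInstance

end Representations

/-! ### Cones -/

/-- The unit vector `e_θ = (cos θ, sin θ)`. -/
noncomputable def dir (θ : ℝ) : Plane := !₂[Real.cos θ, Real.sin θ]

/-- The open cone with apex `a`, axis `e_θ` and half opening angle `φ`. -/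
def cone (a : Plane) (θ φ : ℝ) : Set Plane :=
  {x | ‖x - a‖ * Real.cos φ < inner ℝ (x - a) (dir θ)}

/-- The point `(a, 0)`. -/
noncomputable def onAxis (a : ℝ) : Plane := !₂[a, 0]

/-- The right cones, `𝒞^r = {rightCone a φ | a ∈ ℝ, 0 < φ < π}`. -/
def rightCone (a φ : ℝ) : Set Plane := cone (onAxis a) 0 φ

/-- The left cones, `𝒞^l = {leftCone a φ | a ∈ ℝ, 0 < φ < π}`: the complements of the right cones.
`leftCone a φ` is the closed cone with apex `(a, 0)`, axis `-e_0` and half opening angle `φ`. -/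
def leftCone (a φ : ℝ) : Set Plane := (rightCone a (Real.pi - φ))ᶜ

/-- The arc `{e^{it} | θ - φ ≤ t ≤ θ + φ}` of the unit circle: the directions `arg Λ` of a cone `Λ`
with axis `e_θ` and half opening angle `φ`; its `ε`-fattening is `arc θ (φ + ε)`. -/
def arc (θ φ : ℝ) : Set Circle := Circle.exp '' Set.Icc (θ - φ) (θ + φ)

/-- The set `PC` of pairs `(Λ₁, Λ₂)` of a left cone and a right cone that are disjoint and have
separated sets of directions. -/
structure ConePair where
  a₁ : ℝ
  φ₁ : ℝ
  a₂ : ℝ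
  φ₂ : ℝ
  angle₁ : φ₁ ∈ Set.Ioo 0 Real.pi
  angle₂ : φ₂ ∈ Set.Ioo 0 Real.pi
  disjoint : Disjoint (leftCone a₁ φ₁) (rightCone a₂ φ₂)
  separated : ∃ ε > 0, Disjoint (arc Real.pi (φ₁ + ε)) (arc 0 φ₂)

theorem mem_rightCone {a φ : ℝ} {x : Plane} :
    x ∈ rightCone a φ ↔ ‖x - onAxis a‖ * Real.cos φ < x 0 - a := by
  simp [rightCone, cone, dir, onAxis, PiLp.inner_apply, Fin.sum_univ_two]

theorem rightCone_mono {a a' φ φ' : ℝ} (ha : a' ≤ a) (h0 : 0 ≤ φ) (hφ : φ ≤ φ')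
    (hπ : φ' ≤ Real.pi) : rightCone a φ ⊆ rightCone a' φ' := by
  intro x hx
  rw [mem_rightCone] at hx ⊢
  have hcos : Real.cos φ' ≤ Real.cos φ := Real.cos_le_cos_of_nonneg_of_le_pi h0 hπ hφ
  have hd : ‖onAxis a - onAxis a'‖ = a - a' := by
    rw [EuclideanSpace.norm_eq]
    simp [onAxis, Fin.sum_univ_two, Real.sqrt_sq_eq_abs, abs_of_nonneg (sub_nonneg.2 ha)]
  have h1 : |‖x - onAxis a'‖ - ‖x - onAxis a‖| ≤ a - a' := by
    rw [← hd]
    refine (abs_norm_sub_norm_le _ _).trans (le_of_eq ?_)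
    congr 1
    abel
  have h2 : (‖x - onAxis a'‖ - ‖x - onAxis a‖) * Real.cos φ' ≤ a - a' := by
    refine (le_abs_self _).trans ?_
    rw [abs_mul]
    calc _ ≤ (a - a') * 1 := mul_le_mul h1 (Real.abs_cos_le_one _) (abs_nonneg _)
          (sub_nonneg.2 ha)
      _ = a - a' := mul_one _
  have h3 : ‖x - onAxis a‖ * Real.cos φ' ≤ ‖x - onAxis a‖ * Real.cos φ :=
    mul_le_mul_of_nonneg_left hcos (norm_nonneg _)
  linarith

theorem leftCone_mono {a a' φ φ' : ℝ} (ha : a ≤ a') (h0 : 0 ≤ φ) (hφ : φ ≤ φ')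
    (hπ : φ' ≤ Real.pi) : leftCone a φ ⊆ leftCone a' φ' :=
  Set.compl_subset_compl.2 (rightCone_mono ha (by linarith) (by linarith) (by linarith))

theorem shift_mem_rightCone {a φ t : ℝ} {x : Plane} :
    x ∈ rightCone (a + t) φ ↔ x - onAxis t ∈ rightCone a φ := by
  have h : x - onAxis (a + t) = x - onAxis t - onAxis a := by
    ext i; fin_cases i <;> simp [onAxis]; ring
  rw [mem_rightCone, mem_rightCone, h]
  simp only [onAxis, PiLp.sub_apply]
  constructor <;> intro h <;> simp at h ⊢ <;> linarith

theorem arc_mono {θ φ φ' : ℝ} (h : φ ≤ φ') : arc θ φ ⊆ arc θ φ' :=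
  Set.image_mono (Set.Icc_subset_Icc (by linarith) (by linarith))

namespace ConePair

/-- The left cone of a pair. -/
def left (P : ConePair) : Set Plane := leftCone P.a₁ P.φ₁

/-- The right cone of a pair. -/
def right (P : ConePair) : Set Plane := rightCone P.a₂ P.φ₂

/-- The translate `(Λ₁ + t e_0, Λ₂ + t e_0)` of a pair. -/
def shift (P : ConePair) (t : ℝ) : ConePair where
  a₁ := P.a₁ + t
  φ₁ := P.φ₁
  a₂ := P.a₂ + t
  φ₂ := P.φ₂
  angle₁ := P.angle₁
  angle₂ := P.angle₂
  disjoint := by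
    rw [Set.disjoint_left]
    intro x hx hx'
    rw [shift_mem_rightCone] at hx'
    rw [leftCone, Set.mem_compl_iff, shift_mem_rightCone] at hx
    exact Set.disjoint_left.1 P.disjoint hx hx'
  separated := P.separated

/-- The relation `{P} ← {Q}`: the directions of an `ε`-fattening of the complement of the left cone
of `Q` are among the directions of the right cone of `P`. The complement of the left cone of `Q` is
the right cone of half opening angle `π - φ₁`. -/
def Precedes (P Q : ConePair) : Prop :=
  ∃ ε > 0, arc 0 (Real.pi - Q.φ₁ + ε) ⊆ arc 0 P.φ₂

end ConePair

/-! ### The algebras `ℱ` and `ℬ_l` -/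

section Algebras

variable {d : ℕ} {H : Type*} [NormedAddCommGroup H] [InnerProductSpace ℂ H] [CompleteSpace H]

/-- The C*-algebra `ℱ`, the norm closure of the (directed) union of the algebras
`π(𝒜_{(Λ₁ ∪ Λ₂)ᶜ})''` over all `(Λ₁, Λ₂) ∈ PC`; see `coe_algF`. -/
noncomputable def algF (π : SpinAlg d →⋆ₐ[ℂ] (H →L[ℂ] H)) : StarSubalgebra ℂ (H →L[ℂ] H) :=
  (⨆ P : ConePair, vNAlg π (P.left ∪ P.right)ᶜ).topologicalClosure

/-- The C*-algebra `ℬ_l`, the norm closure of the (directed) union of the algebras `π(𝒜_Λ)''` over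
all left cones `Λ`; see `coe_algBl`. -/
noncomputable def algBl (π : SpinAlg d →⋆ₐ[ℂ] (H →L[ℂ] H)) : StarSubalgebra ℂ (H →L[ℂ] H) :=
  (⨆ p : ℝ × Set.Ioo (0 : ℝ) Real.pi, vNAlg π (leftCone p.1 p.2)).topologicalClosure

instance : Nonempty ConePair := by
  have hpi := Real.pi_pos
  refine ⟨⟨0, Real.pi / 4, 0, Real.pi / 4, ⟨by linarith, by linarith⟩, ⟨by linarith, by linarith⟩,
    ?_, Real.pi / 4, by linarith, ?_⟩⟩
  · exact Set.disjoint_compl_left_iff_subset.2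
      (rightCone_mono le_rfl (by linarith) (by linarith) (by linarith))
  · rw [Set.disjoint_left]
    rintro _ ⟨t, ht, rfl⟩ ⟨s, hs, hst⟩
    obtain ⟨k, hk⟩ := Circle.exp_eq_exp.1 hst
    have h1 := ht.1
    have h2 := ht.2
    have h3 := hs.1
    have h4 := hs.2
    have h5 : (-1 : ℝ) < k := by
      by_contra hcon
      nlinarith
    have h6 : (k : ℝ) < 0 := by
      by_contra hcon
      nlinarith
    have h7 : (-1 : ℤ) < k := by exact_mod_cast h5
    have h8 : k < 0 := by exact_mod_cast h6
    omega

theorem coe_algF (π : SpinAlg d →⋆ₐ[ℂ] (H →L[ℂ] H)) :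
    (algF π : Set (H →L[ℂ] H)) =
      closure (⋃ P : ConePair, (vNAlg π (P.left ∪ P.right)ᶜ : Set (H →L[ℂ] H))) := by
  rw [algF, StarSubalgebra.topologicalClosure_coe, StarSubalgebra.coe_iSup_of_directed]
  intro P Q
  obtain ⟨ε, hε, hs⟩ := P.separated
  have hl : leftCone (min P.a₁ Q.a₁) (min P.φ₁ Q.φ₁) ⊆ P.left :=
    leftCone_mono (min_le_left _ _) (le_min P.angle₁.1.le Q.angle₁.1.le) (min_le_left _ _)
      P.angle₁.2.le
  have hl' : leftCone (min P.a₁ Q.a₁) (min P.φ₁ Q.φ₁) ⊆ Q.left :=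
    leftCone_mono (min_le_right _ _) (le_min P.angle₁.1.le Q.angle₁.1.le) (min_le_right _ _)
      Q.angle₁.2.le
  have hr : rightCone (max P.a₂ Q.a₂) (min P.φ₂ Q.φ₂) ⊆ P.right :=
    rightCone_mono (le_max_left _ _) (le_min P.angle₂.1.le Q.angle₂.1.le) (min_le_left _ _)
      P.angle₂.2.le
  have hr' : rightCone (max P.a₂ Q.a₂) (min P.φ₂ Q.φ₂) ⊆ Q.right :=
    rightCone_mono (le_max_right _ _) (le_min P.angle₂.1.le Q.angle₂.1.le) (min_le_right _ _)
      Q.angle₂.2.le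
  refine ⟨⟨min P.a₁ Q.a₁, min P.φ₁ Q.φ₁, max P.a₂ Q.a₂, min P.φ₂ Q.φ₂,
    ⟨lt_min P.angle₁.1 Q.angle₁.1, min_lt_of_left_lt P.angle₁.2⟩,
    ⟨lt_min P.angle₂.1 Q.angle₂.1, min_lt_of_left_lt P.angle₂.2⟩,
    P.disjoint.mono hl hr, ε, hε, hs.mono ?_ ?_⟩, ?_, ?_⟩
  · exact arc_mono (by linarith [min_le_left P.φ₁ Q.φ₁])
  · exact arc_mono (min_le_left _ _)
  · exact vNAlg_mono π (Set.compl_subset_compl.2 (Set.union_subset_union hl hr))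
  · exact vNAlg_mono π (Set.compl_subset_compl.2 (Set.union_subset_union hl' hr'))

theorem coe_algBl (π : SpinAlg d →⋆ₐ[ℂ] (H →L[ℂ] H)) :
    (algBl π : Set (H →L[ℂ] H)) = closure (⋃ p : ℝ × Set.Ioo (0 : ℝ) Real.pi,
      (vNAlg π (leftCone p.1 p.2) : Set (H →L[ℂ] H))) := by
  have hpi := Real.pi_pos
  have : Nonempty (Set.Ioo (0 : ℝ) Real.pi) := ⟨⟨Real.pi / 2, by linarith, by linarith⟩⟩
  rw [algBl, StarSubalgebra.topologicalClosure_coe, StarSubalgebra.coe_iSup_of_directed]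
  rintro ⟨a, φ⟩ ⟨b, ψ⟩
  refine ⟨⟨max a b, max φ ψ⟩, vNAlg_mono π ?_, vNAlg_mono π ?_⟩
  · exact leftCone_mono (le_max_left _ _) φ.2.1.le (le_max_left φ ψ) (max φ ψ).2.2.le
  · exact leftCone_mono (le_max_right _ _) ψ.2.1.le (le_max_right φ ψ) (max φ ψ).2.2.le

theorem algF_le_algBl (π : SpinAlg d →⋆ₐ[ℂ] (H →L[ℂ] H)) : algF π ≤ algBl π := by
  refine StarSubalgebra.topologicalClosure_mono (iSup_le fun P => ?_)
  refine le_trans (vNAlg_mono π (Γ₂ := leftCone P.a₂ (Real.pi - P.φ₂)) ?_)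
    (le_iSup (fun p : ℝ × Set.Ioo (0 : ℝ) Real.pi => vNAlg π (leftCone p.1 p.2))
      (P.a₂, ⟨Real.pi - P.φ₂, by linarith [P.angle₂.2], by linarith [P.angle₂.1]⟩))
  rw [leftCone, sub_sub_cancel]
  exact Set.compl_subset_compl.2 Set.subset_union_right

theorem map_mem_algBl (π : SpinAlg d →⋆ₐ[ℂ] (H →L[ℂ] H)) (A : SpinAlg d) : π A ∈ algBl π := by
  have hpi := Real.pi_pos
  refine spinAlg_induction (P := fun A => π A ∈ algBl π) ?_ ?_ ?_ ?_ ?_ ?_ A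
  · exact (StarSubalgebra.isClosed_topologicalClosure _).preimage
      (AddMonoidHomClass.continuous_of_bound π 1 fun x => by
        simpa using NonUnitalStarAlgHom.norm_apply_le π x)
  · intro z m
    have hmem : latticePt z ∈ leftCone (z.1 : ℝ) (Real.pi / 2) := by
      rw [leftCone, Set.mem_compl_iff, sub_half, mem_rightCone]
      simp [latticePt]
    refine StarSubalgebra.le_topologicalClosure _ ((le_iSup
      (fun p : ℝ × Set.Ioo (0 : ℝ) Real.pi => vNAlg π (leftCone p.1 p.2))
      ((z.1 : ℝ), ⟨Real.pi / 2, by linarith, by linarith⟩)) (map_mem_vNAlg π ?_))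
    refine StarSubalgebra.le_topologicalClosure _ (StarAlgebra.subset_adjoin ℂ _ ⟨z, m, ?_, rfl⟩)
    exact hmem
  · intro c
    rw [AlgHomClass.commutes]
    exact algebraMap_mem _ c
  · intro x y hx hy; rw [map_add]; exact add_mem hx hy
  · intro x y hx hy; rw [map_mul]; exact mul_mem hx hy
  · intro x hx; rw [map_star]; exact star_mem hx

/-- The representation `π` as a homomorphism into `ℬ_l`. -/
noncomputable def repBl (π : SpinAlg d →⋆ₐ[ℂ] (H →L[ℂ] H)) : SpinAlg d →⋆ₐ[ℂ] algBl π :=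
  π.codRestrict (algBl π) (map_mem_algBl π)

/-! ### Approximate Haag duality for right and left cones -/

/-- Approximate Haag duality for right cones, with unitaries in `ℱ`. -/
def RightHaagDuality (π : SpinAlg d →⋆ₐ[ℂ] (H →L[ℂ] H)) : Prop :=
  ∀ φ ∈ Set.Ioo 0 (Real.pi / 2), ∀ ε > 0, 2 * φ + 2 * ε < Real.pi →
    ∃ r > 0, ∃ f : ℝ → ℝ → ℝ,
      (∀ δ > 0, AntitoneOn (f δ) (Set.Ici 0) ∧ Tendsto (f δ) atTop (𝓝 0)) ∧
      ∀ a : ℝ, ∃ u ∈ unitary (H →L[ℂ] H),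
        (∀ x ∈ commutant π (rightCone a φ)ᶜ,
          ∃ y ∈ vNAlg π (rightCone (a - r) (φ + ε)), x = u * y * star u) ∧
        ∀ δ > 0, φ + ε + δ < Real.pi → ∀ t ≥ 0, ∃ w ∈ unitary (H →L[ℂ] H),
          w ∈ vNAlg π (rightCone (a - t) (φ + ε + δ)) ∧ w ∈ algF π ∧ ‖u - w‖ ≤ f δ t

/-- Approximate Haag duality for left cones, with unitaries in `ℱ`. -/
def LeftHaagDuality (π : SpinAlg d →⋆ₐ[ℂ] (H →L[ℂ] H)) : Prop :=
  ∀ φ ∈ Set.Ioo 0 (Real.pi / 2), ∀ ε > 0, 2 * φ + 2 * ε < Real.pi →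
    ∃ r > 0, ∃ f : ℝ → ℝ → ℝ,
      (∀ δ > 0, AntitoneOn (f δ) (Set.Ici 0) ∧ Tendsto (f δ) atTop (𝓝 0)) ∧
      ∀ a : ℝ, ∃ u ∈ unitary (H →L[ℂ] H),
        (∀ x ∈ commutant π (cone (onAxis a) Real.pi φ)ᶜ,
          ∃ y ∈ vNAlg π (cone (onAxis (a + r)) Real.pi (φ + ε)), x = u * y * star u) ∧
        ∀ δ > 0, φ + ε + δ < Real.pi → ∀ t ≥ 0, ∃ w ∈ unitary (H →L[ℂ] H),
          w ∈ vNAlg π (cone (onAxis (a + t)) Real.pi (φ + ε + δ)) ∧ w ∈ algF π ∧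
            ‖u - w‖ ≤ f δ t

/-! ### `G`-localized sectors -/

/-- The superselection criterion for `π`: in the complement of every cone, `ρ` is unitarily
equivalent to `π`. -/
def Superselection (π ρ : SpinAlg d →⋆ₐ[ℂ] (H →L[ℂ] H)) : Prop :=
  ∀ (a : Plane) (θ φ : ℝ), φ ∈ Set.Ioo 0 Real.pi → ∃ V ∈ unitary (H →L[ℂ] H),
    ∀ A ∈ localAlg d (cone a θ φ)ᶜ, V * ρ A * star V = π A

/-- The charge transporters `𝒱_{ρ,(Λ₁,Λ₂)}^{(g)}`: the unitaries `V ∈ ℱ` with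
`Ad V ∘ ρ = π ∘ β_g^{Λ₁}` on `𝒜_{Λ₁ ∪ Λ₂}`. -/
def transporters {G : Type*} [Group G] (U : G →* Matrix.unitaryGroup (Fin d) ℂ)
    (π : SpinAlg d →⋆ₐ[ℂ] (H →L[ℂ] H)) (g : G) (ρ : SpinAlg d →⋆ₐ[ℂ] (H →L[ℂ] H)) (P : ConePair) :
    Set (H →L[ℂ] H) :=
  {V | V ∈ unitary (H →L[ℂ] H) ∧ V ∈ algF π ∧
    ∀ A ∈ localAlg d (P.left ∪ P.right), V * ρ A * star V = π (onSite U P.left g A)}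

/-- The set `O^{(g)}_{P₀}` of `g`-localized sectors: representations satisfying the superselection
criterion, having charge transporters for all pairs in `PC`, and localized at the pair `P₀`. -/
def sectors {G : Type*} [Group G] (U : G →* Matrix.unitaryGroup (Fin d) ℂ)
    (π : SpinAlg d →⋆ₐ[ℂ] (H →L[ℂ] H)) (P₀ : ConePair) (g : G) :
    Set (SpinAlg d →⋆ₐ[ℂ] (H →L[ℂ] H)) :=
  {ρ | Superselection π ρ ∧ (∀ P, (transporters U π g ρ P).Nonempty) ∧
    1 ∈ transporters U π g ρ P₀}

/-- The morphisms `Mor_G(ρ, σ)`: intertwiners that belong to `ℱ`. -/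
def morG (π ρ σ : SpinAlg d →⋆ₐ[ℂ] (H →L[ℂ] H)) : Set (H →L[ℂ] H) :=
  {X | X ∈ algF π ∧ ∀ A, X * ρ A = σ A * X}

/-- `S` is the extension `S_ρ^{(l)𝕀}` of `ρ` to `ℬ_l`: a *-endomorphism of `ℬ_l` with `S ∘ π = ρ`
that is σ-weakly continuous on `π(𝒜_Λ)''` for every left cone `Λ`. -/
structure IsLeftExtension (π ρ : SpinAlg d →⋆ₐ[ℂ] (H →L[ℂ] H))
    (S : algBl π →⋆ₐ[ℂ] algBl π) : Prop where
  extends_rep : ∀ A, (S (repBl π A) : H →L[ℂ] H) = ρ A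
  continuousOn : ∀ (a φ : ℝ), φ ∈ Set.Ioo 0 Real.pi →
    @ContinuousOn (algBl π) (H →L[ℂ] H) (TopologicalSpace.induced (↑) (sigmaWeak H)) (sigmaWeak H)
      (fun x => (S x : H →L[ℂ] H)) {x | (x : H →L[ℂ] H) ∈ vNAlg π (leftCone a φ)}

open Classical in
/-- The endomorphism `S_ρ^{(l)𝕀}` of `ℬ_l` (the identity, as a junk value, if there is no such
extension). -/
noncomputable def leftExt (π ρ : SpinAlg d →⋆ₐ[ℂ] (H →L[ℂ] H)) : algBl π →⋆ₐ[ℂ] algBl π :=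
  if h : ∃ S, IsLeftExtension π ρ S then h.choose else StarAlgHom.id ℂ (algBl π)

open Classical in
/-- The value `S_ρ^{(l)𝕀}(X)` for `X ∈ ℬ_l`, as an operator on `H` (`0`, as a junk value, for
`X ∉ ℬ_l`). -/
noncomputable def extApply (π ρ : SpinAlg d →⋆ₐ[ℂ] (H →L[ℂ] H)) (X : H →L[ℂ] H) : H →L[ℂ] H :=
  if h : X ∈ algBl π then (leftExt π ρ ⟨X, h⟩ : H →L[ℂ] H) else 0

/-- The tensor product of sectors, `ρ ⊗ σ = S_ρ^{(l)𝕀} S_σ^{(l)𝕀} π`. -/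
noncomputable def tensor (π ρ σ : SpinAlg d →⋆ₐ[ℂ] (H →L[ℂ] H)) :
    SpinAlg d →⋆ₐ[ℂ] (H →L[ℂ] H) :=
  (algBl π).subtype.comp ((leftExt π ρ).comp ((leftExt π σ).comp (repBl π)))

/-- The tensor product `X ⊗ Y = X S_ρ^{(l)𝕀}(Y)` of morphisms, where `ρ` is the source of `X`. -/
noncomputable def tensorHom (π ρ : SpinAlg d →⋆ₐ[ℂ] (H →L[ℂ] H)) (X Y : H →L[ℂ] H) : H →L[ℂ] H :=
  X * extApply π ρ Y

/-- The action `Θ(g)(ρ) = Ad R_g ∘ ρ ∘ β_{g⁻¹}` on representations. -/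
noncomputable def thetaRep {G : Type*} [Group G] (U : G →* Matrix.unitaryGroup (Fin d) ℂ)
    (R : G →* unitary (H →L[ℂ] H)) (g : G) (ρ : SpinAlg d →⋆ₐ[ℂ] (H →L[ℂ] H)) :
    SpinAlg d →⋆ₐ[ℂ] (H →L[ℂ] H) :=
  ((Unitary.conjStarAlgAut ℂ (H →L[ℂ] H) (R g)).toStarAlgHom.comp ρ).comp
    (onSite U Set.univ g⁻¹).toStarAlgHom

/-- The action `Θ(g)(X) = R_g X R_g^*` on operators. -/
noncomputable def thetaOp {G : Type*} [Group G] (R : G →* unitary (H →L[ℂ] H)) (g : G)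
    (X : H →L[ℂ] H) : H →L[ℂ] H :=
  (R g : H →L[ℂ] H) * X * star (R g : H →L[ℂ] H)

/-- `e` is the value `ε_G(ρ, σ)` of the braiding for `ρ ∈ O^{(g)}` and `σ ∈ O^{(h)}`: for all pairs
`{P} ← {Q}` in `PC`, and all charge transporters `V t` of `ρ` for `P - t e_0` and `W s` of `σ` for
`Q + s e_0`, the operators `(W_s ⊗ Θ(h⁻¹)(V_t))^* (V_t ⊗ W_s)` converge to `e` in norm as
`t, s → ∞`. -/
def IsBraidingLimit {G : Type*} [Group G] (U : G →* Matrix.unitaryGroup (Fin d) ℂ)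
    (π : SpinAlg d →⋆ₐ[ℂ] (H →L[ℂ] H)) (R : G →* unitary (H →L[ℂ] H)) (g h : G)
    (ρ σ : SpinAlg d →⋆ₐ[ℂ] (H →L[ℂ] H)) (e : H →L[ℂ] H) : Prop :=
  ∀ P Q : ConePair, P.Precedes Q → ∀ V W : ℝ → (H →L[ℂ] H),
    (∀ t ≥ 0, V t ∈ transporters U π g ρ (P.shift (-t))) →
    (∀ s ≥ 0, W s ∈ transporters U π h σ (Q.shift s)) →
    Tendsto (fun p : ℝ × ℝ =>
        star (tensorHom π σ (W p.2) (thetaOp R h⁻¹ (V p.1))) * tensorHom π ρ (V p.1) (W p.2))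
      (atTop ×ˢ atTop) (𝓝 e)

end Algebras

end SpinSET

open SpinSET

/-!
A sector `ρ` of degree `g` is transported on each left cone `Λ` by some `V ∈ ℱ` to `π ∘ β_g`. Hence
on `π(𝒜_Λ)''` its extension must be `x ↦ V^* Θ(g)(x) V`, which does not depend on `V`
(`conj_transporter_eq`); on an increasing sequence of left cones these maps fit together and extend to
the norm closure (`exists_leftExtension`). Uniqueness is the `σ`-weak density of a *-algebra in its
double commutant, obtained from the double commutant argument for amplifications (`mem_closure_sigmaWeak`).
On right cones `ρ` is transported to `π` itself, which gives an extension to the C*-algebra of the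
right cones; it agrees with the left extension on `ℱ` (`exists_rightExtension`).

For `ρ ⊗ σ`, charge transporters are `V S_ρ(W)`. The superselection criterion for an arbitrary cone
reduces to a thin cone inside it that lies in a right or left cone of half opening angle less than
`π / 2` (`exists_subcone`). By approximate Haag duality, a unitary that trivialises `σ` off the thin
cone then lies, up to a charge transporter and a symmetry, in the C*-algebra of the right or left
cones, and the corresponding extension of `ρ` can be applied to it (`superselection_tensor`).

For the braiding, let `V` transport `ρ` on a right cone with apex `a` and half opening angle `φ`, and
`W` transport `σ` on a left cone with apex `b` and half opening angle `ψ`, where `φ + ψ > π`. When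
`ψ > π / 2`, two choices of `W` differ by an operator that by approximate Haag duality is almost
localized in the right cone if `b - a` is large, and there `V` trivialises `ρ`; so `W` may be changed
freely. It may be chosen for a left cone so large that the operator relating two choices of `V` is
almost localized in it, which makes the choice of `V` irrelevant as well. When `ψ ≤ π / 2`, the angle
`φ` exceeds `π / 2` and the mirror image of the argument applies (`braidApprox_cauchy`). So
`(W ⊗ Θ(h⁻¹)(V))^* (V ⊗ W)` converges as `b - a → ∞` (`exists_isBraid`).

Since `1` is a charge transporter for the cones of `P₀`, the limit is also `lim W_n^* S_ρ(W_n)` and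
`lim S_σ(Θ(h⁻¹)(V_n))^* V_n`, where only one of the sectors is moved (`IsBraid.tendsto_left`,
`IsBraid.tendsto_right`). In this form the intertwining property, the hexagons, naturality and
equivariance are short computations from the compatibility of the extensions with tensor products,
translates and morphisms (`extApply_tensor`, `extApply_thetaRep`, `mul_extApply_of_mem_morG`).
-/

namespace SpinSET

/-! ### Amplifications and σ-weak density -/

section Amplification

variable {H : Type*} [NormedAddCommGroup H] [InnerProductSpace ℂ H]

theorem memℓp_amplification {ι : Type*} (B : H →L[ℂ] H) (ξ : lp (fun _ : ι => H) 2) :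
    Memℓp (fun i => B (ξ i)) 2 :=
  Memℓp.mono' (g := fun i => ((‖B‖ : ℂ) • ξ : lp (fun _ : ι => H) 2) i) (lp.memℓp _) fun i => by
    change ‖B (ξ i)‖ ≤ ‖(‖B‖ : ℂ) • ξ i‖
    simpa [norm_smul] using B.le_opNorm (ξ i)

/-- The amplification `B ⊗ 1` of an operator `B` on `H`, acting on `ℓ²(ι, H)` coordinatewise. -/
noncomputable def amplify (ι : Type*) (B : H →L[ℂ] H) :
    lp (fun _ : ι => H) 2 →L[ℂ] lp (fun _ : ι => H) 2 :=
  LinearMap.mkContinuous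
    { toFun := fun ξ => ⟨fun i => B (ξ i), memℓp_amplification B ξ⟩
      map_add' := fun ξ η => by
        ext i
        exact map_add B (ξ i) (η i)
      map_smul' := fun c ξ => by
        ext i
        exact map_smul B c (ξ i) } ‖B‖
    (fun ξ => by
      have h := lp.norm_mono (p := 2) (by norm_num)
        (x := (⟨fun i => B (ξ i), memℓp_amplification B ξ⟩ : lp (fun _ : ι => H) 2))
        (y := ((‖B‖ : ℂ) • ξ : lp (fun _ : ι => H) 2)) fun i => by
          change ‖B (ξ i)‖ ≤ ‖(‖B‖ : ℂ) • ξ i‖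
          simpa [norm_smul] using B.le_opNorm (ξ i)
      refine h.trans ((lp.norm_const_smul_le (by norm_num) _ _).trans ?_)
      simp)

@[simp]
theorem amplify_apply {ι : Type*} (B : H →L[ℂ] H) (ξ : lp (fun _ : ι => H) 2) (i : ι) :
    amplify ι B ξ i = B (ξ i) := rfl

theorem continuous_sigmaWeak_inner (x y : H) :
    @Continuous _ _ (sigmaWeak H) _ fun T : H →L[ℂ] H => inner ℂ x (T y) := by
  refine continuous_iInf_dom (i := (lp.single 2 0 x, lp.single 2 0 y)) ?_
  have h : (fun T : H →L[ℂ] H => inner ℂ x (T y)) = fun T : H →L[ℂ] H => ∑' n,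
      inner ℂ ((lp.single 2 0 x : lp (fun _ : ℕ => H) 2) n)
        (T ((lp.single 2 0 y : lp (fun _ : ℕ => H) 2) n)) := by
    funext T
    rw [tsum_eq_single 0]
    · simp
    · intro n hn
      rw [lp.single_apply_ne _ _ _ hn, inner_zero_left]
  rw [h]
  exact continuous_induced_dom

variable [CompleteSpace H]

theorem inner_amplify {ι : Type*} (B : H →L[ℂ] H) (ξ η : lp (fun _ : ι => H) 2) :
    inner ℂ (amplify ι (star B) ξ) η = inner ℂ ξ (amplify ι B η) := by
  rw [lp.inner_eq_tsum, lp.inner_eq_tsum]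
  refine tsum_congr fun i => ?_
  rw [amplify_apply, amplify_apply, ContinuousLinearMap.star_eq_adjoint,
    ContinuousLinearMap.adjoint_inner_left]

/-- The amplified form of von Neumann's double commutant theorem: an operator in the double
commutant of a *-algebra `M` maps every vector of `ℓ²(ι, H)`, after amplification, into the closure
of its orbit under the amplification of `M`. -/
theorem amplify_mem_closure {ι : Type*} (M : StarSubalgebra ℂ (H →L[ℂ] H)) {T : H →L[ℂ] H}
    (hT : T ∈ StarSubalgebra.centralizer ℂ (StarSubalgebra.centralizer ℂ (M : Set (H →L[ℂ] H)) :
      Set (H →L[ℂ] H))) (ξ : lp (fun _ : ι => H) 2) :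
    amplify ι T ξ ∈ closure ((fun A => amplify ι A ξ) '' (M : Set (H →L[ℂ] H))) := by
  classical
  let E₀ : Submodule ℂ (lp (fun _ : ι => H) 2) :=
    { carrier := (fun A => amplify ι A ξ) '' (M : Set (H →L[ℂ] H))
      add_mem' := by
        rintro _ _ ⟨A, hA, rfl⟩ ⟨B, hB, rfl⟩
        exact ⟨A + B, add_mem hA hB, by ext i; rfl⟩
      zero_mem' := ⟨0, zero_mem M, by ext i; rfl⟩
      smul_mem' := by
        rintro c _ ⟨A, hA, rfl⟩
        exact ⟨c • A, M.smul_mem hA c, by ext i; rfl⟩ }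
  let E : Submodule ℂ (lp (fun _ : ι => H) 2) := E₀.topologicalClosure
  have hEc : IsClosed (E : Set (lp (fun _ : ι => H) 2)) := E₀.isClosed_topologicalClosure
  have : CompleteSpace E := hEc.completeSpace_coe
  have hE₀E : E₀ ≤ E := E₀.le_topologicalClosure
  have hinv : ∀ A ∈ M, ∀ η ∈ E, amplify ι A η ∈ E := by
    intro A hA η hη
    have h1 : E₀ ≤ E.comap (amplify ι A).toLinearMap := by
      rintro _ ⟨B, hB, rfl⟩
      exact hE₀E ⟨A * B, mul_mem hA hB, rfl⟩
    have h2 : IsClosed (E.comap (amplify ι A).toLinearMap : Set (lp (fun _ : ι => H) 2)) :=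
      hEc.preimage (amplify ι A).continuous
    exact E₀.topologicalClosure_minimal h1 h2 hη
  have hinv' : ∀ A ∈ M, ∀ η ∈ Eᗮ, amplify ι A η ∈ Eᗮ := by
    intro A hA η hη
    rw [Submodule.mem_orthogonal] at hη ⊢
    intro v hv
    rw [← inner_amplify]
    exact hη _ (hinv _ (star_mem hA) _ hv)
  -- the projection onto the closed orbit commutes with the amplification of `M`
  let p : lp (fun _ : ι => H) 2 →L[ℂ] lp (fun _ : ι => H) 2 := E.starProjection
  have hpE : ∀ η ∈ E, p η = η := fun η hη => Submodule.starProjection_eq_self_iff.2 hη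
  have hpA : ∀ A ∈ M, ∀ η, p (amplify ι A η) = amplify ι A (p η) := by
    intro A hA η
    refine Submodule.eq_starProjection_of_mem_of_inner_eq_zero (𝕜 := ℂ) (K := E) (u := amplify ι A η)
      (v := amplify ι A (p η)) ?_ ?_
    · exact hinv A hA _ (Submodule.starProjection_apply_mem E η)
    · intro w hw
      rw [← map_sub]
      have h3 : η - p η ∈ Eᗮ := Submodule.sub_starProjection_mem_orthogonal η
      exact (Submodule.mem_orthogonal' _ _).1 (hinv' A hA _ h3) w hw
  -- the matrix entries of `p` lie in the commutant of `M`, hence commute with `T`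
  let q : ι → ι → (H →L[ℂ] H) := fun i j =>
    (lp.evalCLM ℂ (fun _ : ι => H) 2 i).comp
      (p.comp (lp.singleContinuousLinearMap ℂ (fun _ : ι => H) 2 j))
  have hsingle : ∀ (A : H →L[ℂ] H) (j : ι) (x : H), amplify ι A (lp.single 2 j x) =
      lp.single 2 j (A x) := by
    intro A j x
    ext i
    by_cases h : i = j
    · subst h; simp
    · simp [h]
  have hq : ∀ i j (x : H), q i j x = p (lp.single 2 j x) i := fun i j x => rfl
  have hqM : ∀ i j, q i j ∈ StarSubalgebra.centralizer ℂ (M : Set (H →L[ℂ] H)) := by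
    intro i j
    rw [StarSubalgebra.mem_centralizer_iff]
    have h4 : ∀ A ∈ M, A * q i j = q i j * A := by
      intro A hA
      ext x
      change A (q i j x) = q i j (A x)
      rw [hq, hq, ← hsingle, hpA A hA, amplify_apply]
    exact fun A hA => ⟨h4 A hA, h4 _ (star_mem hA)⟩
  have hpT : ∀ η, p (amplify ι T η) = amplify ι T (p η) := by
    have h5 : p.comp (amplify ι T) = (amplify ι T).comp p := by
      refine lp.ext_continuousLinearMap (by norm_num) fun j => ?_
      ext x i
      change p (amplify ι T (lp.single 2 j x)) i = T (p (lp.single 2 j x) i)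
      rw [hsingle, ← hq, ← hq]
      exact (congrArg (fun B : H →L[ℂ] H => B x)
        ((StarSubalgebra.mem_centralizer_iff ℂ).1 hT _ (hqM i j)).1)
    exact fun η => congrArg (fun B : lp (fun _ : ι => H) 2 →L[ℂ] _ => B η) h5
  have hξ : ξ ∈ E := hE₀E ⟨1, one_mem M, by ext i; rfl⟩
  have h6 : amplify ι T ξ ∈ E := by
    rw [← hpE ξ hξ, ← hpT]
    exact Submodule.starProjection_apply_mem E _
  exact h6

/-- A *-algebra is σ-weakly dense in its double commutant. -/
theorem mem_closure_sigmaWeak (M : StarSubalgebra ℂ (H →L[ℂ] H)) {T : H →L[ℂ] H}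
    (hT : T ∈ StarSubalgebra.centralizer ℂ (StarSubalgebra.centralizer ℂ (M : Set (H →L[ℂ] H)) :
      Set (H →L[ℂ] H))) :
    T ∈ @closure _ (sigmaWeak H) (M : Set (H →L[ℂ] H)) := by
  let φ : lp (fun _ : ℕ => H) 2 × lp (fun _ : ℕ => H) 2 → (H →L[ℂ] H) → ℂ :=
    fun p x => ∑' n, inner ℂ (p.1 n) (x (p.2 n))
  have hφ : ∀ p x, φ p x = inner ℂ p.1 (amplify ℕ x p.2) := fun p x => by
    rw [lp.inner_eq_tsum]; rfl
  rw [@mem_closure_iff_nhds (H →L[ℂ] H) (sigmaWeak H)]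
  intro U hU
  rw [nhds_iInf, Filter.mem_iInf'] at hU
  obtain ⟨I, hI, V, hV, -, rfl, -⟩ := hU
  -- all the functionals indexed by the finite set `I` are controlled by a single vector
  have hfin : ∃ C, 0 ≤ C ∧ ∀ s : Finset (I × ℕ),
      ∑ i ∈ s, ‖(i.1 : lp (fun _ : ℕ => H) 2 × lp (fun _ : ℕ => H) 2).2 i.2‖ ^ 2 ≤ C := by
    have := hI.fintype
    refine ⟨∑ p : I, ‖p.1.2‖ ^ 2, by positivity, fun s => ?_⟩
    classical
    calc _ ≤ ∑ i ∈ (Finset.univ : Finset I) ×ˢ s.image Prod.snd, ‖i.1.1.2 i.2‖ ^ 2 := by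
          refine Finset.sum_le_sum_of_subset_of_nonneg ?_ fun _ _ _ => by positivity
          intro i hi
          exact Finset.mem_product.2 ⟨Finset.mem_univ _, Finset.mem_image_of_mem _ hi⟩
      _ = ∑ p : I, ∑ n ∈ s.image Prod.snd, ‖p.1.2 n‖ ^ 2 := Finset.sum_product _ _ _
      _ ≤ _ := Finset.sum_le_sum fun p _ => by
          have := lp.sum_rpow_le_norm_rpow (p := 2) (by norm_num) p.1.2 (s.image Prod.snd)
          simpa using this
  -- finitely many functionals are handled at once by a single vector of a larger amplification
  let ξ : lp (fun _ : I × ℕ => H) 2 :=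
    ⟨fun i => i.1.1.2 i.2, by
      obtain ⟨C, -, hC⟩ := hfin
      exact memℓp_gen' (C := C) fun s => by simpa using hC s⟩
  have hξ : ∀ (p : I) n, ξ (p, n) = p.1.2 n := fun _ _ => rfl
  have hmem := amplify_mem_closure M hT ξ
  have hbound : ∀ (p : I) (A : H →L[ℂ] H),
      ‖φ p A - φ p T‖ ≤ ‖p.1.1‖ * ‖amplify (I × ℕ) A ξ - amplify (I × ℕ) T ξ‖ := by
    intro p A
    rw [hφ, hφ, ← inner_sub_right]
    refine (norm_inner_le_norm _ _).trans (mul_le_mul_of_nonneg_left ?_ (norm_nonneg _))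
    refine lp.norm_le_of_forall_sum_le (p := 2) (by norm_num) (norm_nonneg _) fun s => ?_
    have h := lp.sum_rpow_le_norm_rpow (p := 2) (by norm_num)
      (amplify (I × ℕ) A ξ - amplify (I × ℕ) T ξ) (s.map ⟨fun n => (p, n), fun a b h => by
        simpa using h⟩)
    rw [Finset.sum_map] at h
    exact h
  have hex : ∀ p : I, ∃ ε > 0, ∀ x, ‖φ p x - φ p T‖ < ε → x ∈ V p := by
    intro p
    have h := hV p.1
    rw [nhds_induced, Filter.mem_comap] at h
    obtain ⟨W, hW, hWV⟩ := h
    obtain ⟨ε, hε, hb⟩ := Metric.mem_nhds_iff.1 hW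
    exact ⟨ε, hε, fun x hx => hWV (hb (by simpa [dist_eq_norm] using hx))⟩
  choose ε hε hεV using hex
  have hex2 : ∃ δ > 0, ∀ p : I, ‖p.1.1‖ * δ < ε p := by
    have := hI.to_subtype
    have h : ∀ p : I, ∀ᶠ δ in 𝓝[>] (0 : ℝ), ‖p.1.1‖ * δ < ε p := by
      intro p
      have h1 : Tendsto (fun δ : ℝ => ‖p.1.1‖ * δ) (𝓝[>] 0) (𝓝 (‖p.1.1‖ * 0)) :=
        (tendsto_id.const_mul _).mono_left nhdsWithin_le_nhds
      rw [mul_zero] at h1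
      exact h1.eventually_lt_const (hε p)
    obtain ⟨δ, h1, h2⟩ := ((eventually_all.2 h).and self_mem_nhdsWithin).exists
    exact ⟨δ, h2, h1⟩
  obtain ⟨δ, hδ, hδε⟩ := hex2
  obtain ⟨_, ⟨A, hA, rfl⟩, hAT⟩ := Metric.mem_closure_iff.1 hmem δ hδ
  refine ⟨A, Set.mem_iInter₂.2 fun p hp => hεV ⟨p, hp⟩ A ?_, hA⟩
  refine (hbound ⟨p, hp⟩ A).trans_lt (lt_of_le_of_lt ?_ (hδε ⟨p, hp⟩))
  rw [dist_comm, dist_eq_norm] at hAT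
  exact mul_le_mul_of_nonneg_left hAT.le (norm_nonneg _)

theorem continuous_sigmaWeak_mul_mul (u v : H →L[ℂ] H) :
    @Continuous _ _ (sigmaWeak H) (sigmaWeak H) fun x : H →L[ℂ] H => u * x * v := by
  refine continuous_iInf_rng.2 fun p => continuous_induced_rng.2 ?_
  refine continuous_iInf_dom (i := (amplify ℕ (star u) p.1, amplify ℕ v p.2)) ?_
  have h : ((fun x : H →L[ℂ] H => ∑' n, inner ℂ (p.1 n) (x (p.2 n))) ∘ fun x => u * x * v) =
      fun x => ∑' n, inner ℂ (amplify ℕ (star u) p.1 n) (x (amplify ℕ v p.2 n)) := by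
    funext x
    refine tsum_congr fun n => ?_
    rw [amplify_apply, amplify_apply, ContinuousLinearMap.star_eq_adjoint,
      ContinuousLinearMap.adjoint_inner_left]
    rfl
  rw [h]
  exact continuous_induced_dom

end Amplification

/-! ### Limits of conjugations by unitaries -/

section Conjugation

variable {H : Type*} [NormedAddCommGroup H] [InnerProductSpace ℂ H] [CompleteSpace H]

theorem star_mul_cancel {u : H →L[ℂ] H} (hu : u ∈ unitary (H →L[ℂ] H)) (x : H →L[ℂ] H) :
    star u * (u * x) = x := by
  rw [← mul_assoc, Unitary.star_mul_self_of_mem hu, one_mul]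

theorem mul_star_cancel {u : H →L[ℂ] H} (hu : u ∈ unitary (H →L[ℂ] H)) (x : H →L[ℂ] H) :
    u * (star u * x) = x := by
  rw [← mul_assoc, Unitary.mul_star_self_of_mem hu, one_mul]

theorem norm_conj {u : H →L[ℂ] H} (hu : u ∈ unitary (H →L[ℂ] H)) (x : H →L[ℂ] H) :
    ‖u * x * star u‖ = ‖x‖ := by
  rw [CStarRing.norm_mul_mem_unitary _ (Unitary.star_mem hu), CStarRing.norm_mem_unitary_mul _ hu]

theorem norm_conj_sub_conj {u : H →L[ℂ] H} (hu : u ∈ unitary (H →L[ℂ] H)) (x y : H →L[ℂ] H) :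
    ‖u * x * star u - u * y * star u‖ = ‖x - y‖ := by
  rw [← sub_mul, ← mul_sub, norm_conj hu]

theorem conj_mul {u : H →L[ℂ] H} (hu : u ∈ unitary (H →L[ℂ] H)) (x y : H →L[ℂ] H) :
    u * (x * y) * star u = u * x * star u * (u * y * star u) := by
  simp only [mul_assoc, star_mul_cancel hu]

theorem norm_le_one_of_mem_unitary {u : H →L[ℂ] H} (hu : u ∈ unitary (H →L[ℂ] H)) : ‖u‖ ≤ 1 := by
  have h := CStarRing.norm_mem_unitary_mul (1 : H →L[ℂ] H) hu
  rw [mul_one] at h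
  rw [h]
  exact ContinuousLinearMap.norm_id_le

theorem isClosed_unitary : IsClosed (unitary (H →L[ℂ] H) : Set (H →L[ℂ] H)) := by
  have h : (unitary (H →L[ℂ] H) : Set (H →L[ℂ] H)) = {u | star u * u = 1 ∧ u * star u = 1} := by
    ext u
    exact Unitary.mem_iff
  rw [h]
  exact (isClosed_eq (continuous_star.mul continuous_id) continuous_const).inter
    (isClosed_eq (continuous_id.mul continuous_star) continuous_const)

theorem StarSubalgebra.norm_map_le {B : StarSubalgebra ℂ (H →L[ℂ] H)}
    (hB : IsClosed (B : Set (H →L[ℂ] H))) (T : B →⋆ₐ[ℂ] (H →L[ℂ] H)) (x : B) :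
    ‖T x‖ ≤ ‖(x : H →L[ℂ] H)‖ := by
  have := hB
  have h := NonUnitalStarAlgHom.norm_apply_le T x
  exact h

/-- Conjugations by unitaries `u n` that stabilise on each member of a family `M n` of *-algebras
converge to a *-homomorphism on the norm closure of the union of the `M n`. -/
theorem exists_limit_conj (B : StarSubalgebra ℂ (H →L[ℂ] H)) (M : ℕ → StarSubalgebra ℂ (H →L[ℂ] H))
    (u : ℕ → H →L[ℂ] H) (hu : ∀ n, u n ∈ unitary (H →L[ℂ] H))
    (hdense : ∀ x ∈ B, ∀ η > 0, ∃ n, ∃ y ∈ M n, ‖x - y‖ < η)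
    (hcompat : ∀ n m, n ≤ m → ∀ y ∈ M n, u m * y * star (u m) = u n * y * star (u n)) :
    ∃ T : B →⋆ₐ[ℂ] (H →L[ℂ] H), ∀ x : B,
      Tendsto (fun n => u n * (x : H →L[ℂ] H) * star (u n)) atTop (𝓝 (T x)) := by
  let c : ℕ → (H →L[ℂ] H) ≃⋆ₐ[ℂ] (H →L[ℂ] H) := fun n =>
    Unitary.conjStarAlgAut ℂ (H →L[ℂ] H) ⟨u n, hu n⟩
  have hlim : ∀ x : B, ∃ y, Tendsto (fun n => c n x) atTop (𝓝 y) := by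
    intro x
    refine cauchySeq_tendsto_of_complete (Metric.cauchySeq_iff'.2 fun ε hε => ?_)
    obtain ⟨N, y, hy, hxy⟩ := hdense x x.2 (ε / 2) (by positivity)
    refine ⟨N, fun n hn => ?_⟩
    have h1 : ‖c n x - c n y‖ = ‖(x : H →L[ℂ] H) - y‖ := norm_conj_sub_conj (hu n) _ _
    have h2 : ‖c N x - c N y‖ = ‖(x : H →L[ℂ] H) - y‖ := norm_conj_sub_conj (hu N) _ _
    have h3 : c n y = c N y := hcompat N n hn y hy
    rw [dist_eq_norm]
    calc ‖c n x - c N x‖ = ‖(c n x - c n y) - (c N x - c N y)‖ := by rw [h3]; congr 1; abel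
      _ ≤ ‖c n x - c n y‖ + ‖c N x - c N y‖ := norm_sub_le _ _
      _ < ε := by rw [h1, h2]; linarith
  choose T hT using hlim
  refine ⟨⟨⟨⟨⟨⟨T, ?_⟩, ?_⟩, ?_, ?_⟩, ?_⟩, ?_⟩, hT⟩
  · exact tendsto_nhds_unique (hT 1) (tendsto_const_nhds.congr fun n => (map_one (c n)).symm)
  · exact fun x y => tendsto_nhds_unique (hT _)
      (((hT x).mul (hT y)).congr fun n => (map_mul (c n) _ _).symm)
  · exact tendsto_nhds_unique (hT 0) (tendsto_const_nhds.congr fun n => (map_zero (c n)).symm)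
  · exact fun x y => tendsto_nhds_unique (hT _)
      (((hT x).add (hT y)).congr fun n => (map_add (c n) _ _).symm)
  · exact fun r => tendsto_nhds_unique (hT _)
      (tendsto_const_nhds.congr fun n => (AlgHomClass.commutes (c n) r).symm)
  · exact fun x => tendsto_nhds_unique (hT _) ((hT x).star.congr fun n => (map_star (c n) _).symm)

end Conjugation

/-! ### Local algebras and on-site symmetries -/

section Local

variable {d : ℕ}

theorem site_mem_localAlg {Γ : Set Plane} {z : ℤ × ℤ} (hz : latticePt z ∈ Γ)
    (m : Matrix (Fin d) (Fin d) ℂ) : site d z m ∈ localAlg d Γ :=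
  StarSubalgebra.le_topologicalClosure _ (StarAlgebra.subset_adjoin ℂ _ ⟨z, m, hz, rfl⟩)

theorem localAlg_induction {Γ : Set Plane} {P : SpinAlg d → Prop} (hclosed : IsClosed {x | P x})
    (hsite : ∀ z m, latticePt z ∈ Γ → P (site d z m)) (hsc : ∀ c : ℂ, P (algebraMap ℂ _ c))
    (hadd : ∀ x y, P x → P y → P (x + y)) (hmul : ∀ x y, P x → P y → P (x * y))
    (hstar : ∀ x, P x → P (star x)) {x : SpinAlg d} (hx : x ∈ localAlg d Γ) : P x := by
  have hcl : IsClosed (SpinAlg.val d '' {x : SpinAlg d | P x}) :=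
    (isClosed_localOps d Set.univ).isClosedEmbedding_subtypeVal.isClosedMap _ hclosed
  have hsub : ((StarAlgebra.adjoin ℂ {x | ∃ z m, latticePt z ∈ Γ ∧ siteOp d z m = x} :
      StarSubalgebra ℂ _) : Set (ConfigSpace d →L[ℂ] ConfigSpace d)) ⊆
      SpinAlg.val d '' {x : SpinAlg d | P x} := by
    intro y hy
    refine StarAlgebra.adjoin_induction
      (p := fun y _ => y ∈ SpinAlg.val d '' {x : SpinAlg d | P x}) ?_ ?_ ?_ ?_ ?_ hy
    · rintro _ ⟨z, m, hz, rfl⟩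
      exact ⟨site d z m, hsite z m hz, rfl⟩
    · exact fun c => ⟨algebraMap ℂ _ c, hsc c, AlgHomClass.commutes _ c⟩
    · rintro _ _ _ _ ⟨a, ha, rfl⟩ ⟨b, hb, rfl⟩
      exact ⟨a + b, hadd a b ha hb, map_add _ _ _⟩
    · rintro _ _ _ _ ⟨a, ha, rfl⟩ ⟨b, hb, rfl⟩
      exact ⟨a * b, hmul a b ha hb, map_mul _ _ _⟩
    · rintro _ _ ⟨a, ha, rfl⟩
      exact ⟨star a, hstar a ha, map_star _ _⟩
  obtain ⟨y, hy, hyx⟩ := closure_minimal hsub hcl hx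
  exact (SpinAlg.val_injective d hyx : y = x) ▸ hy

theorem continuous_starAlgHom {B : Type*} [CStarAlgebra B] (f : SpinAlg d →⋆ₐ[ℂ] B) :
    Continuous f :=
  AddMonoidHomClass.continuous_of_bound f 1 fun x => by
    simpa using NonUnitalStarAlgHom.norm_apply_le f x

theorem eqOn_localAlg {B : Type*} [CStarAlgebra B] {Γ : Set Plane} {f g : SpinAlg d →⋆ₐ[ℂ] B}
    (h : ∀ z m, latticePt z ∈ Γ → f (site d z m) = g (site d z m)) {A : SpinAlg d}
    (hA : A ∈ localAlg d Γ) : f A = g A := by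
  refine localAlg_induction (P := fun A => f A = g A)
    (isClosed_eq (continuous_starAlgHom f) (continuous_starAlgHom g)) h ?_ ?_ ?_ ?_ hA
  · intro c; rw [AlgHomClass.commutes, AlgHomClass.commutes]
  · intro x y hx hy; rw [map_add, map_add, hx, hy]
  · intro x y hx hy; rw [map_mul, map_mul, hx, hy]
  · intro x hx; rw [map_star, map_star, hx]

theorem localAlg_univ (A : SpinAlg d) : A ∈ localAlg d Set.univ := A.2

theorem starAlgHom_ext_site {B : Type*} [CStarAlgebra B] {f g : SpinAlg d →⋆ₐ[ℂ] B}
    (h : ∀ z m, f (site d z m) = g (site d z m)) (A : SpinAlg d) : f A = g A :=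
  eqOn_localAlg (fun z m _ => h z m) (localAlg_univ A)

theorem isClosed_localAlg (Γ : Set Plane) : IsClosed (localAlg d Γ : Set (SpinAlg d)) :=
  (isClosed_localOps d Γ).preimage continuous_subtype_val

variable {G : Type*} [Group G] (U : G →* Matrix.unitaryGroup (Fin d) ℂ)

theorem onSite_mem_localAlg {Γ : Set Plane} (Γ' : Set Plane) (g : G) {A : SpinAlg d}
    (hA : A ∈ localAlg d Γ) : onSite U Γ' g A ∈ localAlg d Γ := by
  classical
  refine localAlg_induction (P := fun A => onSite U Γ' g A ∈ localAlg d Γ)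
    ((isClosed_localAlg Γ).preimage (continuous_starAlgHom (onSite U Γ' g).toStarAlgHom))
    ?_ ?_ ?_ ?_ ?_ hA
  · intro z m hz
    rw [onSite_site]
    split_ifs <;> exact site_mem_localAlg hz _
  · intro c; rw [AlgHomClass.commutes]; exact algebraMap_mem _ c
  · intro x y hx hy; rw [map_add]; exact add_mem hx hy
  · intro x y hx hy; rw [map_mul]; exact mul_mem hx hy
  · intro x hx; rw [map_star]; exact star_mem hx

theorem onSite_congr {Γ Γ₁ Γ₂ : Set Plane} (g : G) (h : ∀ x ∈ Γ, x ∈ Γ₁ ↔ x ∈ Γ₂) {A : SpinAlg d}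
    (hA : A ∈ localAlg d Γ) : onSite U Γ₁ g A = onSite U Γ₂ g A := by
  classical
  refine eqOn_localAlg (f := (onSite U Γ₁ g).toStarAlgHom) (g := (onSite U Γ₂ g).toStarAlgHom)
    (fun z m hz => ?_) hA
  change onSite U Γ₁ g _ = onSite U Γ₂ g _
  rw [onSite_site, onSite_site]
  simp only [h _ hz]

theorem onSite_of_subset {Γ Γ₁ : Set Plane} (g : G) (h : Γ ⊆ Γ₁) {A : SpinAlg d}
    (hA : A ∈ localAlg d Γ) : onSite U Γ₁ g A = onSite U Set.univ g A :=
  onSite_congr U g (fun _ hx => ⟨fun _ => trivial, fun _ => h hx⟩) hA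

theorem onSite_of_disjoint {Γ Γ₁ : Set Plane} (g : G) (h : Disjoint Γ₁ Γ) {A : SpinAlg d}
    (hA : A ∈ localAlg d Γ) : onSite U Γ₁ g A = A := by
  classical
  refine eqOn_localAlg (f := (onSite U Γ₁ g).toStarAlgHom) (g := StarAlgHom.id ℂ (SpinAlg d))
    (fun z m hz => ?_) hA
  change onSite U Γ₁ g _ = _
  rw [onSite_site, if_neg (Set.disjoint_right.1 h hz)]
  rfl

theorem onSite_onSite (Γ : Set Plane) (g h : G) (A : SpinAlg d) :
    onSite U Γ g (onSite U Γ h A) = onSite U Γ (g * h) A := by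
  classical
  refine starAlgHom_ext_site
    (f := (onSite U Γ g).toStarAlgHom.comp (onSite U Γ h).toStarAlgHom)
    (g := (onSite U Γ (g * h)).toStarAlgHom) (fun z m => ?_) A
  change onSite U Γ g (onSite U Γ h _) = onSite U Γ (g * h) _
  rw [onSite_site, onSite_site]
  split_ifs with hz
  · rw [onSite_site, if_pos hz]
    simp [mul_assoc, StarMul.star_mul]
  · rw [onSite_site, if_neg hz]

theorem onSite_one (Γ : Set Plane) (A : SpinAlg d) : onSite U Γ 1 A = A := by
  classical
  refine starAlgHom_ext_site (f := (onSite U Γ 1).toStarAlgHom) (g := StarAlgHom.id ℂ (SpinAlg d))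
    (fun z m => ?_) A
  change onSite U Γ 1 _ = _
  rw [onSite_site]
  split_ifs with hz <;> simp

theorem onSite_inv_onSite (Γ : Set Plane) (g : G) (A : SpinAlg d) :
    onSite U Γ g⁻¹ (onSite U Γ g A) = A := by
  rw [onSite_onSite, inv_mul_cancel, onSite_one]

theorem onSite_onSite_inv (Γ : Set Plane) (g : G) (A : SpinAlg d) :
    onSite U Γ g (onSite U Γ g⁻¹ A) = A := by
  rw [onSite_onSite, mul_inv_cancel, onSite_one]

theorem onSite_conj (Γ : Set Plane) (k g : G) (A : SpinAlg d) :
    onSite U Set.univ k (onSite U Γ g (onSite U Set.univ k⁻¹ A)) = onSite U Γ (k * g * k⁻¹) A := by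
  classical
  refine starAlgHom_ext_site (f := (onSite U Set.univ k).toStarAlgHom.comp
    ((onSite U Γ g).toStarAlgHom.comp (onSite U Set.univ k⁻¹).toStarAlgHom))
    (g := (onSite U Γ (k * g * k⁻¹)).toStarAlgHom) (fun z m => ?_) A
  change onSite U Set.univ k (onSite U Γ g (onSite U Set.univ k⁻¹ _)) =
    onSite U Γ (k * g * k⁻¹) _
  have hk : ∀ (k : G) m, onSite U Set.univ k (site d z m) = site d z
      ((U k : Matrix (Fin d) (Fin d) ℂ) * m * star (U k : Matrix (Fin d) (Fin d) ℂ)) := fun k m => by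
    rw [onSite_site, if_pos (Set.mem_univ _)]
  rw [hk, onSite_site, onSite_site]
  split_ifs with hz
  · rw [hk]
    simp [mul_assoc, StarMul.star_mul]
  · rw [← hk, onSite_onSite_inv]

end Local

/-! ### Geometry of cones -/

theorem compl_rightCone (a φ : ℝ) : (rightCone a φ)ᶜ = leftCone a (Real.pi - φ) := by
  rw [leftCone, sub_sub_cancel]

theorem compl_leftCone (a φ : ℝ) : (leftCone a φ)ᶜ = rightCone a (Real.pi - φ) := compl_compl _

/-- Half opening angles increasing to `π`. -/
noncomputable def wideAngle (n : ℕ) : ℝ := Real.pi - 1 / (n + 1)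

theorem wideAngle_mem (n : ℕ) : wideAngle n ∈ Set.Ioo 0 Real.pi := by
  have h1 : (0 : ℝ) < 1 / (n + 1) := by positivity
  have h2 : (1 : ℝ) / (n + 1) ≤ 1 := by
    rw [div_le_one (by positivity)]
    have : (0 : ℝ) ≤ n := Nat.cast_nonneg n
    linarith
  have h3 := Real.pi_gt_three
  constructor <;> unfold wideAngle <;> linarith

theorem wideAngle_mono {m n : ℕ} (h : m ≤ n) : wideAngle m ≤ wideAngle n := by
  have h1 : (1 : ℝ) / (n + 1) ≤ 1 / (m + 1) := by
    have : (m : ℝ) ≤ n := by exact_mod_cast h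
    exact one_div_le_one_div_of_le (by positivity) (by linarith)
  unfold wideAngle
  linarith

theorem eventually_le_wideAngle {φ : ℝ} (hφ : φ < Real.pi) : ∀ᶠ n : ℕ in atTop, φ ≤ wideAngle n := by
  have h : Tendsto wideAngle atTop (𝓝 (Real.pi - 0)) :=
    tendsto_const_nhds.sub tendsto_one_div_add_atTop_nhds_zero_nat
  rw [sub_zero] at h
  exact h.eventually_const_le hφ

theorem eventually_le_natCast (a : ℝ) : ∀ᶠ n : ℕ in atTop, a ≤ n :=
  tendsto_natCast_atTop_atTop.eventually_ge_atTop a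

/-- An increasing sequence of left cones; every left cone lies in one of them. -/
noncomputable def wideLeft (n : ℕ) : Set Plane := leftCone n (wideAngle n)

/-- An increasing sequence of right cones; every right cone lies in one of them. -/
noncomputable def wideRight (n : ℕ) : Set Plane := rightCone (-n) (wideAngle n)

theorem wideLeft_mono {m n : ℕ} (h : m ≤ n) : wideLeft m ⊆ wideLeft n :=
  leftCone_mono (by exact_mod_cast h) (wideAngle_mem m).1.le (wideAngle_mono h) (wideAngle_mem n).2.le

theorem wideRight_mono {m n : ℕ} (h : m ≤ n) : wideRight m ⊆ wideRight n :=
  rightCone_mono (by simpa using h) (wideAngle_mem m).1.le (wideAngle_mono h)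
    (wideAngle_mem n).2.le

theorem eventually_subset_wideLeft (a : ℝ) {φ : ℝ} (hφ : φ ∈ Set.Ioo 0 Real.pi) :
    ∀ᶠ n in atTop, leftCone a φ ⊆ wideLeft n := by
  filter_upwards [eventually_le_wideAngle hφ.2, eventually_le_natCast a] with n h1 h2
  exact leftCone_mono h2 hφ.1.le h1 (wideAngle_mem n).2.le

theorem eventually_subset_wideRight (a : ℝ) {φ : ℝ} (hφ : φ ∈ Set.Ioo 0 Real.pi) :
    ∀ᶠ n in atTop, rightCone a φ ⊆ wideRight n := by
  filter_upwards [eventually_le_wideAngle hφ.2, eventually_le_natCast (-a)] with n h1 h2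
  exact rightCone_mono (by linarith) hφ.1.le h1 (wideAngle_mem n).2.le

theorem disjoint_arc {φ₁ φ₂ : ℝ} (h1 : 0 < φ₁) (h2 : 0 < φ₂) (h : φ₁ + φ₂ < Real.pi) :
    Disjoint (arc Real.pi φ₁) (arc 0 φ₂) := by
  have hpi := Real.pi_pos
  rw [Set.disjoint_left]
  rintro _ ⟨t, ht, rfl⟩ ⟨s, hs, hst⟩
  obtain ⟨k, hk⟩ := Circle.exp_eq_exp.1 hst
  have h3 := ht.1
  have h4 := ht.2
  have h5 := hs.1
  have h6 := hs.2
  have h7 : (-1 : ℝ) < k := by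
    by_contra hcon
    nlinarith
  have h8 : (k : ℝ) < 0 := by
    by_contra hcon
    nlinarith
  have h9 : (-1 : ℤ) < k := by exact_mod_cast h7
  have h10 : k < 0 := by exact_mod_cast h8
  omega

namespace ConePair

/-- The pair in `PC` given by apices `a₁ ≤ a₂` and half opening angles with `φ₁ + φ₂ < π`. -/
def ofLt (a₁ φ₁ a₂ φ₂ : ℝ) (ha : a₁ ≤ a₂) (h1 : 0 < φ₁) (h2 : 0 < φ₂) (h : φ₁ + φ₂ < Real.pi) :
    ConePair where
  a₁ := a₁
  φ₁ := φ₁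
  a₂ := a₂
  φ₂ := φ₂
  angle₁ := ⟨h1, by linarith⟩
  angle₂ := ⟨h2, by linarith⟩
  disjoint := Set.disjoint_compl_left_iff_subset.2
    (rightCone_mono ha h2.le (by linarith) (by linarith))
  separated := ⟨(Real.pi - φ₁ - φ₂) / 2, by linarith, disjoint_arc (by linarith) h2 (by linarith)⟩

theorem exists_left_eq (a : ℝ) {φ : ℝ} (hφ : φ ∈ Set.Ioo 0 Real.pi) :
    ∃ P : ConePair, P.left = leftCone a φ :=
  ⟨ofLt a φ a ((Real.pi - φ) / 2) le_rfl hφ.1 (by linarith [hφ.2]) (by linarith [hφ.2]), rfl⟩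

theorem exists_right_eq (a : ℝ) {φ : ℝ} (hφ : φ ∈ Set.Ioo 0 Real.pi) :
    ∃ P : ConePair, P.right = rightCone a φ :=
  ⟨ofLt a ((Real.pi - φ) / 2) a φ le_rfl (by linarith [hφ.2]) hφ.1 (by linarith [hφ.2]), rfl⟩

theorem compl_union_subset_left (P : ConePair) :
    (P.left ∪ P.right)ᶜ ⊆ leftCone P.a₂ (Real.pi - P.φ₂) := by
  rw [← compl_rightCone]
  exact Set.compl_subset_compl.2 Set.subset_union_right

theorem compl_union_subset_right (P : ConePair) :
    (P.left ∪ P.right)ᶜ ⊆ rightCone P.a₁ (Real.pi - P.φ₁) := by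
  rw [← compl_leftCone]
  exact Set.compl_subset_compl.2 Set.subset_union_left

theorem Precedes.pi_lt_add {P Q : ConePair} (h : P.Precedes Q) : Real.pi < P.φ₂ + Q.φ₁ := by
  obtain ⟨ε, hε, hs⟩ := h
  have hpi := Real.pi_pos
  by_contra hcon
  have h2 := P.angle₂.1
  have h2' := P.angle₂.2
  have h1 := Q.angle₁.1
  have h1' := Q.angle₁.2
  -- the direction of angle `t` lies in the small arc but not in the large one
  set t := min (Real.pi - Q.φ₁ + ε) Real.pi with ht
  have ht1 : P.φ₂ < t := lt_min (by linarith) h2'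
  have ht2 : t ≤ Real.pi := min_le_right _ _
  have ht3 : t ≤ Real.pi - Q.φ₁ + ε := min_le_left _ _
  obtain ⟨s, hs1, hst⟩ := hs ⟨t, ⟨by linarith, by linarith⟩, rfl⟩
  obtain ⟨k, hk⟩ := Circle.exp_eq_exp.1 hst
  have h5 := hs1.1
  have h6 := hs1.2
  have h7 : (-1 : ℝ) < k := by
    by_contra hcon
    nlinarith
  have h8 : (k : ℝ) < 0 := by
    by_contra hcon
    nlinarith
  have h9 : (-1 : ℤ) < k := by exact_mod_cast h7
  have h10 : k < 0 := by exact_mod_cast h8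
  omega

theorem exists_latticePt_mem_compl (z : ℤ × ℤ) :
    ∃ P : ConePair, latticePt z ∈ (P.left ∪ P.right)ᶜ := by
  have hpi := Real.pi_pos
  refine ⟨ofLt (z.1 - 1) (Real.pi / 2) (z.1 + 1) (Real.pi / 4) (by linarith) (by linarith)
    (by linarith) (by linarith), ?_⟩
  rw [Set.compl_union]
  constructor
  · change latticePt z ∈ (leftCone ((z.1 : ℝ) - 1) (Real.pi / 2))ᶜ
    rw [compl_leftCone, mem_rightCone, sub_half, Real.cos_pi_div_two]
    simp [latticePt]
  · change latticePt z ∉ rightCone ((z.1 : ℝ) + 1) (Real.pi / 4)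
    rw [mem_rightCone, not_lt]
    have h : 0 ≤ Real.cos (Real.pi / 4) := Real.cos_nonneg_of_mem_Icc ⟨by linarith, by linarith⟩
    have h' : latticePt z 0 - ((z.1 : ℝ) + 1) ≤ 0 := by simp [latticePt]
    exact h'.trans (by positivity)

end ConePair

theorem norm_onAxis_sub_onAxis (a b : ℝ) : ‖onAxis a - onAxis b‖ = |a - b| := by
  rw [EuclideanSpace.norm_eq]
  simp [onAxis, Fin.sum_univ_two, Real.sqrt_sq_eq_abs]

theorem mem_cone_pi {a φ : ℝ} {x : Plane} :
    x ∈ cone (onAxis a) Real.pi φ ↔ ‖x - onAxis a‖ * Real.cos φ < a - x 0 := by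
  simp [cone, dir, onAxis, PiLp.inner_apply, Fin.sum_univ_two]

theorem cone_pi_subset_leftCone (a φ : ℝ) : cone (onAxis a) Real.pi φ ⊆ leftCone a φ := by
  intro x hx
  rw [mem_cone_pi] at hx
  rw [leftCone, Set.mem_compl_iff, mem_rightCone, Real.cos_pi_sub, not_lt]
  linarith

theorem compl_cone_pi_subset_rightCone (a : ℝ) {φ : ℝ} (hφ : φ ∈ Set.Ioo 0 Real.pi) :
    (cone (onAxis (a + 1)) Real.pi (Real.pi - φ))ᶜ ⊆ rightCone a φ := by
  intro x hx
  rw [Set.mem_compl_iff, mem_cone_pi, Real.cos_pi_sub, not_lt] at hx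
  rw [mem_rightCone]
  have h1 : |‖x - onAxis a‖ - ‖x - onAxis (a + 1)‖| ≤ 1 := by
    refine (abs_norm_sub_norm_le _ _).trans (le_of_eq ?_)
    rw [sub_sub_sub_cancel_left, norm_onAxis_sub_onAxis]
    simp
  have h2 : |Real.cos φ| < 1 := by
    rw [abs_lt]
    constructor
    · rw [← Real.cos_pi]
      exact Real.cos_lt_cos_of_nonneg_of_le_pi hφ.1.le le_rfl hφ.2
    · rw [← Real.cos_zero]
      exact Real.cos_lt_cos_of_nonneg_of_le_pi le_rfl hφ.2.le hφ.1
  have h3 : (‖x - onAxis a‖ - ‖x - onAxis (a + 1)‖) * Real.cos φ < 1 := by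
    refine (le_abs_self _).trans_lt ?_
    rw [abs_mul]
    exact (mul_le_mul_of_nonneg_right h1 (abs_nonneg _)).trans_lt (by linarith)
  linarith

theorem norm_dir (θ : ℝ) : ‖dir θ‖ = 1 := by
  rw [EuclideanSpace.norm_eq]
  simp [dir, Fin.sum_univ_two]

theorem inner_dir_dir (θ θ' : ℝ) : inner ℝ (dir θ) (dir θ') = Real.cos (θ - θ') := by
  simp [dir, PiLp.inner_apply, Fin.sum_univ_two, Real.cos_sub]
  ring

/-- In a cone of small half opening angle, every vector is close to a multiple of the axis. -/
theorem inner_dir_of_mem_cone {a x : Plane} {θ φ κ : ℝ} (hx : x ∈ cone a θ φ) (hφ : 0 ≤ φ)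
    (hκ : φ ≤ κ) (τ : ℝ) :
    ‖x - a‖ * (Real.cos (θ - τ) - κ) < inner ℝ (x - a) (dir τ) := by
  set y := x - a with hy
  have hx' : ‖y‖ * Real.cos φ < inner ℝ y (dir θ) := hx
  have hpos : 0 < ‖y‖ := by
    rcases eq_or_ne y 0 with h | h
    · rw [h] at hx'; simp at hx'
    · exact norm_pos_iff.2 h
  have hcos := Real.one_sub_sq_div_two_le_cos (x := φ)
  have hsq : ‖y - ‖y‖ • dir θ‖ ^ 2 < (κ * ‖y‖) ^ 2 := by
    rw [norm_sub_sq_real, norm_smul, norm_dir, inner_smul_right, norm_norm]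
    have h1 : ‖y‖ * (‖y‖ * Real.cos φ) < ‖y‖ * inner ℝ y (dir θ) := mul_lt_mul_of_pos_left hx' hpos
    have h2 : ‖y‖ ^ 2 * (1 - φ ^ 2 / 2) ≤ ‖y‖ ^ 2 * Real.cos φ :=
      mul_le_mul_of_nonneg_left hcos (by positivity)
    have h3 : ‖y‖ ^ 2 * φ ^ 2 ≤ ‖y‖ ^ 2 * κ ^ 2 :=
      mul_le_mul_of_nonneg_left (pow_le_pow_left₀ hφ hκ 2) (by positivity)
    nlinarith
  have hlt : ‖y - ‖y‖ • dir θ‖ < κ * ‖y‖ :=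
    lt_of_pow_lt_pow_left₀ 2 (mul_nonneg (hφ.trans hκ) hpos.le) hsq
  have hin : |inner ℝ (y - ‖y‖ • dir θ) (dir τ)| ≤ ‖y - ‖y‖ • dir θ‖ := by
    have := abs_real_inner_le_norm (y - ‖y‖ • dir θ) (dir τ)
    rwa [norm_dir, mul_one] at this
  rw [inner_sub_left, real_inner_smul_left, inner_dir_dir] at hin
  have := (abs_le.1 hin).1
  nlinarith

/-- Every cone contains a cone with the same apex that is contained in a left or right cone of half
opening angle less than `π / 2`. -/
theorem exists_subcone (a : Plane) (θ : ℝ) {φ : ℝ} (hφ : φ ∈ Set.Ioo 0 Real.pi) :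
    ∃ θ' φ', φ' ∈ Set.Ioo 0 Real.pi ∧ cone a θ' φ' ⊆ cone a θ φ ∧
      ∃ b ψ, ψ ∈ Set.Ioo 0 (Real.pi / 2) ∧
        (cone a θ' φ' ⊆ rightCone b ψ ∨ cone a θ' φ' ⊆ cone (onAxis b) Real.pi ψ) := by
  have hpi := Real.pi_gt_three
  -- tilt a vertical axis, so that the cone points strictly to the right or to the left
  obtain ⟨θ', hθ', hc⟩ : ∃ θ', Real.cos φ < Real.cos (θ' - θ) ∧ Real.cos θ' ≠ 0 := by
    by_cases h : Real.cos θ = 0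
    · refine ⟨θ + φ / 2, ?_, ?_⟩
      · rw [add_sub_cancel_left]
        exact Real.cos_lt_cos_of_nonneg_of_le_pi (by linarith [hφ.1]) hφ.2.le (by linarith [hφ.1])
      · have h1 : Real.sin θ ≠ 0 := by
          intro h0
          have := Real.sin_sq_add_cos_sq θ
          rw [h, h0] at this
          norm_num at this
        have h2 : Real.sin (φ / 2) ≠ 0 :=
          (Real.sin_pos_of_pos_of_lt_pi (by linarith [hφ.1]) (by linarith [hφ.1, hφ.2])).ne'
        rw [Real.cos_add, h, zero_mul, zero_sub, neg_ne_zero]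
        exact mul_ne_zero h1 h2
    · refine ⟨θ, ?_, h⟩
      rw [sub_self]
      exact Real.cos_lt_cos_of_nonneg_of_le_pi le_rfl hφ.2.le hφ.1
  set c := |Real.cos θ'| / 2 with hcdef
  have hc0 : 0 < c := by positivity
  have hc1 : c ≤ 1 / 2 := by
    rw [hcdef]
    linarith [Real.abs_cos_le_one θ']
  set κ := min (Real.cos (θ' - θ) - Real.cos φ) c with hκ
  have hκ0 : 0 < κ := lt_min (by linarith) hc0
  have hκ1 : κ ≤ c := min_le_right _ _
  refine ⟨θ', κ, ⟨hκ0, by linarith⟩, ?_, ?_⟩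
  · intro x hx
    have h := inner_dir_of_mem_cone hx hκ0.le le_rfl θ
    refine lt_of_le_of_lt (mul_le_mul_of_nonneg_left ?_ (norm_nonneg _)) h
    linarith [min_le_left (Real.cos (θ' - θ) - Real.cos φ) c]
  · have key : ∀ τ : ℝ, Real.sin τ = 0 → Real.cos (θ' - τ) = 2 * c →
        ∃ b, cone a θ' κ ⊆ cone (onAxis b) τ (Real.arccos c) := by
      intro τ hτ hcos
      have hτ2 : Real.cos τ * Real.cos τ = 1 := by
        have := Real.sin_sq_add_cos_sq τ
        rw [hτ] at this
        linarith
      have hτ3 : |Real.cos τ| = 1 := Real.abs_cos_eq_one_iff.2 (Real.sin_eq_zero_iff.1 hτ)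
      -- the apex is moved back along the axis until the cone contains `a` with room to spare
      set M := |a 1| + 1 with hM
      have hM0 : 0 < M := by positivity
      refine ⟨a 0 - Real.cos τ * M, fun x hx => ?_⟩
      set v := a - onAxis (a 0 - Real.cos τ * M) with hv
      have hv0 : v 0 = Real.cos τ * M := by simp [hv, onAxis]
      have hv1 : v 1 = a 1 := by simp [hv, onAxis]
      have hvin : inner ℝ v (dir τ) = M := by
        have : inner ℝ v (dir τ) = v 0 * Real.cos τ + v 1 * Real.sin τ := by
          simp [dir, PiLp.inner_apply, Fin.sum_univ_two, mul_comm]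
        rw [this, hv0, hτ, mul_zero, add_zero]
        linear_combination M * hτ2
      have hvn : ‖v‖ ≤ 2 * M := by
        refine abs_le_of_sq_le_sq' ?_ (by positivity) |>.2
        rw [EuclideanSpace.norm_sq_eq, Fin.sum_univ_two, hv0, hv1]
        simp only [Real.norm_eq_abs, abs_mul, hτ3, one_mul, abs_of_pos hM0]
        have : |a 1| ≤ M := by linarith
        nlinarith [abs_nonneg (a 1)]
      have h := inner_dir_of_mem_cone hx hκ0.le hκ1 τ
      rw [hcos] at h
      have hsum : x - onAxis (a 0 - Real.cos τ * M) = (x - a) + v := by rw [hv]; abel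
      change ‖x - onAxis (a 0 - Real.cos τ * M)‖ * Real.cos (Real.arccos c) <
        inner ℝ (x - onAxis (a 0 - Real.cos τ * M)) (dir τ)
      rw [hsum, inner_add_left, hvin, Real.cos_arccos (by linarith) (by linarith)]
      have h1 : ‖x - a + v‖ * c ≤ (‖x - a‖ + ‖v‖) * c :=
        mul_le_mul_of_nonneg_right (norm_add_le _ _) hc0.le
      have h2 : ‖v‖ * c ≤ 2 * M * (1 / 2) :=
        mul_le_mul hvn hc1 hc0.le (by positivity)
      linarith
    have hψ : Real.arccos c ∈ Set.Ioo 0 (Real.pi / 2) :=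
      ⟨Real.arccos_pos.2 (by linarith), Real.arccos_lt_pi_div_two.2 hc0⟩
    rcases le_or_gt 0 (Real.cos θ') with h | h
    · obtain ⟨b, hb⟩ := key 0 Real.sin_zero (by
        rw [sub_zero, hcdef, abs_of_nonneg h]; ring)
      exact ⟨b, _, hψ, Or.inl hb⟩
    · obtain ⟨b, hb⟩ := key Real.pi Real.sin_pi (by
        rw [Real.cos_sub_pi, hcdef, abs_of_neg h]; ring)
      exact ⟨b, _, hψ, Or.inr hb⟩

/-! ### Commutants and the action of the symmetry group -/

section Algebras

variable {d : ℕ} {H : Type*} [NormedAddCommGroup H] [InnerProductSpace ℂ H] [CompleteSpace H]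
  {π : SpinAlg d →⋆ₐ[ℂ] (H →L[ℂ] H)}

theorem mem_commutant_iff {Γ : Set Plane} {x : H →L[ℂ] H} :
    x ∈ commutant π Γ ↔ ∀ A ∈ localAlg d Γ, π A * x = x * π A := by
  rw [commutant, StarSubalgebra.mem_centralizer_iff]
  constructor
  · exact fun h A hA => (h _ ⟨A, hA, rfl⟩).1
  · rintro h _ ⟨A, hA, rfl⟩
    refine ⟨h A hA, ?_⟩
    rw [← map_star]
    exact h _ (star_mem hA)

theorem commutant_anti {Γ₁ Γ₂ : Set Plane} (h : Γ₁ ⊆ Γ₂) : commutant π Γ₂ ≤ commutant π Γ₁ :=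
  StarSubalgebra.centralizer_le _ _ _ (Set.image_mono (localAlg_mono h))

theorem mem_vNAlg_iff {Γ : Set Plane} {x : H →L[ℂ] H} :
    x ∈ vNAlg π Γ ↔ ∀ y ∈ commutant π Γ, y * x = x * y := by
  rw [vNAlg, StarSubalgebra.mem_centralizer_iff]
  exact ⟨fun h y hy => (h y hy).1, fun h y hy => ⟨h y hy, h _ (star_mem hy)⟩⟩

/-- An operator intertwining two unitary conjugations on `π(𝒜_Γ)` intertwines them on
`π(𝒜_Γ)''`. -/
theorem intertwine_vNAlg {Γ : Set Plane} {u v X : H →L[ℂ] H} (hu : u ∈ unitary (H →L[ℂ] H))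
    (hv : v ∈ unitary (H →L[ℂ] H))
    (h : ∀ A ∈ localAlg d Γ, X * (u * π A * star u) = v * π A * star v * X) {x : H →L[ℂ] H}
    (hx : x ∈ vNAlg π Γ) : X * (u * x * star u) = v * x * star v * X := by
  have hw : star v * (X * u) ∈ commutant π Γ := by
    rw [mem_commutant_iff]
    intro A hA
    have h1 := congrArg (fun y => star v * (y * u)) (h A hA)
    simp only [mul_assoc, star_mul_cancel hv, Unitary.star_mul_self_of_mem hu, mul_one] at h1
    simp only [mul_assoc, h1]
  have h2 := congrArg (fun y => v * (y * star u)) (mem_vNAlg_iff.1 hx _ hw)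
  simp only [mul_assoc, mul_star_cancel hv, Unitary.mul_star_self_of_mem hu, mul_one] at h2
  simp only [mul_assoc, h2]

theorem conj_eq_conj_of_mem_vNAlg {Γ : Set Plane} {u v : H →L[ℂ] H} (hu : u ∈ unitary (H →L[ℂ] H))
    (hv : v ∈ unitary (H →L[ℂ] H))
    (h : ∀ A ∈ localAlg d Γ, u * π A * star u = v * π A * star v) {x : H →L[ℂ] H}
    (hx : x ∈ vNAlg π Γ) : u * x * star u = v * x * star v := by
  have := intertwine_vNAlg (X := 1) hu hv (fun A hA => by rw [one_mul, mul_one, h A hA]) hx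
  rwa [one_mul, mul_one] at this

/-- The C*-algebra generated by the algebras `π(𝒜_Λ)''` of all right cones `Λ`. -/
noncomputable def algBr (π : SpinAlg d →⋆ₐ[ℂ] (H →L[ℂ] H)) : StarSubalgebra ℂ (H →L[ℂ] H) :=
  (⨆ n, vNAlg π (wideRight n)).topologicalClosure

theorem isClosed_algF : IsClosed (algF π : Set (H →L[ℂ] H)) :=
  StarSubalgebra.isClosed_topologicalClosure _

theorem isClosed_algBl : IsClosed (algBl π : Set (H →L[ℂ] H)) :=
  StarSubalgebra.isClosed_topologicalClosure _

theorem isClosed_algBr : IsClosed (algBr π : Set (H →L[ℂ] H)) :=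
  StarSubalgebra.isClosed_topologicalClosure _

theorem vNAlg_le_algF (P : ConePair) : vNAlg π (P.left ∪ P.right)ᶜ ≤ algF π :=
  (le_iSup (fun P : ConePair => vNAlg π (P.left ∪ P.right)ᶜ) P).trans
    (StarSubalgebra.le_topologicalClosure _)

theorem vNAlg_leftCone_le_algBl (a : ℝ) {φ : ℝ} (hφ : φ ∈ Set.Ioo 0 Real.pi) :
    vNAlg π (leftCone a φ) ≤ algBl π :=
  (le_iSup (fun p : ℝ × Set.Ioo (0 : ℝ) Real.pi => vNAlg π (leftCone p.1 p.2)) (a, ⟨φ, hφ⟩)).trans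
    (StarSubalgebra.le_topologicalClosure _)

theorem vNAlg_rightCone_le_algBr (a : ℝ) {φ : ℝ} (hφ : φ ∈ Set.Ioo 0 Real.pi) :
    vNAlg π (rightCone a φ) ≤ algBr π := by
  obtain ⟨n, hn⟩ := (eventually_subset_wideRight a hφ).exists
  exact (vNAlg_mono π hn).trans ((le_iSup (fun n => vNAlg π (wideRight n)) n).trans
    (StarSubalgebra.le_topologicalClosure _))

theorem vNAlg_wideLeft_le_algBl (n : ℕ) : vNAlg π (wideLeft n) ≤ algBl π :=
  vNAlg_leftCone_le_algBl _ (wideAngle_mem n)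

theorem exists_approx_of_mem_algF {x : H →L[ℂ] H} (hx : x ∈ algF π) {η : ℝ} (hη : 0 < η) :
    ∃ P : ConePair, ∃ y ∈ vNAlg π (P.left ∪ P.right)ᶜ, ‖x - y‖ < η := by
  rw [← SetLike.mem_coe, coe_algF, Metric.mem_closure_iff] at hx
  obtain ⟨y, hy, hxy⟩ := hx η hη
  obtain ⟨P, hP⟩ := Set.mem_iUnion.1 hy
  exact ⟨P, y, hP, by rwa [dist_eq_norm] at hxy⟩

theorem eventually_approx_of_mem_algBl {x : H →L[ℂ] H} (hx : x ∈ algBl π) {η : ℝ} (hη : 0 < η) :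
    ∀ᶠ n in atTop, ∃ y ∈ vNAlg π (wideLeft n), ‖x - y‖ < η := by
  rw [← SetLike.mem_coe, coe_algBl, Metric.mem_closure_iff] at hx
  obtain ⟨y, hy, hxy⟩ := hx η hη
  obtain ⟨p, hp⟩ := Set.mem_iUnion.1 hy
  filter_upwards [eventually_subset_wideLeft p.1 p.2.2] with n hn
  exact ⟨y, vNAlg_mono π hn hp, by rwa [dist_eq_norm] at hxy⟩

theorem eventually_approx_of_mem_algBr {x : H →L[ℂ] H} (hx : x ∈ algBr π) {η : ℝ} (hη : 0 < η) :
    ∀ᶠ n in atTop, ∃ y ∈ vNAlg π (wideRight n), ‖x - y‖ < η := by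
  rw [← SetLike.mem_coe, algBr, StarSubalgebra.topologicalClosure_coe,
    StarSubalgebra.coe_iSup_of_directed (Monotone.directed_le fun m n h =>
      vNAlg_mono π (wideRight_mono h)), Metric.mem_closure_iff] at hx
  obtain ⟨y, hy, hxy⟩ := hx η hη
  obtain ⟨m, hm⟩ := Set.mem_iUnion.1 hy
  filter_upwards [eventually_ge_atTop m] with n hn
  exact ⟨y, vNAlg_mono π (wideRight_mono hn) hm, by rwa [dist_eq_norm] at hxy⟩

theorem algF_le_algBr : algF π ≤ algBr π := by
  refine StarSubalgebra.topologicalClosure_minimal (iSup_le fun P => ?_) isClosed_algBr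
  exact (vNAlg_mono π P.compl_union_subset_right).trans (vNAlg_rightCone_le_algBr _
    ⟨by linarith [P.angle₁.2], by linarith [P.angle₁.1]⟩)

theorem map_mem_algF (A : SpinAlg d) : π A ∈ algF π := by
  refine spinAlg_induction (P := fun A => π A ∈ algF π)
    (isClosed_algF.preimage (continuous_starAlgHom π)) ?_ ?_ ?_ ?_ ?_ A
  · intro z m
    obtain ⟨P, hP⟩ := ConePair.exists_latticePt_mem_compl z
    exact vNAlg_le_algF P (map_mem_vNAlg π (site_mem_localAlg hP m))
  · intro c; rw [AlgHomClass.commutes]; exact algebraMap_mem _ c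
  · intro x y hx hy; rw [map_add]; exact add_mem hx hy
  · intro x y hx hy; rw [map_mul]; exact mul_mem hx hy
  · intro x hx; rw [map_star]; exact star_mem hx

section Theta

variable {G : Type*} [Group G] {U : G →* Matrix.unitaryGroup (Fin d) ℂ} {R : G →* unitary (H →L[ℂ] H)}

theorem thetaOp_mul (g : G) (x y : H →L[ℂ] H) :
    thetaOp R g (x * y) = thetaOp R g x * thetaOp R g y :=
  conj_mul (R g).2 x y

theorem thetaOp_star (g : G) (x : H →L[ℂ] H) : thetaOp R g (star x) = star (thetaOp R g x) := by
  simp only [thetaOp, star_mul, star_star, mul_assoc]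

theorem thetaOp_one_right (g : G) : thetaOp R g 1 = 1 := by
  rw [thetaOp, mul_one, Unitary.mul_star_self_of_mem (R g).2]

theorem thetaOp_thetaOp (g h : G) (x : H →L[ℂ] H) :
    thetaOp R g (thetaOp R h x) = thetaOp R (g * h) x := by
  simp only [thetaOp, map_mul, Submonoid.coe_mul, star_mul, mul_assoc]

theorem thetaOp_one_left (x : H →L[ℂ] H) : thetaOp R 1 x = x := by
  simp [thetaOp]

theorem thetaOp_thetaOp_inv (g : G) (x : H →L[ℂ] H) : thetaOp R g (thetaOp R g⁻¹ x) = x := by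
  rw [thetaOp_thetaOp, mul_inv_cancel, thetaOp_one_left]

theorem norm_thetaOp_sub (g : G) (x y : H →L[ℂ] H) :
    ‖thetaOp R g x - thetaOp R g y‖ = ‖x - y‖ :=
  norm_conj_sub_conj (R g).2 x y

theorem continuous_thetaOp (g : G) : Continuous (thetaOp R g : (H →L[ℂ] H) → (H →L[ℂ] H)) :=
  (continuous_const.mul continuous_id).mul continuous_const

theorem thetaOp_mem_unitary (g : G) {x : H →L[ℂ] H} (hx : x ∈ unitary (H →L[ℂ] H)) :
    thetaOp R g x ∈ unitary (H →L[ℂ] H) :=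
  mul_mem (mul_mem (R g).2 hx) (Unitary.star_mem (R g).2)

variable (hR : ∀ (g : G) (A : SpinAlg d),
      (R g : H →L[ℂ] H) * π A * star (R g : H →L[ℂ] H) = π (onSite U Set.univ g A))

include hR

theorem thetaOp_rep (g : G) (A : SpinAlg d) : thetaOp R g (π A) = π (onSite U Set.univ g A) :=
  hR g A

theorem thetaOp_mem_commutant (g : G) {Γ : Set Plane} {x : H →L[ℂ] H} (hx : x ∈ commutant π Γ) :
    thetaOp R g x ∈ commutant π Γ := by
  rw [mem_commutant_iff] at hx ⊢
  intro A hA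
  have h := congrArg (thetaOp R g) (hx _ (onSite_mem_localAlg U Set.univ g⁻¹ hA))
  rwa [thetaOp_mul, thetaOp_mul, thetaOp_rep hR, onSite_onSite_inv] at h

theorem thetaOp_mem_vNAlg (g : G) {Γ : Set Plane} {x : H →L[ℂ] H} (hx : x ∈ vNAlg π Γ) :
    thetaOp R g x ∈ vNAlg π Γ := by
  rw [mem_vNAlg_iff] at hx ⊢
  intro y hy
  have h := congrArg (thetaOp R g) (hx _ (thetaOp_mem_commutant hR g⁻¹ hy))
  rwa [thetaOp_mul, thetaOp_mul, thetaOp_thetaOp_inv] at h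

theorem thetaOp_mem_algF (g : G) {x : H →L[ℂ] H} (hx : x ∈ algF π) : thetaOp R g x ∈ algF π := by
  rw [← SetLike.mem_coe, coe_algF] at hx ⊢
  refine map_mem_closure (continuous_thetaOp g) hx fun y hy => ?_
  obtain ⟨P, hP⟩ := Set.mem_iUnion.1 hy
  exact Set.mem_iUnion.2 ⟨P, thetaOp_mem_vNAlg hR g hP⟩

theorem thetaOp_mem_algBl (g : G) {x : H →L[ℂ] H} (hx : x ∈ algBl π) : thetaOp R g x ∈ algBl π := by
  rw [← SetLike.mem_coe, coe_algBl] at hx ⊢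
  refine map_mem_closure (continuous_thetaOp g) hx fun y hy => ?_
  obtain ⟨P, hP⟩ := Set.mem_iUnion.1 hy
  exact Set.mem_iUnion.2 ⟨P, thetaOp_mem_vNAlg hR g hP⟩

end Theta

end Algebras

/-! ### Charge transporters for a single region -/

section Transporters

variable {d : ℕ} {H : Type*} [NormedAddCommGroup H] [InnerProductSpace ℂ H] [CompleteSpace H]
  {π : SpinAlg d →⋆ₐ[ℂ] (H →L[ℂ] H)} {G : Type*} [Group G]
  {U : G →* Matrix.unitaryGroup (Fin d) ℂ} {R : G →* unitary (H →L[ℂ] H)}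

/-- The unitaries `V ∈ ℱ` with `Ad V ∘ ρ = π ∘ β_g` on `𝒜_Γ`. For a pair `(Λ₁, Λ₂)` the charge
transporters of degree `g` are such unitaries for `(g, Λ₁)` and for `(1, Λ₂)`. -/
def transportersOn (U : G →* Matrix.unitaryGroup (Fin d) ℂ) (π : SpinAlg d →⋆ₐ[ℂ] (H →L[ℂ] H))
    (g : G) (ρ : SpinAlg d →⋆ₐ[ℂ] (H →L[ℂ] H)) (Γ : Set Plane) : Set (H →L[ℂ] H) :=
  {V | V ∈ unitary (H →L[ℂ] H) ∧ V ∈ algF π ∧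
    ∀ A ∈ localAlg d Γ, V * ρ A * star V = π (onSite U Set.univ g A)}

theorem transportersOn_anti {g : G} {ρ : SpinAlg d →⋆ₐ[ℂ] (H →L[ℂ] H)} {Γ₁ Γ₂ : Set Plane}
    (h : Γ₁ ⊆ Γ₂) : transportersOn U π g ρ Γ₂ ⊆ transportersOn U π g ρ Γ₁ :=
  fun _ hV => ⟨hV.1, hV.2.1, fun A hA => hV.2.2 A (localAlg_mono h hA)⟩

theorem transporters_subset_left {g : G} {ρ : SpinAlg d →⋆ₐ[ℂ] (H →L[ℂ] H)} (P : ConePair) :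
    transporters U π g ρ P ⊆ transportersOn U π g ρ P.left := by
  intro V hV
  refine ⟨hV.1, hV.2.1, fun A hA => ?_⟩
  rw [hV.2.2 A (localAlg_mono Set.subset_union_left hA), onSite_of_subset U g subset_rfl hA]

theorem transporters_subset_right {g : G} {ρ : SpinAlg d →⋆ₐ[ℂ] (H →L[ℂ] H)} (P : ConePair) :
    transporters U π g ρ P ⊆ transportersOn U π 1 ρ P.right := by
  intro V hV
  refine ⟨hV.1, hV.2.1, fun A hA => ?_⟩
  rw [hV.2.2 A (localAlg_mono Set.subset_union_right hA),
    onSite_of_disjoint U g (Γ₁ := P.left) P.disjoint hA, onSite_one]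

variable {P₀ : ConePair} {g h : G} {ρ σ : SpinAlg d →⋆ₐ[ℂ] (H →L[ℂ] H)}

theorem exists_transporter_left (hρ : ρ ∈ sectors U π P₀ g) (a : ℝ) {φ : ℝ}
    (hφ : φ ∈ Set.Ioo 0 Real.pi) : ∃ V, V ∈ transportersOn U π g ρ (leftCone a φ) := by
  obtain ⟨P, hP⟩ := ConePair.exists_left_eq a hφ
  obtain ⟨V, hV⟩ := hρ.2.1 P
  exact ⟨V, hP ▸ transporters_subset_left P hV⟩

theorem exists_transporter_right (hρ : ρ ∈ sectors U π P₀ g) (a : ℝ) {φ : ℝ}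
    (hφ : φ ∈ Set.Ioo 0 Real.pi) : ∃ V, V ∈ transportersOn U π 1 ρ (rightCone a φ) := by
  obtain ⟨P, hP⟩ := ConePair.exists_right_eq a hφ
  obtain ⟨V, hV⟩ := hρ.2.1 P
  exact ⟨V, hP ▸ transporters_subset_right P hV⟩

theorem star_mul_unitary_mem {V : H →L[ℂ] H} (hV : V ∈ unitary (H →L[ℂ] H)) (g : G) :
    star V * (R g : H →L[ℂ] H) ∈ unitary (H →L[ℂ] H) :=
  mul_mem (Unitary.star_mem hV) (R g).2

theorem conj_star_mul (V x : H →L[ℂ] H) (g : G) :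
    star V * (R g : H →L[ℂ] H) * x * star (star V * (R g : H →L[ℂ] H)) =
      star V * thetaOp R g x * V := by
  simp only [thetaOp, star_mul, star_star, mul_assoc]

variable (hR : ∀ (g : G) (A : SpinAlg d),
      (R g : H →L[ℂ] H) * π A * star (R g : H →L[ℂ] H) = π (onSite U Set.univ g A))

include hR

theorem conj_rep_eq {Γ : Set Plane} {V : H →L[ℂ] H} (hV : V ∈ transportersOn U π g ρ Γ)
    {A : SpinAlg d} (hA : A ∈ localAlg d Γ) : star V * thetaOp R g (π A) * V = ρ A := by
  rw [thetaOp_rep hR, ← hV.2.2 A hA]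
  simp only [mul_assoc, star_mul_cancel hV.1, Unitary.star_mul_self_of_mem hV.1, mul_one]

/-- Two charge transporters for the same region implement the same map on `π(𝒜_Γ)''`. -/
theorem conj_transporter_eq {Γ : Set Plane} {V W : H →L[ℂ] H} (hV : V ∈ transportersOn U π g ρ Γ)
    (hW : W ∈ transportersOn U π h ρ Γ) {x : H →L[ℂ] H} (hx : x ∈ vNAlg π Γ) :
    star V * thetaOp R g x * V = star W * thetaOp R h x * W := by
  rw [← conj_star_mul, ← conj_star_mul]
  refine conj_eq_conj_of_mem_vNAlg (star_mul_unitary_mem hV.1 g) (star_mul_unitary_mem hW.1 h)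
    (fun A hA => ?_) hx
  rw [conj_star_mul, conj_star_mul, conj_rep_eq hR hV hA, conj_rep_eq hR hW hA]

/-- The representation `ρ`, which is unitarily implemented on an increasing sequence of regions,
extends to the C*-algebra generated by the corresponding von Neumann algebras. -/
theorem exists_extension (B : StarSubalgebra ℂ (H →L[ℂ] H)) (Γ : ℕ → Set Plane)
    (hΓ : ∀ m n, m ≤ n → Γ m ⊆ Γ n)
    (hB : ∀ x ∈ B, ∀ η > 0, ∃ n, ∃ y ∈ vNAlg π (Γ n), ‖x - y‖ < η)
    (hρ : ∀ n, ∃ V, V ∈ transportersOn U π g ρ (Γ n)) :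
    ∃ T : B →⋆ₐ[ℂ] (H →L[ℂ] H), ∀ n, ∀ Γ' ⊆ Γ n, ∀ (k : G), ∀ V ∈ transportersOn U π k ρ Γ',
      ∀ x : B, (x : H →L[ℂ] H) ∈ vNAlg π Γ' → T x = star V * thetaOp R k x * V := by
  choose V hV using hρ
  obtain ⟨T, hT⟩ := exists_limit_conj B (fun n => vNAlg π (Γ n))
    (fun n => star (V n) * (R g : H →L[ℂ] H)) (fun n => star_mul_unitary_mem (hV n).1 g) hB
    (fun n m hnm y hy => by
      rw [conj_star_mul, conj_star_mul]
      exact conj_transporter_eq hR (transportersOn_anti (hΓ n m hnm) (hV m)) (hV n) hy)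
  refine ⟨T, fun n Γ' hn k W hW x hx => tendsto_nhds_unique (hT x) (tendsto_const_nhds.congr' ?_)⟩
  filter_upwards [eventually_ge_atTop n] with m hm
  rw [conj_star_mul]
  exact conj_transporter_eq hR hW (transportersOn_anti (hn.trans (hΓ n m hm)) (hV m)) hx

/-! ### The extension of a sector to `ℬ_l` -/

theorem exists_leftExtension (hρ : ρ ∈ sectors U π P₀ g) :
    ∃ S : algBl π →⋆ₐ[ℂ] algBl π, IsLeftExtension π ρ S ∧
      ∀ n, ∀ Γ ⊆ wideLeft n, ∀ (k : G), ∀ V ∈ transportersOn U π k ρ Γ, ∀ x : algBl π,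
        (x : H →L[ℂ] H) ∈ vNAlg π Γ → (S x : H →L[ℂ] H) = star V * thetaOp R k x * V := by
  obtain ⟨T, hT⟩ := exists_extension (ρ := ρ) (g := g) hR (algBl π) wideLeft
    (fun m n => wideLeft_mono) (fun x hx η hη => (eventually_approx_of_mem_algBl hx hη).exists)
    (fun n => exists_transporter_left hρ _ (wideAngle_mem n))
  have hformula : ∀ (a φ : ℝ), φ ∈ Set.Ioo 0 Real.pi → ∀ V ∈ transportersOn U π g ρ (leftCone a φ),
      ∀ x : algBl π, (x : H →L[ℂ] H) ∈ vNAlg π (leftCone a φ) →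
        T x = star V * thetaOp R g x * V := by
    intro a φ hφ V hV x hx
    obtain ⟨n, hn⟩ := (eventually_subset_wideLeft a hφ).exists
    exact hT n _ hn g V hV x hx
  have hTB : ∀ x, T x ∈ algBl π := by
    intro x
    rw [← SetLike.mem_coe, ← isClosed_algBl.closure_eq, Metric.mem_closure_iff]
    intro η hη
    obtain ⟨n, y, hy, hxy⟩ := (eventually_approx_of_mem_algBl x.2 hη).exists
    obtain ⟨V, hV⟩ := exists_transporter_left hρ n (wideAngle_mem n)
    have hy' := vNAlg_wideLeft_le_algBl n hy
    refine ⟨T ⟨y, hy'⟩, ?_, ?_⟩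
    · rw [hformula _ _ (wideAngle_mem n) V hV ⟨y, hy'⟩ hy]
      have hVB := algF_le_algBl π hV.2.1
      exact mul_mem (mul_mem (star_mem hVB) (thetaOp_mem_algBl hR g hy')) hVB
    · rw [dist_eq_norm, ← map_sub]
      exact (StarSubalgebra.norm_map_le isClosed_algBl T _).trans_lt hxy
  refine ⟨T.codRestrict (algBl π) hTB, ⟨fun A => ?_, fun a φ hφ => ?_⟩, hT⟩
  · change T (repBl π A) = ρ A
    refine starAlgHom_ext_site (f := T.comp (repBl π)) (g := ρ) (fun z m => ?_) A
    have hmem : latticePt z ∈ leftCone (z.1 : ℝ) (Real.pi / 2) := by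
      rw [leftCone, Set.mem_compl_iff, sub_half, mem_rightCone]
      simp [latticePt]
    have hφ : Real.pi / 2 ∈ Set.Ioo 0 Real.pi := by constructor <;> linarith [Real.pi_pos]
    obtain ⟨V, hV⟩ := exists_transporter_left hρ (z.1 : ℝ) hφ
    have hs := site_mem_localAlg hmem m
    exact (hformula _ _ hφ V hV _ (map_mem_vNAlg π hs)).trans (conj_rep_eq hR hV hs)
  · obtain ⟨V, hV⟩ := exists_transporter_left hρ a hφ
    let : TopologicalSpace (algBl π) :=
      TopologicalSpace.induced (fun x : algBl π => (x : H →L[ℂ] H)) (sigmaWeak H)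
    let : TopologicalSpace (H →L[ℂ] H) := sigmaWeak H
    have hc : Continuous (fun x : algBl π => star V * (R g : H →L[ℂ] H) * (x : H →L[ℂ] H) *
        star (star V * (R g : H →L[ℂ] H))) :=
      (continuous_sigmaWeak_mul_mul _ _).comp continuous_induced_dom
    refine hc.continuousOn.congr fun x hx => ?_
    exact (hformula a φ hφ V hV x hx).trans (conj_star_mul V (x : H →L[ℂ] H) g).symm

omit hR in
/-- By the σ-weak density of `π(𝒜_Λ)` in `π(𝒜_Λ)''`, two left extensions of a representation agree
on all the algebras `π(𝒜_Λ)''`, hence everywhere. -/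
theorem IsLeftExtension.unique {S T : algBl π →⋆ₐ[ℂ] algBl π} (hS : IsLeftExtension π ρ S)
    (hT : IsLeftExtension π ρ T) : S = T := by
  have hloc : ∀ (a φ : ℝ), φ ∈ Set.Ioo 0 Real.pi → ∀ x : algBl π,
      (x : H →L[ℂ] H) ∈ vNAlg π (leftCone a φ) → (S x : H →L[ℂ] H) = T x := by
    intro a φ hφ x hx
    refine ContinuousLinearMap.ext fun η => ext_inner_left ℂ fun ξ => ?_
    let τ : TopologicalSpace (algBl π) :=
      TopologicalSpace.induced (fun x : algBl π => (x : H →L[ℂ] H)) (sigmaWeak H)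
    let M : StarSubalgebra ℂ (H →L[ℂ] H) := (localAlg d (leftCone a φ)).map π
    have hM : (M : Set (H →L[ℂ] H)) = π '' localAlg d (leftCone a φ) := rfl
    have hcont : ∀ {S : algBl π →⋆ₐ[ℂ] algBl π}, IsLeftExtension π ρ S →
        @ContinuousOn _ _ τ _ (fun x : algBl π => inner ℂ ξ ((S x : H →L[ℂ] H) η))
          {x | (x : H →L[ℂ] H) ∈ vNAlg π (leftCone a φ)} := fun hS =>
      @Continuous.comp_continuousOn _ _ _ τ (sigmaWeak H) _ _ _ _
        (continuous_sigmaWeak_inner ξ η) (hS.continuousOn a φ hφ)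
    refine @Set.EqOn.of_subset_closure _ _ τ _ _ (repBl π '' localAlg d (leftCone a φ))
      {x | (x : H →L[ℂ] H) ∈ vNAlg π (leftCone a φ)} _ _ ?_ (hcont hS) (hcont hT) ?_ ?_ _ hx
    · rintro _ ⟨A, hA, rfl⟩
      change inner ℂ ξ ((S (repBl π A) : H →L[ℂ] H) η) = inner ℂ ξ ((T (repBl π A) : H →L[ℂ] H) η)
      rw [hS.extends_rep, hT.extends_rep]
    · rintro _ ⟨A, hA, rfl⟩
      exact map_mem_vNAlg π hA
    · intro y hy
      rw [@closure_induced _ _ (sigmaWeak H)]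
      have h := mem_closure_sigmaWeak M (T := (y : H →L[ℂ] H)) (by rw [hM]; exact hy)
      rw [hM] at h
      have himg : (fun x : algBl π => (x : H →L[ℂ] H)) '' (repBl π '' localAlg d (leftCone a φ)) =
          π '' localAlg d (leftCone a φ) := by
        rw [Set.image_image]; rfl
      rw [himg]
      exact h
  refine StarAlgHom.ext fun x => Subtype.ext ?_
  refine eq_of_forall_dist_le fun η hη => ?_
  obtain ⟨n, y, hy, hxy⟩ := (eventually_approx_of_mem_algBl x.2 (half_pos hη)).exists
  have hy' := vNAlg_wideLeft_le_algBl n hy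
  have h1 := StarSubalgebra.norm_map_le isClosed_algBl ((algBl π).subtype.comp S) (x - ⟨y, hy'⟩)
  have h2 := StarSubalgebra.norm_map_le isClosed_algBl ((algBl π).subtype.comp T) (x - ⟨y, hy'⟩)
  rw [map_sub] at h1 h2
  have h3 : (S ⟨y, hy'⟩ : H →L[ℂ] H) = T ⟨y, hy'⟩ := hloc _ _ (wideAngle_mem n) _ hy
  have h1' : ‖(S x : H →L[ℂ] H) - S ⟨y, hy'⟩‖ < η / 2 := h1.trans_lt hxy
  have h2' : ‖(T x : H →L[ℂ] H) - S ⟨y, hy'⟩‖ < η / 2 := by rw [h3]; exact h2.trans_lt hxy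
  rw [← dist_eq_norm] at h1' h2'
  linarith [dist_triangle_right (S x : H →L[ℂ] H) (T x) (S ⟨y, hy'⟩)]

end Transporters

/-! ### Calculus of the extensions -/

section Extensions

variable {d : ℕ} {H : Type*} [NormedAddCommGroup H] [InnerProductSpace ℂ H] [CompleteSpace H]
  {π : SpinAlg d →⋆ₐ[ℂ] (H →L[ℂ] H)}

section General

variable (ρ : SpinAlg d →⋆ₐ[ℂ] (H →L[ℂ] H))

theorem extApply_of_mem {x : H →L[ℂ] H} (hx : x ∈ algBl π) :
    extApply π ρ x = leftExt π ρ ⟨x, hx⟩ := by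
  rw [extApply, dif_pos hx]

theorem extApply_mem_algBl {x : H →L[ℂ] H} (hx : x ∈ algBl π) : extApply π ρ x ∈ algBl π := by
  rw [extApply_of_mem ρ hx]
  exact (leftExt π ρ ⟨x, hx⟩).2

theorem extApply_mul {x y : H →L[ℂ] H} (hx : x ∈ algBl π) (hy : y ∈ algBl π) :
    extApply π ρ (x * y) = extApply π ρ x * extApply π ρ y := by
  have h1 : extApply π ρ (x * y) = (leftExt π ρ (⟨x, hx⟩ * ⟨y, hy⟩) : H →L[ℂ] H) :=
    extApply_of_mem ρ (mul_mem hx hy)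
  rw [h1, map_mul, MulMemClass.coe_mul, ← extApply_of_mem ρ hx, ← extApply_of_mem ρ hy]

theorem extApply_star {x : H →L[ℂ] H} (hx : x ∈ algBl π) :
    extApply π ρ (star x) = star (extApply π ρ x) := by
  have h1 : extApply π ρ (star x) = (leftExt π ρ (star ⟨x, hx⟩) : H →L[ℂ] H) :=
    extApply_of_mem ρ (star_mem hx)
  rw [h1, map_star, StarMemClass.coe_star, ← extApply_of_mem ρ hx]

theorem extApply_one : extApply π ρ 1 = 1 := by
  rw [extApply_of_mem ρ (one_mem _)]
  exact congrArg Subtype.val (map_one (leftExt π ρ))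

theorem norm_extApply_sub_le {x y : H →L[ℂ] H} (hx : x ∈ algBl π) (hy : y ∈ algBl π) :
    ‖extApply π ρ x - extApply π ρ y‖ ≤ ‖x - y‖ := by
  rw [extApply_of_mem ρ hx, extApply_of_mem ρ hy]
  have h := StarSubalgebra.norm_map_le isClosed_algBl ((algBl π).subtype.comp (leftExt π ρ))
    (⟨x, hx⟩ - ⟨y, hy⟩)
  rw [map_sub] at h
  exact h

theorem extApply_mem_unitary {x : H →L[ℂ] H} (hx : x ∈ algBl π) (hu : x ∈ unitary (H →L[ℂ] H)) :
    extApply π ρ x ∈ unitary (H →L[ℂ] H) := by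
  rw [Unitary.mem_iff, ← extApply_star ρ hx, ← extApply_mul ρ (star_mem hx) hx,
    ← extApply_mul ρ hx (star_mem hx), Unitary.star_mul_self_of_mem hu,
    Unitary.mul_star_self_of_mem hu, extApply_one]
  exact ⟨rfl, rfl⟩

theorem tendsto_extApply {ι : Type*} {l : Filter ι} {f : ι → H →L[ℂ] H} {x : H →L[ℂ] H}
    (hf : ∀ i, f i ∈ algBl π) (hx : x ∈ algBl π) (h : Tendsto f l (𝓝 x)) :
    Tendsto (fun i => extApply π ρ (f i)) l (𝓝 (extApply π ρ x)) := by
  rw [tendsto_iff_norm_sub_tendsto_zero] at h ⊢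
  exact squeeze_zero (fun i => norm_nonneg _) (fun i => norm_extApply_sub_le ρ (hf i) hx) h

end General

/-- Two Lipschitz maps that agree on `π(𝒜_Λ)''` for all left cones `Λ` agree on `ℬ_l`. -/
theorem eq_of_eqOn_vNAlg {E F : (H →L[ℂ] H) → (H →L[ℂ] H)} (C : ℝ)
    (hE : ∀ x ∈ algBl π, ∀ y ∈ algBl π, ‖E x - E y‖ ≤ C * ‖x - y‖)
    (hF : ∀ x ∈ algBl π, ∀ y ∈ algBl π, ‖F x - F y‖ ≤ C * ‖x - y‖)
    (h : ∀ n, ∀ x ∈ vNAlg π (wideLeft n), E x = F x) {x : H →L[ℂ] H} (hx : x ∈ algBl π) :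
    E x = F x := by
  refine eq_of_forall_dist_le fun η hη => ?_
  have hpos : 0 < |C| + 1 := by positivity
  obtain ⟨n, y, hy, hxy⟩ :=
    (eventually_approx_of_mem_algBl hx (div_pos hη (mul_pos two_pos hpos))).exists
  have hy' := vNAlg_wideLeft_le_algBl n hy
  have h1 := hE x hx y hy'
  have h2 := hF x hx y hy'
  rw [lt_div_iff₀ (by positivity)] at hxy
  have h3 : C * ‖x - y‖ ≤ (|C| + 1) * ‖x - y‖ :=
    mul_le_mul_of_nonneg_right (by linarith [le_abs_self C]) (norm_nonneg _)
  rw [← h n y hy, ← dist_eq_norm] at h2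
  rw [← dist_eq_norm] at h1
  linarith [dist_triangle_right (E x) (F x) (E y)]

variable {G : Type*} [Group G] {U : G →* Matrix.unitaryGroup (Fin d) ℂ}
  {R : G →* unitary (H →L[ℂ] H)} {P₀ : ConePair} {g h : G} {ρ σ : SpinAlg d →⋆ₐ[ℂ] (H →L[ℂ] H)}
  (hR : ∀ (g : G) (A : SpinAlg d),
      (R g : H →L[ℂ] H) * π A * star (R g : H →L[ℂ] H) = π (onSite U Set.univ g A))

include hR

theorem isLeftExtension_leftExt (hρ : ρ ∈ sectors U π P₀ g) :
    IsLeftExtension π ρ (leftExt π ρ) := by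
  have h : ∃ S, IsLeftExtension π ρ S := (exists_leftExtension hR hρ).imp fun _ h => h.1
  rw [leftExt, dif_pos h]
  exact h.choose_spec

theorem extApply_eq (hρ : ρ ∈ sectors U π P₀ g) {n : ℕ} {Γ : Set Plane} (hΓ : Γ ⊆ wideLeft n) {k : G}
    {V : H →L[ℂ] H} (hV : V ∈ transportersOn U π k ρ Γ) {x : H →L[ℂ] H} (hx : x ∈ vNAlg π Γ) :
    extApply π ρ x = star V * thetaOp R k x * V := by
  obtain ⟨S, hS, hS'⟩ := exists_leftExtension hR hρ
  have hxB := vNAlg_wideLeft_le_algBl n (vNAlg_mono π hΓ hx)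
  rw [extApply_of_mem ρ hxB, (isLeftExtension_leftExt hR hρ).unique hS]
  exact hS' n Γ hΓ k V hV ⟨x, hxB⟩ hx

theorem extApply_rep (hρ : ρ ∈ sectors U π P₀ g) (A : SpinAlg d) : extApply π ρ (π A) = ρ A := by
  rw [extApply_of_mem ρ (map_mem_algBl π A)]
  exact (isLeftExtension_leftExt hR hρ).extends_rep A

/-- The complement of `Λ₁ ∪ Λ₂` lies in a left cone, so the extension acts on its algebra as
conjugation by a charge transporter, that is, by elements of `ℱ`, and the symmetry. -/
theorem extApply_mem_algF (hρ : ρ ∈ sectors U π P₀ g) {x : H →L[ℂ] H} (hx : x ∈ algF π) :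
    extApply π ρ x ∈ algF π := by
  rw [← SetLike.mem_coe, ← isClosed_algF.closure_eq, Metric.mem_closure_iff]
  intro η hη
  obtain ⟨P, y, hy, hxy⟩ := exists_approx_of_mem_algF hx hη
  have hy' := vNAlg_le_algF P hy
  refine ⟨extApply π ρ y, ?_, ?_⟩
  · have hφ : Real.pi - P.φ₂ ∈ Set.Ioo 0 Real.pi :=
      ⟨by linarith [P.angle₂.2], by linarith [P.angle₂.1]⟩
    obtain ⟨n, hn⟩ := (eventually_subset_wideLeft P.a₂ hφ).exists
    obtain ⟨V, hV⟩ := exists_transporter_left hρ P.a₂ hφ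
    rw [extApply_eq hR hρ hn hV (vNAlg_mono π P.compl_union_subset_left hy)]
    exact mul_mem (mul_mem (star_mem hV.2.1) (thetaOp_mem_algF hR g hy')) hV.2.1
  · rw [dist_eq_norm]
    exact (norm_extApply_sub_le ρ (algF_le_algBl π hx) (algF_le_algBl π hy')).trans_lt hxy

theorem rep_mem_algF (hρ : ρ ∈ sectors U π P₀ g) (A : SpinAlg d) : ρ A ∈ algF π := by
  rw [← extApply_rep hR hρ]
  exact extApply_mem_algF hR hρ (map_mem_algF A)

/-- A sector also extends to the algebra of right cones, where it is transported without a symmetry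
action; both extensions agree on `ℱ`. -/
theorem exists_rightExtension (hρ : ρ ∈ sectors U π P₀ g) :
    ∃ T : algBr π →⋆ₐ[ℂ] (H →L[ℂ] H),
      (∀ n, ∀ Γ ⊆ wideRight n, ∀ (k : G), ∀ V ∈ transportersOn U π k ρ Γ, ∀ x : algBr π,
        (x : H →L[ℂ] H) ∈ vNAlg π Γ → T x = star V * thetaOp R k x * V) ∧
      ∀ x (hx : x ∈ algF π), T ⟨x, algF_le_algBr hx⟩ = extApply π ρ x := by
  obtain ⟨T, hT⟩ := exists_extension (ρ := ρ) (g := 1) hR (algBr π) wideRight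
    (fun m n => wideRight_mono) (fun x hx η hη => (eventually_approx_of_mem_algBr hx hη).exists)
    (fun n => exists_transporter_right hρ _ (wideAngle_mem n))
  refine ⟨T, hT, fun x hx => eq_of_forall_dist_le fun η hη => ?_⟩
  obtain ⟨P, y, hy, hxy⟩ := exists_approx_of_mem_algF hx (half_pos hη)
  have hyF := vNAlg_le_algF P hy
  have heq : T ⟨y, algF_le_algBr hyF⟩ = extApply π ρ y := by
    -- the complement of `Λ₁ ∪ Λ₂` lies in a left cone and in a right cone
    have hφ : Real.pi - P.φ₂ ∈ Set.Ioo 0 Real.pi :=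
      ⟨by linarith [P.angle₂.2], by linarith [P.angle₂.1]⟩
    have hφ' : Real.pi - P.φ₁ ∈ Set.Ioo 0 Real.pi :=
      ⟨by linarith [P.angle₁.2], by linarith [P.angle₁.1]⟩
    obtain ⟨n, hn⟩ := (eventually_subset_wideLeft P.a₂ hφ).exists
    obtain ⟨m, hm⟩ := (eventually_subset_wideRight P.a₁ hφ').exists
    obtain ⟨V, hV⟩ := exists_transporter_left hρ P.a₂ hφ
    have hV' := transportersOn_anti P.compl_union_subset_left hV
    rw [extApply_eq hR hρ (P.compl_union_subset_left.trans hn) hV' hy]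
    exact hT m _ (P.compl_union_subset_right.trans hm) g V hV' _ hy
  have h1 := StarSubalgebra.norm_map_le isClosed_algBr T
    (⟨x, algF_le_algBr hx⟩ - ⟨y, algF_le_algBr hyF⟩)
  rw [map_sub, heq] at h1
  have h1' : ‖T ⟨x, algF_le_algBr hx⟩ - extApply π ρ y‖ < η / 2 := h1.trans_lt hxy
  have h2 := norm_extApply_sub_le ρ (algF_le_algBl π hx) (algF_le_algBl π hyF)
  rw [← dist_eq_norm] at h1' h2
  linarith [dist_triangle_right (T ⟨x, algF_le_algBr hx⟩) (extApply π ρ x) (extApply π ρ y)]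

/-- Transporting the extension of `σ` far to the right turns it into the action of `h`, up to the
distance of the argument from the algebra of the left cone. -/
theorem norm_conj_extApply_left_le (hσ : σ ∈ sectors U π P₀ h) {n : ℕ} {Γ : Set Plane}
    (hΓ : Γ ⊆ wideLeft n) {W : H →L[ℂ] H} (hW : W ∈ transportersOn U π h σ Γ) {X X₀ : H →L[ℂ] H}
    (hX : X ∈ algBl π) (hX₀ : X₀ ∈ vNAlg π Γ) :
    ‖W * extApply π σ (thetaOp R h⁻¹ X) * star W - X‖ ≤ 2 * ‖X - X₀‖ := by
  have hX₀B := vNAlg_wideLeft_le_algBl n (vNAlg_mono π hΓ hX₀)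
  have h0 : W * extApply π σ (thetaOp R h⁻¹ X₀) * star W = X₀ := by
    rw [extApply_eq hR hσ hΓ hW (thetaOp_mem_vNAlg hR _ hX₀), thetaOp_thetaOp_inv]
    simp only [mul_assoc, mul_star_cancel hW.1, Unitary.mul_star_self_of_mem hW.1, mul_one]
  have h1 := norm_extApply_sub_le σ (thetaOp_mem_algBl hR h⁻¹ hX) (thetaOp_mem_algBl hR h⁻¹ hX₀B)
  rw [norm_thetaOp_sub, ← norm_conj_sub_conj hW.1, h0, ← dist_eq_norm, ← dist_eq_norm] at h1
  rw [← dist_eq_norm, ← dist_eq_norm]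
  linarith [dist_triangle_right (W * extApply π σ (thetaOp R h⁻¹ X) * star W) X X₀]

/-- Transporting the extension of `ρ` far to the left turns it into the identity, up to the distance
of the argument from the algebra of the right cone. -/
theorem norm_conj_extApply_right_le (hρ : ρ ∈ sectors U π P₀ g) {n : ℕ} {Γ : Set Plane}
    (hΓ : Γ ⊆ wideRight n) {V : H →L[ℂ] H} (hV : V ∈ transportersOn U π 1 ρ Γ) {Y Y₀ : H →L[ℂ] H}
    (hY : Y ∈ algF π) (hY₀ : Y₀ ∈ vNAlg π Γ) :
    ‖V * extApply π ρ Y * star V - Y‖ ≤ 2 * ‖Y - Y₀‖ := by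
  obtain ⟨T, hT, hTF⟩ := exists_rightExtension hR hρ
  have hY₀B : Y₀ ∈ algBr π := vNAlg_rightCone_le_algBr _ (wideAngle_mem n) (vNAlg_mono π hΓ hY₀)
  have h0 : V * T ⟨Y₀, hY₀B⟩ * star V = Y₀ := by
    rw [hT n Γ hΓ 1 V hV ⟨Y₀, hY₀B⟩ hY₀, thetaOp_one_left]
    simp only [mul_assoc, mul_star_cancel hV.1, Unitary.mul_star_self_of_mem hV.1, mul_one]
  have h1 := StarSubalgebra.norm_map_le isClosed_algBr T (⟨Y, algF_le_algBr hY⟩ - ⟨Y₀, hY₀B⟩)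
  rw [map_sub, hTF Y hY, ← norm_conj_sub_conj hV.1, h0] at h1
  have h1' : ‖V * extApply π ρ Y * star V - Y₀‖ ≤ ‖Y - Y₀‖ := h1
  rw [← dist_eq_norm, ← dist_eq_norm] at h1' ⊢
  linarith [dist_triangle_right (V * extApply π ρ Y * star V) Y Y₀]

theorem tensor_apply (hσ : σ ∈ sectors U π P₀ h) (A : SpinAlg d) :
    tensor π ρ σ A = extApply π ρ (σ A) := by
  rw [← extApply_rep hR hσ, extApply_of_mem ρ (extApply_mem_algBl σ (map_mem_algBl π A))]
  simp only [extApply_of_mem σ (map_mem_algBl π A)]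
  rfl

/-! ### Group translates and tensor products of sectors -/

omit hR in
theorem thetaRep_apply (k : G) (A : SpinAlg d) :
    thetaRep U R k ρ A = thetaOp R k (ρ (onSite U Set.univ k⁻¹ A)) := rfl

theorem thetaOp_mem_transporters (k : G) {P : ConePair} {V : H →L[ℂ] H}
    (hV : V ∈ transporters U π g ρ P) :
    thetaOp R k V ∈ transporters U π (k * g * k⁻¹) (thetaRep U R k ρ) P := by
  refine ⟨thetaOp_mem_unitary k hV.1, thetaOp_mem_algF hR k hV.2.1, fun A hA => ?_⟩
  rw [thetaRep_apply, ← thetaOp_star, ← thetaOp_mul, ← thetaOp_mul,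
    hV.2.2 _ (onSite_mem_localAlg U _ _ hA), thetaOp_rep hR, onSite_conj]

theorem thetaOp_mem_transportersOn (k : G) {Γ : Set Plane} {V : H →L[ℂ] H}
    (hV : V ∈ transportersOn U π g ρ Γ) :
    thetaOp R k V ∈ transportersOn U π (k * g * k⁻¹) (thetaRep U R k ρ) Γ := by
  refine ⟨thetaOp_mem_unitary k hV.1, thetaOp_mem_algF hR k hV.2.1, fun A hA => ?_⟩
  rw [thetaRep_apply, ← thetaOp_star, ← thetaOp_mul, ← thetaOp_mul,
    hV.2.2 _ (onSite_mem_localAlg U _ _ hA), thetaOp_rep hR, onSite_conj]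

theorem thetaRep_mem_sectors (k : G) (hρ : ρ ∈ sectors U π P₀ g) :
    thetaRep U R k ρ ∈ sectors U π P₀ (k * g * k⁻¹) := by
  refine ⟨fun a θ φ hφ => ?_, fun P => ?_, ?_⟩
  · obtain ⟨V, hV, hVρ⟩ := hρ.1 a θ φ hφ
    refine ⟨thetaOp R k V, thetaOp_mem_unitary k hV, fun A hA => ?_⟩
    rw [thetaRep_apply, ← thetaOp_star, ← thetaOp_mul, ← thetaOp_mul,
      hVρ _ (onSite_mem_localAlg U _ _ hA), thetaOp_rep hR, onSite_onSite_inv]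
  · obtain ⟨V, hV⟩ := hρ.2.1 P
    exact ⟨_, thetaOp_mem_transporters hR k hV⟩
  · have h := thetaOp_mem_transporters hR k hρ.2.2
    rwa [thetaOp_one_right] at h

theorem mul_extApply_mem_transporters (hρ : ρ ∈ sectors U π P₀ g) (hσ : σ ∈ sectors U π P₀ h)
    {P : ConePair} {V W : H →L[ℂ] H} (hV : V ∈ transporters U π g ρ P)
    (hW : W ∈ transporters U π h σ P) :
    V * extApply π ρ W ∈ transporters U π (g * h) (tensor π ρ σ) P := by
  have hWB := algF_le_algBl π hW.2.1
  refine ⟨mul_mem hV.1 (extApply_mem_unitary ρ hWB hW.1),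
    mul_mem hV.2.1 (extApply_mem_algF hR hρ hW.2.1), fun A hA => ?_⟩
  have hσB := algF_le_algBl π (rep_mem_algF hR hσ A)
  have h1 : extApply π ρ W * extApply π ρ (σ A) * star (extApply π ρ W) =
      ρ (onSite U P.left h A) := by
    rw [← extApply_star ρ hWB, ← extApply_mul ρ hWB hσB,
      ← extApply_mul ρ (mul_mem hWB hσB) (star_mem hWB), hW.2.2 A hA, extApply_rep hR hρ]
  rw [tensor_apply hR hσ, star_mul, mul_assoc V, mul_assoc V, ← mul_assoc (_ * _) (star _), h1,
    ← mul_assoc, hV.2.2 _ (onSite_mem_localAlg U _ _ hA), onSite_onSite]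

end Extensions

/-! ### Consequences of approximate Haag duality -/

section Haag

variable {d : ℕ} {H : Type*} [NormedAddCommGroup H] [InnerProductSpace ℂ H] [CompleteSpace H]
  {π : SpinAlg d →⋆ₐ[ℂ] (H →L[ℂ] H)}

theorem norm_conj_sub_conj_le {u w : H →L[ℂ] H} (hu : u ∈ unitary (H →L[ℂ] H))
    (hw : w ∈ unitary (H →L[ℂ] H)) (y : H →L[ℂ] H) :
    ‖u * y * star u - w * y * star w‖ ≤ 2 * ‖u - w‖ * ‖u * y * star u‖ := by
  have h : u * y * star u - w * y * star w = (u - w) * y * star u + w * y * star (u - w) := by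
    rw [star_sub]
    noncomm_ring
  have h1 : ‖(u - w) * y * star u‖ ≤ ‖u - w‖ * ‖y‖ := by
    rw [CStarRing.norm_mul_mem_unitary _ (Unitary.star_mem hu)]
    exact norm_mul_le _ _
  have h2 : ‖w * y * star (u - w)‖ ≤ ‖u - w‖ * ‖y‖ := by
    rw [mul_assoc, CStarRing.norm_mem_unitary_mul _ hw, mul_comm ‖u - w‖, ← norm_star (u - w)]
    exact norm_mul_le _ _
  rw [h, norm_conj hu]
  linarith [norm_add_le ((u - w) * y * star u) (w * y * star (u - w))]

/-- Operators commuting with the complement of a narrow right cone are, up to an error that depends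
only on the distance `t` of the apices, localized in a slightly wider right cone. -/
theorem RightHaagDuality.approx (hr : RightHaagDuality π) {ψ ε : ℝ} (hψ : ψ ∈ Set.Ioo 0 (Real.pi / 2))
    (hε : 0 < ε) (hψε : 2 * ψ + 2 * ε < Real.pi) :
    ∃ f : ℝ → ℝ, Tendsto f atTop (𝓝 0) ∧ ∃ r : ℝ, ∀ b : ℝ, ∀ x ∈ commutant π (rightCone b ψ)ᶜ,
      ∀ t ≥ r, ∃ x₀ ∈ vNAlg π (rightCone (b - t) (ψ + 2 * ε)), ‖x - x₀‖ ≤ f t * ‖x‖ := by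
  obtain ⟨r, hr0, f, hf, h⟩ := hr ψ hψ ε hε hψε
  refine ⟨fun t => 2 * f ε t, by simpa using (hf ε hε).2.const_mul 2, r, fun b x hx t ht => ?_⟩
  obtain ⟨u, hu, hxu, hw⟩ := h b
  obtain ⟨y, hy, rfl⟩ := hxu x hx
  have hψ1 := hψ.1
  obtain ⟨w, hwu, hwv, -, huw⟩ := hw ε hε (by linarith) t (by linarith)
  have hangle : ψ + ε + ε = ψ + 2 * ε := by ring
  rw [hangle] at hwv
  have hy' : y ∈ vNAlg π (rightCone (b - t) (ψ + 2 * ε)) :=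
    vNAlg_mono π (rightCone_mono (by linarith) (by linarith) (by linarith) (by linarith)) hy
  refine ⟨w * y * star w, mul_mem (mul_mem hwv hy') (star_mem hwv), ?_⟩
  refine (norm_conj_sub_conj_le hu hwu y).trans ?_
  exact mul_le_mul_of_nonneg_right (by linarith) (norm_nonneg _)

/-- The mirror image of `RightHaagDuality.approx`. -/
theorem LeftHaagDuality.approx (hl : LeftHaagDuality π) {ψ ε : ℝ} (hψ : ψ ∈ Set.Ioo 0 (Real.pi / 2))
    (hε : 0 < ε) (hψε : 2 * ψ + 2 * ε < Real.pi) :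
    ∃ f : ℝ → ℝ, Tendsto f atTop (𝓝 0) ∧ ∃ r : ℝ, ∀ b : ℝ,
      ∀ x ∈ commutant π (cone (onAxis b) Real.pi ψ)ᶜ,
      ∀ t ≥ r, ∃ x₀ ∈ vNAlg π (leftCone (b + t) (ψ + 2 * ε)), ‖x - x₀‖ ≤ f t * ‖x‖ := by
  obtain ⟨r, hr0, f, hf, h⟩ := hl ψ hψ ε hε hψε
  refine ⟨fun t => 2 * f ε t, by simpa using (hf ε hε).2.const_mul 2, r, fun b x hx t ht => ?_⟩
  obtain ⟨u, hu, hxu, hw⟩ := h b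
  obtain ⟨y, hy, rfl⟩ := hxu x hx
  have hψ1 := hψ.1
  obtain ⟨w, hwu, hwv, -, huw⟩ := hw ε hε (by linarith) t (by linarith)
  have hangle : ψ + ε + ε = ψ + 2 * ε := by ring
  rw [hangle] at hwv
  have hwv' := vNAlg_mono π (cone_pi_subset_leftCone _ _) hwv
  have hy' : y ∈ vNAlg π (leftCone (b + t) (ψ + 2 * ε)) :=
    vNAlg_mono π ((cone_pi_subset_leftCone _ _).trans
      (leftCone_mono (by linarith) (by linarith) (by linarith) (by linarith))) hy
  refine ⟨w * y * star w, mul_mem (mul_mem hwv' hy') (star_mem hwv'), ?_⟩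
  refine (norm_conj_sub_conj_le hu hwu y).trans ?_
  exact mul_le_mul_of_nonneg_right (by linarith) (norm_nonneg _)

theorem mem_of_approx {B : StarSubalgebra ℂ (H →L[ℂ] H)} (hB : IsClosed (B : Set (H →L[ℂ] H)))
    {x : H →L[ℂ] H} {f : ℝ → ℝ} (hf : Tendsto f atTop (𝓝 0)) {r : ℝ}
    (h : ∀ t ≥ r, ∃ x₀ ∈ B, ‖x - x₀‖ ≤ f t * ‖x‖) : x ∈ B := by
  rw [← SetLike.mem_coe, ← hB.closure_eq, Metric.mem_closure_iff]
  intro η hη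
  have hf' : Tendsto (fun t => f t * ‖x‖) atTop (𝓝 0) := by simpa using hf.mul_const ‖x‖
  obtain ⟨t, ht1, ht2⟩ := ((hf'.eventually_lt_const hη).and (eventually_ge_atTop r)).exists
  obtain ⟨x₀, hx₀, hxx⟩ := h t ht2
  exact ⟨x₀, hx₀, by rw [dist_eq_norm]; linarith⟩

theorem RightHaagDuality.commutant_le (hr : RightHaagDuality π) (b : ℝ) {ψ : ℝ}
    (hψ : ψ ∈ Set.Ioo 0 (Real.pi / 2)) : commutant π (rightCone b ψ)ᶜ ≤ algBr π := by
  intro x hx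
  have hψ1 := hψ.1
  have hψ2 := hψ.2
  obtain ⟨f, hf, r, h⟩ := hr.approx hψ (ε := (Real.pi / 2 - ψ) / 2) (by linarith) (by linarith)
  refine mem_of_approx isClosed_algBr hf (r := r) fun t ht => ?_
  obtain ⟨x₀, hx₀, hxx⟩ := h b x hx t ht
  exact ⟨x₀, vNAlg_rightCone_le_algBr _ ⟨by linarith, by linarith⟩ hx₀, hxx⟩

theorem LeftHaagDuality.commutant_le (hl : LeftHaagDuality π) (b : ℝ) {ψ : ℝ}
    (hψ : ψ ∈ Set.Ioo 0 (Real.pi / 2)) : commutant π (cone (onAxis b) Real.pi ψ)ᶜ ≤ algBl π := by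
  intro x hx
  have hψ1 := hψ.1
  have hψ2 := hψ.2
  obtain ⟨f, hf, r, h⟩ := hl.approx hψ (ε := (Real.pi / 2 - ψ) / 2) (by linarith) (by linarith)
  refine mem_of_approx isClosed_algBl hf (r := r) fun t ht => ?_
  obtain ⟨x₀, hx₀, hxx⟩ := h b x hx t ht
  exact ⟨x₀, vNAlg_leftCone_le_algBl _ ⟨by linarith, by linarith⟩ hx₀, hxx⟩

variable {G : Type*} [Group G] {U : G →* Matrix.unitaryGroup (Fin d) ℂ}
  {R : G →* unitary (H →L[ℂ] H)} {P₀ : ConePair} {g h : G} {ρ σ : SpinAlg d →⋆ₐ[ℂ] (H →L[ℂ] H)}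

/-- Two unitaries that transport `ρ` on `𝒜_Γ` with the same symmetry differ by an element of the
commutant of `π(𝒜_Γ)`. -/
theorem mul_star_mem_commutant {Γ : Set Plane} {V W : H →L[ℂ] H} (hV : V ∈ unitary (H →L[ℂ] H))
    (hW : W ∈ unitary (H →L[ℂ] H)) {τ : SpinAlg d ≃⋆ₐ[ℂ] SpinAlg d}
    (hτ : ∀ A ∈ localAlg d Γ, τ.symm A ∈ localAlg d Γ)
    (hVρ : ∀ A ∈ localAlg d Γ, V * ρ A * star V = π (τ A))
    (hWρ : ∀ A ∈ localAlg d Γ, W * ρ A * star W = π (τ A)) : V * star W ∈ commutant π Γ := by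
  rw [mem_commutant_iff]
  intro A hA
  have h1 := hVρ _ (hτ A hA)
  have h2 := hWρ _ (hτ A hA)
  rw [StarAlgEquiv.apply_symm_apply] at h1 h2
  calc π A * (V * star W) = V * ρ (τ.symm A) * star V * (V * star W) := by rw [h1]
    _ = V * star W * (W * ρ (τ.symm A) * star W) := by
      simp only [mul_assoc, star_mul_cancel hV, star_mul_cancel hW]
    _ = V * star W * π A := by rw [h2]

theorem onSite_symm_mem_localAlg {Γ Γ' : Set Plane} (g : G) {A : SpinAlg d}
    (hA : A ∈ localAlg d Γ) : (onSite U Γ' g).symm A ∈ localAlg d Γ := by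
  have h : (onSite U Γ' g).symm A = onSite U Γ' g⁻¹ A := by
    rw [StarAlgEquiv.symm_apply_eq, onSite_onSite_inv]
  rw [h]
  exact onSite_mem_localAlg U _ _ hA

theorem transporter_mul_star_mem_commutant {Γ : Set Plane} {V W : H →L[ℂ] H}
    (hV : V ∈ transportersOn U π g ρ Γ) (hW : W ∈ transportersOn U π g ρ Γ) :
    V * star W ∈ commutant π Γ :=
  mul_star_mem_commutant hV.1 hW.1 (fun _ hA => onSite_symm_mem_localAlg g hA) hV.2.2 hW.2.2

variable (hR : ∀ (g : G) (A : SpinAlg d),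
      (R g : H →L[ℂ] H) * π A * star (R g : H →L[ℂ] H) = π (onSite U Set.univ g A))

include hR

/-- The superselection criterion for tensor products: a unitary `V` that trivialises `σ` outside a
thin cone belongs to `ℬ_l` or, up to a symmetry, to `ℬ_r`, by approximate Haag duality, so that one
of the two extensions of `ρ` can be applied to it. -/
theorem superselection_tensor (hr : RightHaagDuality π) (hl : LeftHaagDuality π)
    (hρ : ρ ∈ sectors U π P₀ g) (hσ : σ ∈ sectors U π P₀ h) : Superselection π (tensor π ρ σ) := by
  intro a θ φ hφ
  obtain ⟨θ', φ', hφ', hsub, b, ψ, hψ, hcone⟩ := exists_subcone a θ hφ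
  have hψ1 := hψ.1
  have hψ2 := hψ.2
  have hψπ : Real.pi - ψ ∈ Set.Ioo 0 Real.pi := ⟨by linarith, by linarith⟩
  obtain ⟨V₁, hV₁, hV₁ρ⟩ := hρ.1 a θ' φ' hφ'
  obtain ⟨V, hV, hVσ⟩ := hσ.1 a θ' φ' hφ'
  suffices h : ∃ V' ∈ unitary (H →L[ℂ] H), ∀ A ∈ localAlg d (cone a θ' φ')ᶜ,
      V' * tensor π ρ σ A * star V' = π A by
    obtain ⟨V', h1, h2⟩ := h
    exact ⟨V', h1, fun A hA => h2 A (localAlg_mono (Set.compl_subset_compl.2 hsub) hA)⟩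
  rcases hcone with hcone | hcone
  · have hsub' := localAlg_mono (d := d) (Set.compl_subset_compl.2 hcone)
    have hΓ : (rightCone b ψ)ᶜ = leftCone b (Real.pi - ψ) := compl_rightCone b ψ
    obtain ⟨W, hW⟩ := exists_transporter_left hσ b hψπ
    rw [← hΓ] at hW
    -- `R_h V` and `W` both transport `σ` to `π ∘ β_h` outside the right cone
    have hZW : (R h : H →L[ℂ] H) * V * star W ∈ algBr π := by
      refine hr.commutant_le b hψ (mul_star_mem_commutant (ρ := σ) (mul_mem (R h).2 hV) hW.1
        (fun _ hA => onSite_symm_mem_localAlg h hA) (fun A hA => ?_) hW.2.2)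
      rw [← hR, ← hVσ A (hsub' hA)]
      simp only [star_mul, mul_assoc]
    have hZ : (R h : H →L[ℂ] H) * V ∈ algBr π := by
      have h1 := mul_mem hZW (algF_le_algBr hW.2.1)
      rwa [mul_assoc _ (star W), Unitary.star_mul_self_of_mem hW.1, mul_one] at h1
    obtain ⟨T, -, hTF⟩ := exists_rightExtension hR hρ
    set Z : algBr π := ⟨_, hZ⟩ with hZdef
    have hZu : star Z * Z = 1 ∧ Z * star Z = 1 := by
      have hu : (R h : H →L[ℂ] H) * V ∈ unitary (H →L[ℂ] H) := mul_mem (R h).2 hV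
      exact ⟨Subtype.ext (Unitary.star_mul_self_of_mem hu),
        Subtype.ext (Unitary.mul_star_self_of_mem hu)⟩
    have hTZ : T Z ∈ unitary (H →L[ℂ] H) := by
      rw [Unitary.mem_iff, ← map_star, ← map_mul, ← map_mul, hZu.1, hZu.2, map_one]
      exact ⟨rfl, rfl⟩
    refine ⟨star (R h : H →L[ℂ] H) * (V₁ * T Z),
      mul_mem (Unitary.star_mem (R h).2) (mul_mem hV₁ hTZ), fun A hA => ?_⟩
    have hσF := rep_mem_algF hR hσ A
    have h1 : T Z * tensor π ρ σ A * star (T Z) = ρ (onSite U Set.univ h A) := by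
      have h2 : Z * ⟨σ A, algF_le_algBr hσF⟩ * star Z =
          ⟨π (onSite U Set.univ h A), algF_le_algBr (map_mem_algF _)⟩ := by
        refine Subtype.ext ?_
        change (R h : H →L[ℂ] H) * V * σ A * star ((R h : H →L[ℂ] H) * V) = π (onSite U Set.univ h A)
        rw [← hR, ← hVσ A hA]
        simp only [star_mul, mul_assoc]
      rw [tensor_apply hR hσ, ← hTF _ hσF, ← map_star, ← map_mul, ← map_mul, h2,
        hTF _ (map_mem_algF _), extApply_rep hR hρ]
    calc star (R h : H →L[ℂ] H) * (V₁ * T Z) * tensor π ρ σ A *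
          star (star (R h : H →L[ℂ] H) * (V₁ * T Z))
        = star (R h : H →L[ℂ] H) * (V₁ * (T Z * tensor π ρ σ A * star (T Z)) * star V₁) * R h := by
          simp only [star_mul, star_star, mul_assoc]
      _ = star (R h : H →L[ℂ] H) * (R h * π A * star (R h : H →L[ℂ] H)) * R h := by
          rw [h1, hV₁ρ _ (onSite_mem_localAlg U _ _ hA), hR]
      _ = π A := by
          simp only [mul_assoc, Unitary.star_mul_self_of_mem (R h).2, mul_one,
            star_mul_cancel (R h).2]
  · have hsub' := localAlg_mono (d := d) (Set.compl_subset_compl.2 hcone)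
    -- right cones are open: the shift by 1 makes room for the boundary of the open cone
    have hΓ : (cone (onAxis b) Real.pi ψ)ᶜ ⊆ rightCone (b - 1) (Real.pi - ψ) := by
      have := compl_cone_pi_subset_rightCone (b - 1) hψπ
      rwa [sub_add_cancel, sub_sub_cancel] at this
    obtain ⟨W, hW⟩ := exists_transporter_right hσ (b - 1) hψπ
    have hW' := transportersOn_anti hΓ hW
    have hVW : V * star W ∈ algBl π := by
      refine hl.commutant_le b hψ (mul_star_mem_commutant (ρ := σ) hV hW.1
        (fun _ hA => onSite_symm_mem_localAlg (1 : G) hA) (fun A hA => ?_) hW'.2.2)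
      rw [hVσ A (hsub' hA), onSite_one]
    have hVB : V ∈ algBl π := by
      have h1 := mul_mem hVW (algF_le_algBl π hW.2.1)
      rwa [mul_assoc, Unitary.star_mul_self_of_mem hW.1, mul_one] at h1
    refine ⟨V₁ * extApply π ρ V, mul_mem hV₁ (extApply_mem_unitary ρ hVB hV), fun A hA => ?_⟩
    have hσB := algF_le_algBl π (rep_mem_algF hR hσ A)
    have h1 : extApply π ρ V * extApply π ρ (σ A) * star (extApply π ρ V) = ρ A := by
      rw [← extApply_star ρ hVB, ← extApply_mul ρ hVB hσB,
        ← extApply_mul ρ (mul_mem hVB hσB) (star_mem hVB), hVσ A hA, extApply_rep hR hρ]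
    rw [tensor_apply hR hσ, star_mul, mul_assoc V₁, mul_assoc V₁, ← mul_assoc (_ * _) (star _), h1,
      ← mul_assoc, hV₁ρ A hA]

theorem tensor_mem_sectors (hr : RightHaagDuality π) (hl : LeftHaagDuality π)
    (hρ : ρ ∈ sectors U π P₀ g) (hσ : σ ∈ sectors U π P₀ h) :
    tensor π ρ σ ∈ sectors U π P₀ (g * h) := by
  refine ⟨superselection_tensor hR hr hl hρ hσ, fun P => ?_, ?_⟩
  · obtain ⟨V, hV⟩ := hρ.2.1 P
    obtain ⟨W, hW⟩ := hσ.2.1 P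
    exact ⟨_, mul_extApply_mem_transporters hR hρ hσ hV hW⟩
  · have := mul_extApply_mem_transporters hR hρ hσ hρ.2.2 hσ.2.2
    rwa [extApply_one, one_mul] at this

end Haag

/-! ### Existence of the braiding -/

section Braiding

variable {d : ℕ} {H : Type*} [NormedAddCommGroup H] [InnerProductSpace ℂ H] [CompleteSpace H]
  {π : SpinAlg d →⋆ₐ[ℂ] (H →L[ℂ] H)} {G : Type*} [Group G]
  {U : G →* Matrix.unitaryGroup (Fin d) ℂ} {R : G →* unitary (H →L[ℂ] H)}

/-- The operator `(W ⊗ Θ(h⁻¹)(V))^* (V ⊗ W)` that approximates the braiding of `ρ` and `σ`. -/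
noncomputable def braidApprox (π : SpinAlg d →⋆ₐ[ℂ] (H →L[ℂ] H)) (R : G →* unitary (H →L[ℂ] H))
    (h : G) (ρ σ : SpinAlg d →⋆ₐ[ℂ] (H →L[ℂ] H)) (V W : H →L[ℂ] H) : H →L[ℂ] H :=
  star (tensorHom π σ W (thetaOp R h⁻¹ V)) * tensorHom π ρ V W

/-- `e` is the limit of `braidApprox` as the distance between the apex of the right cone, for which
`V` is a charge transporter of `ρ`, and the apex of the left cone, for which `W` is a charge
transporter of `σ`, tends to infinity. Only the distance matters, not the position. -/
def IsBraid (U : G →* Matrix.unitaryGroup (Fin d) ℂ) (π : SpinAlg d →⋆ₐ[ℂ] (H →L[ℂ] H))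
    (R : G →* unitary (H →L[ℂ] H)) (h : G) (ρ σ : SpinAlg d →⋆ₐ[ℂ] (H →L[ℂ] H)) (e : H →L[ℂ] H) :
    Prop :=
  ∀ φ ∈ Set.Ioo 0 Real.pi, ∀ ψ ∈ Set.Ioo 0 Real.pi, Real.pi < φ + ψ → ∀ η > 0, ∃ N : ℝ,
    ∀ a b : ℝ, N ≤ b - a → ∀ V ∈ transportersOn U π 1 ρ (rightCone a φ),
      ∀ W ∈ transportersOn U π h σ (leftCone b ψ), ‖braidApprox π R h ρ σ V W - e‖ ≤ η

variable {P₀ : ConePair} {g h : G} {ρ σ : SpinAlg d →⋆ₐ[ℂ] (H →L[ℂ] H)}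
  (hR : ∀ (g : G) (A : SpinAlg d),
      (R g : H →L[ℂ] H) * π A * star (R g : H →L[ℂ] H) = π (onSite U Set.univ g A))

include hR

/-- The error made by changing `W` is the extent to which `V` fails to trivialise `ρ` on `W' W^*`. -/
theorem norm_braidApprox_sub_right {V W W' : H →L[ℂ] H} (hVu : V ∈ unitary (H →L[ℂ] H))
    (hV : V ∈ algF π) (hWu : W ∈ unitary (H →L[ℂ] H)) (hW : W ∈ algF π)
    (hWu' : W' ∈ unitary (H →L[ℂ] H)) (hW' : W' ∈ algF π) :
    ‖braidApprox π R h ρ σ V W' - braidApprox π R h ρ σ V W‖ ≤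
      ‖V * extApply π ρ (W' * star W) * star V - W' * star W‖ := by
  have hWB := algF_le_algBl π hW
  have hWB' := algF_le_algBl π hW'
  have hVB := thetaOp_mem_algBl hR h⁻¹ (algF_le_algBl π hV)
  set s := extApply π σ (thetaOp R h⁻¹ V) with hs
  have hsu : s ∈ unitary (H →L[ℂ] H) :=
    extApply_mem_unitary σ hVB (thetaOp_mem_unitary h⁻¹ hVu)
  have hWW : extApply π ρ W' = extApply π ρ (W' * star W) * extApply π ρ W := by
    rw [← extApply_mul ρ (mul_mem hWB' (star_mem hWB)) hWB, mul_assoc,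
      Unitary.star_mul_self_of_mem hWu, mul_one]
  have key : braidApprox π R h ρ σ V W' - braidApprox π R h ρ σ V W =
      star s * (star W' * ((V * extApply π ρ (W' * star W) * star V - W' * star W) *
        (V * extApply π ρ W))) := by
    simp only [braidApprox, tensorHom, star_mul, ← hs, hWW, sub_mul, mul_sub, mul_assoc,
      star_mul_cancel hVu, star_mul_cancel hWu']
  rw [key, CStarRing.norm_mem_unitary_mul _ (Unitary.star_mem hsu),
    CStarRing.norm_mem_unitary_mul _ (Unitary.star_mem hWu'),
    CStarRing.norm_mul_mem_unitary _ (mul_mem hVu (extApply_mem_unitary ρ hWB hWu))]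

/-- The error made by changing `V` is the extent to which `W` fails to transport `σ` to the action of
`h` at `V' V^*`. -/
theorem norm_braidApprox_sub_left {V V' W : H →L[ℂ] H} (hVu : V ∈ unitary (H →L[ℂ] H))
    (hV : V ∈ algF π) (hVu' : V' ∈ unitary (H →L[ℂ] H)) (hV' : V' ∈ algF π)
    (hWu : W ∈ unitary (H →L[ℂ] H)) (hW : W ∈ algF π) :
    ‖braidApprox π R h ρ σ V' W - braidApprox π R h ρ σ V W‖ ≤
      ‖W * extApply π σ (thetaOp R h⁻¹ (V' * star V)) * star W - V' * star V‖ := by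
  have hWB := algF_le_algBl π hW
  have hVB := thetaOp_mem_algBl hR h⁻¹ (algF_le_algBl π hV)
  have hVB' := thetaOp_mem_algBl hR h⁻¹ (algF_le_algBl π (mul_mem hV' (star_mem hV)))
  set s := extApply π σ (thetaOp R h⁻¹ V) with hs
  set x := extApply π σ (thetaOp R h⁻¹ (V' * star V)) with hx
  have hsu : s ∈ unitary (H →L[ℂ] H) :=
    extApply_mem_unitary σ hVB (thetaOp_mem_unitary h⁻¹ hVu)
  have hVV : extApply π σ (thetaOp R h⁻¹ V') = x * s := by
    rw [hs, hx, ← extApply_mul σ hVB' hVB, ← thetaOp_mul, mul_assoc,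
      Unitary.star_mul_self_of_mem hVu, mul_one]
  have key : braidApprox π R h ρ σ V' W - braidApprox π R h ρ σ V W =
      star s * (star W * (star (W * x * star W - V' * star V) * (V' * extApply π ρ W))) := by
    simp only [braidApprox, tensorHom, star_mul, star_sub, star_star, ← hs, hVV, sub_mul, mul_sub,
      mul_assoc, star_mul_cancel hVu', star_mul_cancel hWu]
  rw [key, CStarRing.norm_mem_unitary_mul _ (Unitary.star_mem hsu),
    CStarRing.norm_mem_unitary_mul _ (Unitary.star_mem hWu),
    CStarRing.norm_mul_mem_unitary _ (mul_mem hVu' (extApply_mem_unitary ρ hWB hWu)), norm_star]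

/-- If the left cone is wide, then the approximate braiding is almost independent of `W`: the
operator `W' W^*` commutes with the algebra of the left cone, whose complement is a right cone of half
opening angle less than `π / 2`, so by approximate Haag duality it is almost localized in the right
cone of `V`, where `V` trivialises `ρ`. -/
theorem braidApprox_cauchy_right (hr : RightHaagDuality π) (hρ : ρ ∈ sectors U π P₀ g)
    {φ ψ : ℝ} (hφ : φ ∈ Set.Ioo 0 Real.pi) (hψ : ψ ∈ Set.Ioo 0 Real.pi) (hφψ : Real.pi < φ + ψ)
    (hψ2 : Real.pi / 2 < ψ) {η : ℝ} (hη : 0 < η) :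
    ∃ N : ℝ, ∀ a b : ℝ, N ≤ b - a → ∀ V ∈ transportersOn U π 1 ρ (rightCone a φ),
      ∀ W ∈ transportersOn U π h σ (leftCone b ψ), ∀ W' ∈ transportersOn U π h σ (leftCone b ψ),
        ‖braidApprox π R h ρ σ V W' - braidApprox π R h ρ σ V W‖ ≤ η := by
  have hφ2 := hφ.2
  have hψ3 := hψ.2
  set ε := min ((φ + ψ - Real.pi) / 2) ((ψ - Real.pi / 2) / 2) with hε
  have hε0 : 0 < ε := lt_min (by linarith) (by linarith)
  have hε1 : ε ≤ (φ + ψ - Real.pi) / 2 := min_le_left _ _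
  have hε2 : ε ≤ (ψ - Real.pi / 2) / 2 := min_le_right _ _
  obtain ⟨f, hf, r, hfr⟩ := hr.approx (ψ := Real.pi - ψ) ⟨by linarith, by linarith⟩ hε0
    (by linarith)
  obtain ⟨N, hN⟩ := eventually_atTop.1 (hf.eventually_le_const (half_pos hη))
  refine ⟨max N r, fun a b hab V hV W hW W' hW' => ?_⟩
  have hY := transporter_mul_star_mem_commutant hW' hW
  have hYu : W' * star W ∈ unitary (H →L[ℂ] H) := mul_mem hW'.1 (Unitary.star_mem hW.1)
  obtain ⟨Y₀, hY₀, hYY⟩ := hfr b _ hY (b - a) ((le_max_right _ _).trans hab)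
  have hY₀' : Y₀ ∈ vNAlg π (rightCone a φ) := by
    refine vNAlg_mono π ?_ hY₀
    rw [sub_sub_cancel]
    exact rightCone_mono le_rfl (by linarith) (by linarith) hφ2.le
  obtain ⟨n, hn⟩ := (eventually_subset_wideRight a hφ).exists
  have hf1 := hN (b - a) ((le_max_left _ _).trans hab)
  have h1 := norm_conj_extApply_right_le hR hρ hn hV (mul_mem hW'.2.1 (star_mem hW.2.1)) hY₀'
  refine (norm_braidApprox_sub_right hR hV.1 hV.2.1 hW.1 hW.2.1 hW'.1 hW'.2.1).trans (h1.trans ?_)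
  have h2 : f (b - a) * ‖W' * star W‖ ≤ η / 2 * 1 :=
    mul_le_mul hf1 (norm_le_one_of_mem_unitary hYu) (norm_nonneg _) (by positivity)
  linarith

/-- If the right cone is wide, then the approximate braiding is almost independent of `V`: the mirror
image of `braidApprox_cauchy_right`. -/
theorem braidApprox_cauchy_left (hl : LeftHaagDuality π) (hσ : σ ∈ sectors U π P₀ h)
    {φ ψ : ℝ} (hφ : φ ∈ Set.Ioo 0 Real.pi) (hψ : ψ ∈ Set.Ioo 0 Real.pi) (hφψ : Real.pi < φ + ψ)
    (hφ2 : Real.pi / 2 < φ) {η : ℝ} (hη : 0 < η) :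
    ∃ N : ℝ, ∀ a b : ℝ, N ≤ b - a → ∀ W ∈ transportersOn U π h σ (leftCone b ψ),
      ∀ V ∈ transportersOn U π 1 ρ (rightCone a φ), ∀ V' ∈ transportersOn U π 1 ρ (rightCone a φ),
        ‖braidApprox π R h ρ σ V' W - braidApprox π R h ρ σ V W‖ ≤ η := by
  have hφ3 := hφ.2
  have hψ2 := hψ.2
  set ε := min ((φ + ψ - Real.pi) / 2) ((φ - Real.pi / 2) / 2) with hε
  have hε0 : 0 < ε := lt_min (by linarith) (by linarith)
  have hε1 : ε ≤ (φ + ψ - Real.pi) / 2 := min_le_left _ _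
  have hε2 : ε ≤ (φ - Real.pi / 2) / 2 := min_le_right _ _
  obtain ⟨f, hf, r, hfr⟩ := hl.approx (ψ := Real.pi - φ) ⟨by linarith, by linarith⟩ hε0
    (by linarith)
  obtain ⟨N, hN⟩ := eventually_atTop.1 (hf.eventually_le_const (half_pos hη))
  refine ⟨max N r + 1, fun a b hab W hW V hV V' hV' => ?_⟩
  have hX := commutant_anti (compl_cone_pi_subset_rightCone a hφ)
    (transporter_mul_star_mem_commutant hV' hV)
  have hXu : V' * star V ∈ unitary (H →L[ℂ] H) := mul_mem hV'.1 (Unitary.star_mem hV.1)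
  obtain ⟨X₀, hX₀, hXX⟩ := hfr (a + 1) _ hX (b - a - 1) (by linarith [le_max_right N r])
  have hX₀' : X₀ ∈ vNAlg π (leftCone b ψ) := by
    refine vNAlg_mono π ?_ hX₀
    exact leftCone_mono (by linarith) (by linarith) (by linarith) hψ2.le
  obtain ⟨n, hn⟩ := (eventually_subset_wideLeft b hψ).exists
  have hf1 := hN (b - a - 1) (by linarith [le_max_left N r])
  have h1 := norm_conj_extApply_left_le hR hσ hn hW
    (algF_le_algBl π (mul_mem hV'.2.1 (star_mem hV.2.1))) hX₀'
  refine (norm_braidApprox_sub_left hR hV.1 hV.2.1 hV'.1 hV'.2.1 hW.1 hW.2.1).trans (h1.trans ?_)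
  have h2 : f (b - a - 1) * ‖V' * star V‖ ≤ η / 2 * 1 :=
    mul_le_mul hf1 (norm_le_one_of_mem_unitary hXu) (norm_nonneg _) (by positivity)
  linarith

/-- The approximate braiding depends, up to a small error, only on the cones. As `φ + ψ > π`, one of
the two cones has half opening angle greater than `π / 2`, so the transporter on that side is
arbitrary; it is chosen for such a large cone that replacing the transporter on the other side makes
almost no difference. -/
theorem braidApprox_cauchy (hr : RightHaagDuality π) (hl : LeftHaagDuality π)
    (hρ : ρ ∈ sectors U π P₀ g) (hσ : σ ∈ sectors U π P₀ h) {φ ψ : ℝ} (hφ : φ ∈ Set.Ioo 0 Real.pi)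
    (hψ : ψ ∈ Set.Ioo 0 Real.pi) (hφψ : Real.pi < φ + ψ) {η : ℝ} (hη : 0 < η) :
    ∃ N : ℝ, ∀ a b : ℝ, N ≤ b - a →
      ∀ V ∈ transportersOn U π 1 ρ (rightCone a φ), ∀ W ∈ transportersOn U π h σ (leftCone b ψ),
      ∀ V' ∈ transportersOn U π 1 ρ (rightCone a φ), ∀ W' ∈ transportersOn U π h σ (leftCone b ψ),
        ‖braidApprox π R h ρ σ V W - braidApprox π R h ρ σ V' W'‖ ≤ η := by
  have h4 : 0 < η / 4 := by positivity
  rcases lt_or_ge (Real.pi / 2) ψ with hψ2 | hψ2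
  · obtain ⟨N, hN⟩ := braidApprox_cauchy_right (h := h) (σ := σ) hR hr hρ hφ hψ hφψ hψ2 h4
    refine ⟨N, fun a b hab V hV W hW V' hV' W' hW' => ?_⟩
    -- replace both `W` and `W'` by a charge transporter for a left cone almost containing `V' V^*`
    have hX : V * star V' ∈ algBl π := algF_le_algBl π (mul_mem hV.2.1 (star_mem hV'.2.1))
    obtain ⟨n, ⟨X₀, hX₀, hXX⟩, hn⟩ := ((eventually_approx_of_mem_algBl hX h4).and
      (eventually_subset_wideLeft b hψ)).exists
    obtain ⟨W'', hW''⟩ := exists_transporter_left hσ n (wideAngle_mem n)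
    have hW''' := transportersOn_anti hn hW''
    have h1 := hN a b hab V hV W'' hW''' W hW
    have h2 := hN a b hab V' hV' W' hW' W'' hW'''
    have h3 := (norm_braidApprox_sub_left (ρ := ρ) (σ := σ) (h := h) hR hV'.1 hV'.2.1 hV.1 hV.2.1
      hW''.1 hW''.2.1).trans
      (norm_conj_extApply_left_le hR hσ subset_rfl hW'' hX hX₀)
    rw [← dist_eq_norm] at h1 h2 h3 ⊢
    linarith [dist_triangle4 (braidApprox π R h ρ σ V W) (braidApprox π R h ρ σ V W'')
      (braidApprox π R h ρ σ V' W'') (braidApprox π R h ρ σ V' W')]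
  · obtain ⟨N, hN⟩ := braidApprox_cauchy_left (ρ := ρ) hR hl hσ hφ hψ hφψ (by linarith) h4
    refine ⟨N, fun a b hab V hV W hW V' hV' W' hW' => ?_⟩
    -- replace both `V` and `V'` by a charge transporter for a right cone almost containing `W W'^*`
    have hYF : W * star W' ∈ algF π := mul_mem hW.2.1 (star_mem hW'.2.1)
    obtain ⟨n, ⟨Y₀, hY₀, hYY⟩, hn⟩ := ((eventually_approx_of_mem_algBr (algF_le_algBr hYF) h4).and
      (eventually_subset_wideRight a hφ)).exists
    obtain ⟨V'', hV''⟩ := exists_transporter_right hρ (-n) (wideAngle_mem n)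
    have hV''' := transportersOn_anti hn hV''
    have h1 := hN a b hab W hW V'' hV''' V hV
    have h2 := hN a b hab W' hW' V' hV' V'' hV'''
    have h3 := (norm_braidApprox_sub_right (ρ := ρ) (σ := σ) (h := h) hR hV''.1 hV''.2.1
      hW'.1 hW'.2.1 hW.1 hW.2.1).trans
      (norm_conj_extApply_right_le hR hρ subset_rfl hV'' hYF hY₀)
    rw [← dist_eq_norm] at h1 h2 h3 ⊢
    linarith [dist_triangle4 (braidApprox π R h ρ σ V W) (braidApprox π R h ρ σ V'' W)
      (braidApprox π R h ρ σ V'' W') (braidApprox π R h ρ σ V' W')]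

/-- The limit along the increasing wide cones exists by the Cauchy property, applied to the fixed
opening angle `wideAngle 0 > π / 2`, and serves all pairs of cones because each cone lies in almost
all the wide ones. -/
theorem exists_isBraid (hr : RightHaagDuality π) (hl : LeftHaagDuality π)
    (hρ : ρ ∈ sectors U π P₀ g) (hσ : σ ∈ sectors U π P₀ h) : ∃ e, IsBraid U π R h ρ σ e := by
  choose V hV using fun n : ℕ => exists_transporter_right hρ (-n) (wideAngle_mem n)
  choose W hW using fun n : ℕ => exists_transporter_left hσ n (wideAngle_mem n)
  have hpi := Real.pi_gt_three
  have h0 := wideAngle_mem 0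
  have hw0 : wideAngle 0 = Real.pi - 1 := by simp [wideAngle]
  have hcauchy : CauchySeq fun n => braidApprox π R h ρ σ (V n) (W n) := by
    refine Metric.cauchySeq_iff'.2 fun η hη => ?_
    obtain ⟨N, hN⟩ := braidApprox_cauchy hR hr hl hρ hσ h0 h0 (by rw [hw0]; linarith)
      (half_pos hη)
    obtain ⟨n, hn⟩ := (eventually_le_natCast N).exists
    have hn0 : (0 : ℝ) ≤ n := Nat.cast_nonneg n
    refine ⟨n, fun m hm => ?_⟩
    have hsubR : ∀ m ≥ n, V m ∈ transportersOn U π 1 ρ (rightCone (-n) (wideAngle 0)) := fun m hm =>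
      transportersOn_anti (rightCone_mono (by simpa using hm) h0.1.le (wideAngle_mono (Nat.zero_le m))
        (wideAngle_mem m).2.le) (hV m)
    have hsubL : ∀ m ≥ n, W m ∈ transportersOn U π h σ (leftCone n (wideAngle 0)) := fun m hm =>
      transportersOn_anti (leftCone_mono (by exact_mod_cast hm) h0.1.le
        (wideAngle_mono (Nat.zero_le m)) (wideAngle_mem m).2.le) (hW m)
    rw [dist_eq_norm]
    exact (hN (-n) n (by linarith) _ (hsubR m hm) _ (hsubL m hm) _ (hsubR n le_rfl) _
      (hsubL n le_rfl)).trans_lt (by linarith)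
  obtain ⟨e, he⟩ := cauchySeq_tendsto_of_complete hcauchy
  refine ⟨e, fun φ hφ ψ hψ hφψ η hη => ?_⟩
  obtain ⟨N, hN⟩ := braidApprox_cauchy hR hr hl hρ hσ hφ hψ hφψ hη
  refine ⟨N, fun a b hab V' hV' W' hW' => ?_⟩
  refine le_of_tendsto (tendsto_const_nhds.sub he).norm ?_
  filter_upwards [eventually_subset_wideRight a hφ, eventually_subset_wideLeft b hψ] with n h1 h2
  exact hN a b hab V' hV' W' hW' _ (transportersOn_anti h1 (hV n)) _ (transportersOn_anti h2 (hW n))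

omit hR in
theorem IsBraid.isBraidingLimit {e : H →L[ℂ] H} (he : IsBraid U π R h ρ σ e) (g : G) :
    IsBraidingLimit U π R g h ρ σ e := by
  intro P Q hPQ V W hV hW
  rw [Metric.tendsto_nhds]
  intro η hη
  obtain ⟨N, hN⟩ := he P.φ₂ P.angle₂ Q.φ₁ Q.angle₁ hPQ.pi_lt_add (η / 2) (half_pos hη)
  have h1 : ∀ᶠ t : ℝ in atTop, 0 ≤ t ∧ N - Q.a₁ + P.a₂ ≤ t :=
    (eventually_ge_atTop _).and (eventually_ge_atTop _)
  filter_upwards [h1.prod_mk (eventually_ge_atTop (0 : ℝ))] with p hp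
  have hV' : V p.1 ∈ transportersOn U π 1 ρ (rightCone (P.a₂ + -p.1) P.φ₂) :=
    transporters_subset_right (P.shift (-p.1)) (hV _ hp.1.1)
  have hW' : W p.2 ∈ transportersOn U π h σ (leftCone (Q.a₁ + p.2) Q.φ₁) :=
    transporters_subset_left (Q.shift p.2) (hW _ hp.2)
  have h2 := hN _ _ (by linarith [hp.1.2, hp.2]) _ hV' _ hW'
  rw [braidApprox, ← dist_eq_norm] at h2
  linarith

omit hR in
theorem exists_pi_lt_add_wideAngle {φ : ℝ} (hφ : 0 < φ) : ∃ n, Real.pi < φ + wideAngle n := by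
  obtain ⟨n, hn⟩ := (eventually_le_wideAngle (φ := Real.pi - φ / 2) (by linarith)).exists
  exact ⟨n, by linarith⟩

omit hR in
/-- Since `ρ` is localized at `P₀`, the braiding can be computed by transporting only `σ`. -/
theorem IsBraid.tendsto_left {e : H →L[ℂ] H} (he : IsBraid U π R h ρ σ e)
    (hρ : ρ ∈ sectors U π P₀ g) {W : ℕ → H →L[ℂ] H}
    (hW : ∀ n, W n ∈ transportersOn U π h σ (wideLeft n)) :
    Tendsto (fun n => star (W n) * extApply π ρ (W n)) atTop (𝓝 e) := by
  rw [Metric.tendsto_nhds]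
  intro η hη
  obtain ⟨m, hm⟩ := exists_pi_lt_add_wideAngle P₀.angle₂.1
  obtain ⟨N, hN⟩ := he _ P₀.angle₂ _ (wideAngle_mem m) hm (η / 2) (half_pos hη)
  filter_upwards [eventually_ge_atTop m, eventually_le_natCast (N + P₀.a₂)] with n hn hn'
  have h1 := hN P₀.a₂ n (by linarith) 1 (transporters_subset_right P₀ hρ.2.2) (W n)
    (transportersOn_anti (leftCone_mono le_rfl (wideAngle_mem m).1.le (wideAngle_mono hn)
      (wideAngle_mem n).2.le) (hW n))
  rw [braidApprox, tensorHom, tensorHom, thetaOp_one_right, extApply_one, mul_one, one_mul,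
    ← dist_eq_norm] at h1
  linarith

omit hR in
/-- Since `σ` is localized at `P₀`, the braiding can be computed by transporting only `ρ`. -/
theorem IsBraid.tendsto_right {e : H →L[ℂ] H} (he : IsBraid U π R h ρ σ e)
    (hσ : σ ∈ sectors U π P₀ h) {V : ℕ → H →L[ℂ] H}
    (hV : ∀ n, V n ∈ transportersOn U π 1 ρ (wideRight n)) :
    Tendsto (fun n => star (extApply π σ (thetaOp R h⁻¹ (V n))) * V n) atTop (𝓝 e) := by
  rw [Metric.tendsto_nhds]
  intro η hη
  obtain ⟨m, hm⟩ := exists_pi_lt_add_wideAngle P₀.angle₁.1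
  rw [add_comm] at hm
  obtain ⟨N, hN⟩ := he _ (wideAngle_mem m) _ P₀.angle₁ hm (η / 2) (half_pos hη)
  filter_upwards [eventually_ge_atTop m, eventually_le_natCast (N - P₀.a₁)] with n hn hn'
  have h1 := hN (-n) P₀.a₁ (by linarith) (V n) (transportersOn_anti (rightCone_mono le_rfl
    (wideAngle_mem m).1.le (wideAngle_mono hn) (wideAngle_mem n).2.le) (hV n)) 1
    (transporters_subset_left P₀ hσ.2.2)
  rw [braidApprox, tensorHom, tensorHom, extApply_one, mul_one, one_mul, ← dist_eq_norm] at h1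
  linarith

end Braiding

/-! ### Compatibility of the extensions with tensor products, translates and morphisms -/

section Identities

variable {d : ℕ} {H : Type*} [NormedAddCommGroup H] [InnerProductSpace ℂ H] [CompleteSpace H]
  {π : SpinAlg d →⋆ₐ[ℂ] (H →L[ℂ] H)} {G : Type*} [Group G]
  {U : G →* Matrix.unitaryGroup (Fin d) ℂ} {R : G →* unitary (H →L[ℂ] H)}

omit [CompleteSpace H] in
/-- Two sequences whose difference is controlled by that of two sequences with the same limit have
the same limit. -/
theorem limit_eq_of_norm_sub_le {F F' p q : ℕ → H →L[ℂ] H} {x y z : H →L[ℂ] H}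
    (hF : Tendsto F atTop (𝓝 x)) (hF' : Tendsto F' atTop (𝓝 y)) (hp : Tendsto p atTop (𝓝 z))
    (hq : Tendsto q atTop (𝓝 z)) (h : ∀ n, ‖F n - F' n‖ ≤ ‖p n - q n‖) : x = y := by
  have h0 : Tendsto (fun n => p n - q n) atTop (𝓝 0) := by simpa using hp.sub hq
  have h1 : Tendsto (fun n => F n - F' n) atTop (𝓝 0) :=
    squeeze_zero_norm h (by simpa using h0.norm)
  exact sub_eq_zero.1 (tendsto_nhds_unique (hF.sub hF') h1)

variable {P₀ : ConePair} {g h k : G} {ρ ρ' σ σ' γ : SpinAlg d →⋆ₐ[ℂ] (H →L[ℂ] H)}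
  (hR : ∀ (g : G) (A : SpinAlg d),
      (R g : H →L[ℂ] H) * π A * star (R g : H →L[ℂ] H) = π (onSite U Set.univ g A))

theorem exists_transporters_wideLeft (hσ : σ ∈ sectors U π P₀ h) :
    ∃ W : ℕ → H →L[ℂ] H, ∀ n, W n ∈ transportersOn U π h σ (wideLeft n) := by
  choose W hW using fun n : ℕ => exists_transporter_left hσ n (wideAngle_mem n)
  exact ⟨W, hW⟩

theorem exists_transporters_wideRight (hρ : ρ ∈ sectors U π P₀ g) :
    ∃ V : ℕ → H →L[ℂ] H, ∀ n, V n ∈ transportersOn U π 1 ρ (wideRight n) := by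
  choose V hV using fun n : ℕ => exists_transporter_right hρ (-n) (wideAngle_mem n)
  exact ⟨V, hV⟩

include hR

theorem extApply_tensor (hρ : ρ ∈ sectors U π P₀ g) (hσ : σ ∈ sectors U π P₀ h)
    (hρσ : tensor π ρ σ ∈ sectors U π P₀ (g * h)) {x : H →L[ℂ] H} (hx : x ∈ algBl π) :
    extApply π (tensor π ρ σ) x = extApply π ρ (extApply π σ x) := by
  refine eq_of_eqOn_vNAlg (E := fun x => extApply π (tensor π ρ σ) x)
    (F := fun x => extApply π ρ (extApply π σ x)) 1 (fun x hx y hy => ?_) (fun x hx y hy => ?_)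
    (fun n x hx => ?_) hx
  · rw [one_mul]
    exact norm_extApply_sub_le _ hx hy
  · rw [one_mul]
    exact (norm_extApply_sub_le ρ (extApply_mem_algBl σ hx) (extApply_mem_algBl σ hy)).trans
      (norm_extApply_sub_le σ hx hy)
  · obtain ⟨P, hP⟩ := ConePair.exists_left_eq (n : ℝ) (wideAngle_mem n)
    obtain ⟨V, hV⟩ := hρ.2.1 P
    obtain ⟨W, hW⟩ := hσ.2.1 P
    have hVW := transporters_subset_left P (mul_extApply_mem_transporters hR hρ hσ hV hW)
    have hV' := transporters_subset_left P hV
    have hW' := transporters_subset_left P hW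
    rw [hP] at hVW hV' hW'
    have hWB := algF_le_algBl π hW.2.1
    have hxB := thetaOp_mem_algBl hR h (vNAlg_wideLeft_le_algBl n hx)
    change extApply π (tensor π ρ σ) x = extApply π ρ (extApply π σ x)
    rw [extApply_eq hR hρσ (n := n) subset_rfl hVW hx,
      extApply_eq hR hσ (n := n) subset_rfl hW' hx, extApply_mul ρ (mul_mem (star_mem hWB) hxB) hWB,
      extApply_mul ρ (star_mem hWB) hxB, extApply_star ρ hWB,
      extApply_eq hR hρ (n := n) subset_rfl hV' (thetaOp_mem_vNAlg hR h hx), thetaOp_thetaOp]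
    simp only [star_mul, mul_assoc]

theorem extApply_thetaRep (hρ : ρ ∈ sectors U π P₀ g) (k : G) {x : H →L[ℂ] H} (hx : x ∈ algBl π) :
    extApply π (thetaRep U R k ρ) (thetaOp R k x) = thetaOp R k (extApply π ρ x) := by
  refine eq_of_eqOn_vNAlg (E := fun x => extApply π (thetaRep U R k ρ) (thetaOp R k x))
    (F := fun x => thetaOp R k (extApply π ρ x)) 1 (fun x hx y hy => ?_) (fun x hx y hy => ?_)
    (fun n x hx => ?_) hx
  · rw [one_mul, ← norm_thetaOp_sub (R := R) k x y]
    exact norm_extApply_sub_le _ (thetaOp_mem_algBl hR k hx) (thetaOp_mem_algBl hR k hy)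
  · rw [one_mul, norm_thetaOp_sub]
    exact norm_extApply_sub_le ρ hx hy
  · obtain ⟨V, hV⟩ := exists_transporter_left hρ n (wideAngle_mem n)
    rw [extApply_eq hR hρ (n := n) subset_rfl hV hx,
      extApply_eq hR (thetaRep_mem_sectors hR k hρ) (n := n) subset_rfl
        (thetaOp_mem_transportersOn hR k hV) (thetaOp_mem_vNAlg hR k hx), thetaOp_thetaOp,
      inv_mul_cancel_right, ← thetaOp_thetaOp, thetaOp_mul, thetaOp_mul, thetaOp_star]

/-- A morphism intertwines not only the representations but also their extensions to `ℬ_l`. -/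
theorem mul_extApply_of_mem_morG (hρ : ρ ∈ sectors U π P₀ g) (hρ' : ρ' ∈ sectors U π P₀ h)
    {X : H →L[ℂ] H} (hX : X ∈ morG π ρ ρ') {z : H →L[ℂ] H} (hz : z ∈ algBl π) :
    X * extApply π ρ z = extApply π ρ' z * X := by
  refine eq_of_eqOn_vNAlg (E := fun z => X * extApply π ρ z) (F := fun z => extApply π ρ' z * X) ‖X‖
    (fun x hx y hy => ?_) (fun x hx y hy => ?_) (fun n x hx => ?_) hz
  · rw [← mul_sub]
    exact (norm_mul_le _ _).trans
      (mul_le_mul_of_nonneg_left (norm_extApply_sub_le ρ hx hy) (norm_nonneg _))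
  · rw [← sub_mul, mul_comm ‖X‖]
    exact (norm_mul_le _ _).trans
      (mul_le_mul_of_nonneg_right (norm_extApply_sub_le ρ' hx hy) (norm_nonneg _))
  · obtain ⟨V, hV⟩ := exists_transporter_left hρ n (wideAngle_mem n)
    obtain ⟨V', hV'⟩ := exists_transporter_left hρ' n (wideAngle_mem n)
    have h1 := intertwine_vNAlg (X := X) (star_mul_unitary_mem (R := R) hV.1 g)
      (star_mul_unitary_mem (R := R) hV'.1 h) (fun A hA => by
        rw [conj_star_mul, conj_star_mul, conj_rep_eq hR hV hA, conj_rep_eq hR hV' hA, hX.2]) hx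
    rw [conj_star_mul, conj_star_mul] at h1
    change X * extApply π ρ x = extApply π ρ' x * X
    rw [extApply_eq hR hρ (n := n) subset_rfl hV hx,
      extApply_eq hR hρ' (n := n) subset_rfl hV' hx, h1]

theorem tendsto_conj_extApply_left (hσ : σ ∈ sectors U π P₀ h) {W : ℕ → H →L[ℂ] H}
    (hW : ∀ n, W n ∈ transportersOn U π h σ (wideLeft n)) {X : H →L[ℂ] H} (hX : X ∈ algBl π) :
    Tendsto (fun n => W n * extApply π σ (thetaOp R h⁻¹ X) * star (W n)) atTop (𝓝 X) := by
  rw [Metric.tendsto_nhds]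
  intro η hη
  filter_upwards [eventually_approx_of_mem_algBl hX (half_pos hη)] with n ⟨X₀, hX₀, hXX⟩
  rw [dist_eq_norm]
  linarith [norm_conj_extApply_left_le hR hσ subset_rfl (hW n) hX hX₀]

theorem tendsto_conj_extApply_right (hρ : ρ ∈ sectors U π P₀ g) {V : ℕ → H →L[ℂ] H}
    (hV : ∀ n, V n ∈ transportersOn U π 1 ρ (wideRight n)) {Y : H →L[ℂ] H} (hY : Y ∈ algF π) :
    Tendsto (fun n => V n * extApply π ρ Y * star (V n)) atTop (𝓝 Y) := by
  rw [Metric.tendsto_nhds]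
  intro η hη
  filter_upwards [eventually_approx_of_mem_algBr (algF_le_algBr hY) (half_pos hη)]
    with n ⟨Y₀, hY₀, hYY⟩
  rw [dist_eq_norm]
  linarith [norm_conj_extApply_right_le hR hρ subset_rfl (hV n) hY hY₀]

/-! ### The identities satisfied by the braiding -/

omit hR in
theorem IsBraid.mem_unitary {e : H →L[ℂ] H} (he : IsBraid U π R h ρ σ e)
    (hρ : ρ ∈ sectors U π P₀ g) (hσ : σ ∈ sectors U π P₀ h) : e ∈ unitary (H →L[ℂ] H) := by
  obtain ⟨W, hW⟩ := exists_transporters_wideLeft hσ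
  exact isClosed_unitary.mem_of_tendsto (he.tendsto_left hρ hW) (Eventually.of_forall fun n =>
    mul_mem (Unitary.star_mem (hW n).1)
      (extApply_mem_unitary ρ (algF_le_algBl π (hW n).2.1) (hW n).1))

theorem IsBraid.mem_algF {e : H →L[ℂ] H} (he : IsBraid U π R h ρ σ e)
    (hρ : ρ ∈ sectors U π P₀ g) (hσ : σ ∈ sectors U π P₀ h) : e ∈ algF π := by
  obtain ⟨W, hW⟩ := exists_transporters_wideLeft hσ
  exact isClosed_algF.mem_of_tendsto (he.tendsto_left hρ hW) (Eventually.of_forall fun n =>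
    mul_mem (star_mem (hW n).2.1) (extApply_mem_algF hR hρ (hW n).2.1))

/-- With `e = lim W_n^* S_ρ(W_n)`: conjugation by `W_n` turns `σ(A)` into `π(β_h(A))` in the limit,
so `S_ρ(W_n)` carries `S_ρ(σ(A))` to `ρ(β_h(A))`, and `W_n^*` carries this to
`S_σ(Θ(h⁻¹)(ρ(β_h(A))))`. -/
theorem IsBraid.intertwines {e : H →L[ℂ] H} (he : IsBraid U π R h ρ σ e)
    (hρ : ρ ∈ sectors U π P₀ g) (hσ : σ ∈ sectors U π P₀ h) (A : SpinAlg d) :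
    e * tensor π ρ σ A = tensor π σ (thetaRep U R h⁻¹ ρ) A * e := by
  obtain ⟨W, hW⟩ := exists_transporters_wideLeft hσ
  have hlim := he.tendsto_left hρ hW
  have hB := fun n => algF_le_algBl π (hW n).2.1
  have hσB := algF_le_algBl π (rep_mem_algF hR hσ A)
  have h1 := tendsto_conj_extApply_left hR hσ hW (map_mem_algBl π (onSite U Set.univ h A))
  simp only [thetaOp_rep hR, onSite_inv_onSite, extApply_rep hR hσ] at h1
  have h2 := tendsto_extApply ρ (fun n => mul_mem (mul_mem (hB n) hσB) (star_mem (hB n)))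
    (map_mem_algBl π _) h1
  rw [extApply_rep hR hρ] at h2
  have h3 := tendsto_conj_extApply_left hR hσ hW
    (algF_le_algBl π (rep_mem_algF hR hρ (onSite U Set.univ h A)))
  have hθ : tensor π σ (thetaRep U R h⁻¹ ρ) A =
      extApply π σ (thetaOp R h⁻¹ (ρ (onSite U Set.univ h A))) := by
    rw [tensor_apply hR (thetaRep_mem_sectors hR h⁻¹ hρ), thetaRep_apply, inv_inv]
  refine limit_eq_of_norm_sub_le (hlim.mul_const (tensor π ρ σ A)) (hlim.const_mul _) h2 h3
    fun n => ?_
  have hSu := extApply_mem_unitary ρ (hB n) (hW n).1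
  have hS : extApply π ρ (W n * σ A * star (W n)) =
      extApply π ρ (W n) * extApply π ρ (σ A) * star (extApply π ρ (W n)) := by
    rw [extApply_mul ρ (mul_mem (hB n) hσB) (star_mem (hB n)), extApply_mul ρ (hB n) hσB,
      extApply_star ρ (hB n)]
  rw [hθ, tensor_apply hR hσ, hS]
  set s := extApply π σ (thetaOp R h⁻¹ (ρ (onSite U Set.univ h A)))
  set r := extApply π ρ (W n)
  have key : star (W n) * r * extApply π ρ (σ A) - s * (star (W n) * r) =
      star (W n) * ((r * extApply π ρ (σ A) * star r - W n * s * star (W n)) * r) := by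
    simp only [sub_mul, mul_sub, mul_assoc, star_mul_cancel (hW n).1,
      Unitary.star_mul_self_of_mem hSu, mul_one]
  rw [key, CStarRing.norm_mem_unitary_mul _ (Unitary.star_mem (hW n).1),
    CStarRing.norm_mul_mem_unitary _ hSu]

/-- With `e = lim W_n^* S_ρ(S_σ(W_n))`, insert `S_ρ(W_n) S_ρ(W_n)^*`. -/
theorem IsBraid.hexagon_left {e e₁ e₂ : H →L[ℂ] H} (he : IsBraid U π R k (tensor π ρ σ) γ e)
    (he₁ : IsBraid U π R k ρ γ e₁) (he₂ : IsBraid U π R k σ γ e₂) (hρ : ρ ∈ sectors U π P₀ g)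
    (hσ : σ ∈ sectors U π P₀ h) (hρσ : tensor π ρ σ ∈ sectors U π P₀ (g * h))
    (hγ : γ ∈ sectors U π P₀ k) : e = e₁ * extApply π ρ e₂ := by
  obtain ⟨W, hW⟩ := exists_transporters_wideLeft hγ
  have hB := fun n => algF_le_algBl π (hW n).2.1
  have h2 := tendsto_extApply ρ
    (fun n => mul_mem (star_mem (hB n)) (extApply_mem_algBl σ (hB n)))
    (algF_le_algBl π (he₂.mem_algF hR hσ hγ)) (he₂.tendsto_left hσ hW)
  refine tendsto_nhds_unique (he.tendsto_left hρσ hW)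
    (((he₁.tendsto_left hρ hW).mul h2).congr fun n => ?_)
  rw [extApply_tensor hR hρ hσ hρσ (hB n),
    extApply_mul ρ (star_mem (hB n)) (extApply_mem_algBl σ (hB n)), extApply_star ρ (hB n),
    mul_assoc, mul_star_cancel (extApply_mem_unitary ρ (hB n) (hW n).1)]

/-- With `e = lim S_σ(S_γ(Θ((hk)⁻¹)(V_n)))^* V_n`, insert `S_σ(Θ(h⁻¹)(V_n)) S_σ(Θ(h⁻¹)(V_n))^*`. -/
theorem IsBraid.hexagon_right {e e₁ e₂ : H →L[ℂ] H} (he : IsBraid U π R (h * k) ρ (tensor π σ γ) e)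
    (he₁ : IsBraid U π R k (thetaRep U R h⁻¹ ρ) γ e₁) (he₂ : IsBraid U π R h ρ σ e₂)
    (hρ : ρ ∈ sectors U π P₀ g) (hσ : σ ∈ sectors U π P₀ h) (hγ : γ ∈ sectors U π P₀ k)
    (hσγ : tensor π σ γ ∈ sectors U π P₀ (h * k)) : e = extApply π σ e₁ * e₂ := by
  obtain ⟨V, hV⟩ := exists_transporters_wideRight hρ
  have hB := fun n => algF_le_algBl π (hV n).2.1
  have hθ : ∀ n, thetaOp R h⁻¹ (V n) ∈ transportersOn U π 1 (thetaRep U R h⁻¹ ρ) (wideRight n) := by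
    intro n
    have := thetaOp_mem_transportersOn hR h⁻¹ (hV n)
    rwa [mul_one, mul_inv_cancel] at this
  have hθB := fun n => algF_le_algBl π (hθ n).2.1
  have hkB := fun n => thetaOp_mem_algBl hR k⁻¹ (hθB n)
  have hγB := fun n => extApply_mem_algBl γ (hkB n)
  have h2 := tendsto_extApply σ (fun n => mul_mem (star_mem (hγB n)) (hθB n))
    (algF_le_algBl π (he₁.mem_algF hR (thetaRep_mem_sectors hR h⁻¹ hρ) hγ))
    (he₁.tendsto_right hγ hθ)
  refine tendsto_nhds_unique (he.tendsto_right hσγ hV)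
    ((h2.mul (he₂.tendsto_right hσ hV)).congr fun n => ?_)
  rw [mul_inv_rev, ← thetaOp_thetaOp, extApply_tensor hR hσ hγ hσγ (hkB n),
    extApply_mul σ (star_mem (hγB n)) (hθB n), extApply_star σ (hγB n), mul_assoc,
    mul_star_cancel (extApply_mem_unitary σ (hθB n) (hθ n).1)]

/-- A morphism between the first arguments passes through `e = lim W_n^* S_ρ(W_n)`. -/
theorem IsBraid.natural_left {e e' X : H →L[ℂ] H} (he : IsBraid U π R h ρ σ e)
    (he' : IsBraid U π R h ρ' σ e') (hρ : ρ ∈ sectors U π P₀ g) (hρ' : ρ' ∈ sectors U π P₀ g)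
    (hσ : σ ∈ sectors U π P₀ h) (hX : X ∈ morG π ρ ρ') :
    e' * X = extApply π σ (thetaOp R h⁻¹ X) * e := by
  obtain ⟨W, hW⟩ := exists_transporters_wideLeft hσ
  have hB := fun n => algF_le_algBl π (hW n).2.1
  refine limit_eq_of_norm_sub_le ((he'.tendsto_left hρ' hW).mul_const X)
    ((he.tendsto_left hρ hW).const_mul _) tendsto_const_nhds
    (tendsto_conj_extApply_left hR hσ hW (algF_le_algBl π hX.1)) fun n => ?_
  have hSu := extApply_mem_unitary ρ (hB n) (hW n).1
  set s := extApply π σ (thetaOp R h⁻¹ X)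
  have key : star (W n) * extApply π ρ' (W n) * X - s * (star (W n) * extApply π ρ (W n)) =
      star (W n) * ((X - W n * s * star (W n)) * extApply π ρ (W n)) := by
    rw [mul_assoc, ← mul_extApply_of_mem_morG hR hρ hρ' hX (hB n)]
    simp only [sub_mul, mul_sub, mul_assoc, star_mul_cancel (hW n).1]
  rw [key, CStarRing.norm_mem_unitary_mul _ (Unitary.star_mem (hW n).1),
    CStarRing.norm_mul_mem_unitary _ hSu]

/-- A morphism between the second arguments passes through `e = lim S_σ(Θ(h⁻¹)(V_n))^* V_n`. -/
theorem IsBraid.natural_right {e e' Y : H →L[ℂ] H} (he : IsBraid U π R h ρ σ e)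
    (he' : IsBraid U π R h ρ σ' e') (hρ : ρ ∈ sectors U π P₀ g)
    (hσ : σ ∈ sectors U π P₀ h) (hσ' : σ' ∈ sectors U π P₀ h) (hY : Y ∈ morG π σ σ') :
    e' * extApply π ρ Y = Y * e := by
  obtain ⟨V, hV⟩ := exists_transporters_wideRight hρ
  have hB := fun n => thetaOp_mem_algBl hR h⁻¹ (algF_le_algBl π (hV n).2.1)
  refine limit_eq_of_norm_sub_le ((he'.tendsto_right hσ' hV).mul_const _)
    ((he.tendsto_right hσ hV).const_mul Y) (tendsto_conj_extApply_right hR hρ hV hY.1)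
    tendsto_const_nhds fun n => ?_
  have hSu := extApply_mem_unitary σ' (hB n) (thetaOp_mem_unitary h⁻¹ (hV n).1)
  have hcomm := mul_extApply_of_mem_morG hR hσ hσ' hY (star_mem (hB n))
  rw [extApply_star σ (hB n), extApply_star σ' (hB n)] at hcomm
  set s := extApply π σ' (thetaOp R h⁻¹ (V n))
  have key : star s * V n * extApply π ρ Y -
      Y * (star (extApply π σ (thetaOp R h⁻¹ (V n))) * V n) =
      star s * ((V n * extApply π ρ Y * star (V n) - Y) * V n) := by
    rw [← mul_assoc Y, hcomm]
    simp only [sub_mul, mul_sub, mul_assoc, Unitary.star_mul_self_of_mem (hV n).1, mul_one]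
  rw [key, CStarRing.norm_mem_unitary_mul _ (Unitary.star_mem hSu),
    CStarRing.norm_mul_mem_unitary _ (hV n).1]

theorem IsBraid.natural {e e₁ e' X Y : H →L[ℂ] H} (he : IsBraid U π R h ρ σ e)
    (he₁ : IsBraid U π R h ρ σ' e₁) (he' : IsBraid U π R h ρ' σ' e')
    (hρ : ρ ∈ sectors U π P₀ g) (hρ' : ρ' ∈ sectors U π P₀ g)
    (hσ : σ ∈ sectors U π P₀ h) (hσ' : σ' ∈ sectors U π P₀ h) (hX : X ∈ morG π ρ ρ')
    (hY : Y ∈ morG π σ σ') :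
    e' * (X * extApply π ρ Y) = Y * extApply π σ (thetaOp R h⁻¹ X) * e := by
  rw [← mul_assoc, he₁.natural_left hR he' hρ hρ' hσ' hX, mul_assoc,
    he.natural_right hR he₁ hρ hσ hσ' hY, ← mul_assoc,
    mul_extApply_of_mem_morG hR hσ hσ' hY (thetaOp_mem_algBl hR h⁻¹ (algF_le_algBl π hX.1))]

theorem IsBraid.equivariant {e e' : H →L[ℂ] H} (he : IsBraid U π R h ρ σ e)
    (he' : IsBraid U π R (k * h * k⁻¹) (thetaRep U R k ρ) (thetaRep U R k σ) e')
    (hρ : ρ ∈ sectors U π P₀ g) (hσ : σ ∈ sectors U π P₀ h) : thetaOp R k e = e' := by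
  obtain ⟨W, hW⟩ := exists_transporters_wideLeft hσ
  have h1 := he'.tendsto_left (thetaRep_mem_sectors hR k hρ)
    fun n => thetaOp_mem_transportersOn hR k (hW n)
  refine tendsto_nhds_unique ?_ h1
  refine (((continuous_thetaOp (R := R) k).tendsto e).comp (he.tendsto_left hρ hW)).congr fun n => ?_
  rw [Function.comp_apply, thetaOp_mul, thetaOp_star,
    extApply_thetaRep hR hρ k (algF_le_algBl π (hW n).2.1)]

end Identities

end SpinSET

theorem lemma2p13 {d : ℕ} (hd : 2 ≤ d) {G : Type*} [Group G] [Finite G]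
    (U : G →* Matrix.unitaryGroup (Fin d) ℂ)
    (hU : ∀ g : G, (∀ m : Matrix (Fin d) (Fin d) ℂ,
      (U g : Matrix (Fin d) (Fin d) ℂ) * m * star (U g : Matrix (Fin d) (Fin d) ℂ) = m) → g = 1)
    (ω : SpinAlg d →ₗ[ℂ] ℂ) (hω : IsPureState ω)
    (hinv : ∀ (g : G) (A : SpinAlg d), ω (onSite U Set.univ g A) = ω A)
    {H : Type*} [NormedAddCommGroup H] [InnerProductSpace ℂ H] [CompleteSpace H]
    (π : SpinAlg d →⋆ₐ[ℂ] (H →L[ℂ] H)) (Ω : H) (hπ : IsGNSTriple ω π Ω)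
    (R : G →* unitary (H →L[ℂ] H))
    (hR : ∀ (g : G) (A : SpinAlg d),
      (R g : H →L[ℂ] H) * π A * star (R g : H →L[ℂ] H) = π (onSite U Set.univ g A))
    (hr : RightHaagDuality π) (hl : LeftHaagDuality π) (P₀ : ConePair) :
    -- the extensions, tensor products and group translates of sectors are well defined
    (∀ (g : G), ∀ ρ ∈ sectors U π P₀ g, ∃! S, IsLeftExtension π ρ S) ∧
    (∀ (g h : G), ∀ ρ ∈ sectors U π P₀ g, ∀ σ ∈ sectors U π P₀ h,
      tensor π ρ σ ∈ sectors U π P₀ (g * h)) ∧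
    (∀ (k g : G), ∀ ρ ∈ sectors U π P₀ g, thetaRep U R k ρ ∈ sectors U π P₀ (k * g * k⁻¹)) ∧
    ∃ ε : G → G → (SpinAlg d →⋆ₐ[ℂ] (H →L[ℂ] H)) → (SpinAlg d →⋆ₐ[ℂ] (H →L[ℂ] H)) → (H →L[ℂ] H),
      -- the limit exists, is independent of all choices, and is a unitary of `ℱ`
      (∀ (g h : G), ∀ ρ ∈ sectors U π P₀ g, ∀ σ ∈ sectors U π P₀ h,
        IsBraidingLimit U π R g h ρ σ (ε g h ρ σ) ∧
        ε g h ρ σ ∈ unitary (H →L[ℂ] H) ∧ ε g h ρ σ ∈ algF π) ∧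
      -- intertwining property
      (∀ (g h : G), ∀ ρ ∈ sectors U π P₀ g, ∀ σ ∈ sectors U π P₀ h,
        ε g h ρ σ ∈ morG π (tensor π ρ σ) (tensor π σ (thetaRep U R h⁻¹ ρ))) ∧
      -- first hexagon identity
      (∀ (g h k : G), ∀ ρ ∈ sectors U π P₀ g, ∀ σ ∈ sectors U π P₀ h, ∀ γ ∈ sectors U π P₀ k,
        ε (g * h) k (tensor π ρ σ) γ =
          tensorHom π (tensor π ρ γ) (ε g k ρ γ) 1 * tensorHom π ρ 1 (ε h k σ γ)) ∧
      -- second hexagon identity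
      (∀ (g h k : G), ∀ ρ ∈ sectors U π P₀ g, ∀ σ ∈ sectors U π P₀ h, ∀ γ ∈ sectors U π P₀ k,
        ε g (h * k) ρ (tensor π σ γ) =
          tensorHom π σ 1 (ε (h⁻¹ * g * h) k (thetaRep U R h⁻¹ ρ) γ) *
            tensorHom π (tensor π ρ σ) (ε g h ρ σ) 1) ∧
      -- naturality
      (∀ (g h : G), ∀ ρ ∈ sectors U π P₀ g, ∀ ρ' ∈ sectors U π P₀ g,
        ∀ σ ∈ sectors U π P₀ h, ∀ σ' ∈ sectors U π P₀ h,
        ∀ X ∈ morG π ρ ρ', ∀ Y ∈ morG π σ σ',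
        ε g h ρ' σ' * tensorHom π ρ X Y = tensorHom π σ Y (thetaOp R h⁻¹ X) * ε g h ρ σ) ∧
      -- equivariance
      (∀ (g h k : G), ∀ ρ ∈ sectors U π P₀ g, ∀ σ ∈ sectors U π P₀ h,
        thetaOp R k (ε g h ρ σ) =
          ε (k * g * k⁻¹) (k * h * k⁻¹) (thetaRep U R k ρ) (thetaRep U R k σ)) := by
  classical
  have htensor : ∀ {g h : G} {ρ σ : SpinAlg d →⋆ₐ[ℂ] (H →L[ℂ] H)}, ρ ∈ sectors U π P₀ g →
      σ ∈ sectors U π P₀ h → tensor π ρ σ ∈ sectors U π P₀ (g * h) := fun hρ hσ =>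
    tensor_mem_sectors hR hr hl hρ hσ
  -- outside the sectors, where the limit need not exist, the value is irrelevant
  let ε : G → G → (SpinAlg d →⋆ₐ[ℂ] (H →L[ℂ] H)) → (SpinAlg d →⋆ₐ[ℂ] (H →L[ℂ] H)) → (H →L[ℂ] H) :=
    fun _ h ρ σ => if hex : ∃ e, IsBraid U π R h ρ σ e then hex.choose else 0
  have hε : ∀ {g h : G} {ρ σ : SpinAlg d →⋆ₐ[ℂ] (H →L[ℂ] H)}, ρ ∈ sectors U π P₀ g →
      σ ∈ sectors U π P₀ h → IsBraid U π R h ρ σ (ε g h ρ σ) := by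
    intro g h ρ σ hρ hσ
    have hex := exists_isBraid hR hr hl hρ hσ
    have hval : ε g h ρ σ = hex.choose := dif_pos hex
    rw [hval]
    exact hex.choose_spec
  refine ⟨fun g ρ hρ => ?_, fun g h ρ hρ σ hσ => htensor hρ hσ,
    fun k g ρ hρ => thetaRep_mem_sectors hR k hρ, ε, ?_, ?_, ?_, ?_, ?_, ?_⟩
  · obtain ⟨S, hS, -⟩ := exists_leftExtension hR hρ
    exact ⟨S, hS, fun T hT => hT.unique hS⟩
  · intro g h ρ hρ σ hσ
    exact ⟨(hε hρ hσ).isBraidingLimit g, (hε hρ hσ).mem_unitary hρ hσ, (hε hρ hσ).mem_algF hR hρ hσ⟩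
  · intro g h ρ hρ σ hσ
    exact ⟨(hε hρ hσ).mem_algF hR hρ hσ, (hε hρ hσ).intertwines hR hρ hσ⟩
  · intro g h k ρ hρ σ hσ γ hγ
    rw [tensorHom, tensorHom, extApply_one, mul_one, one_mul]
    exact (hε (htensor hρ hσ) hγ).hexagon_left hR (hε hρ hγ) (hε hσ hγ) hρ hσ (htensor hρ hσ) hγ
  · intro g h k ρ hρ σ hσ γ hγ
    rw [tensorHom, tensorHom, extApply_one, mul_one, one_mul]
    have hθ := thetaRep_mem_sectors hR h⁻¹ hρ
    rw [inv_inv] at hθ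
    exact (hε hρ (htensor hσ hγ)).hexagon_right hR (hε hθ hγ) (hε hρ hσ) hρ hσ hγ (htensor hσ hγ)
  · intro g h ρ hρ ρ' hρ' σ hσ σ' hσ' X hX Y hY
    exact (hε hρ hσ).natural hR (hε hρ hσ') (hε hρ' hσ') hρ hρ' hσ hσ' hX hY
  · intro g h k ρ hρ σ hσ
    exact (hε hρ hσ).equivariant hR
      (hε (thetaRep_mem_sectors hR k hρ) (thetaRep_mem_sectors hR k hσ)) hρ hσ
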